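/- All graphs are finite and simple. A graph is unicyclic if it is connected and has as many edges as vertices; it then contains exactly one cycle, whose length is its girth. For a graph $G$ on $n$ vertices with degree matrix $D(G)$ and adjacency matrix $A(G)$, let $Q(G)=D(G)+A(G)$ be its signless Laplacian matrix, and define its signless Laplacian coefficients $\varphi_0(G),\dots,\varphi_n(G)$ by $$\det(xI-Q(G))=\sum_{i=0}^{n}(-1)^i\varphi_i(G)\,x^{n-i}.$$ For two graphs $G,H$ on $n$ vertices write $G\preceq H$ if $\varphi_i(G)\le\varphi_i(H)$ for all $i=0,1,\dots,n$. The matching number of a graph is the largest number of edges in a matching. Let $\mathcal G_{\mathrm{odd}}(n,m)$ be the set of all unicyclic graphs with $n$ vertices, odd girth and matching number $m$. Let $G_3(s_1,t_1;s_2,t_2;s_3,t_3)$ be the graph obtained from a triangle $u_1u_2u_3$ by attaching $s_i$ pendent paths of length $2$ and $t_i$ pendent edges at $u_i$, for $i=1,2,3$. Put $$G_3^1=G_3(0,0;\,0,0;\,m-2,\,n-2m+1)\quad(m\ge 2),\qquad G_3^2=G_3(0,1;\,0,1;\,m-3,\,n-2m+1)\quad(m\ge 3).$$ **Theorem 4.1.**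 Let $n,m$ be non-negative integers with $n\ge 2m$. 1. If $m=2$, then $G_3^1\in\mathcal G_{\mathrm{odd}}(n,m)$ and $G_3^1\preceq G$ for every $G\in\mathcal G_{\mathrm{odd}}(n,m)$; moreover, if $G\preceq G_3^1$ for such a $G$, then $G\cong G_3^1$. 2. If $n-m\le 3$, $6\le n\le 12$ and $m\ge 3$, then $G_3^2\in\mathcal G_{\mathrm{odd}}(n,m)$ and $G_3^2\preceq G$ for every $G\in\mathcal G_{\mathrm{odd}}(n,m)$; moreover, if $G\preceq G_3^2$ for such a $G$, then $G\cong G_3^2$. 3. If $m\ge 3$ and either $n-m>3$ or $n>12$, then $G_3^1,G_3^2\in\mathcal G_{\mathrm{odd}}(n,m)$, and every $G\in\mathcal G_{\mathrm{odd}}(n,m)$ satisfies $G_3^1\preceq G$ or $G_3^2\preceq G$. Moreover, if $G\in\mathcal G_{\mathrm{odd}}(n,m)$ satisfies $G\preceq G_3^1$, then $G\cong G_3^1$, and if it satisfies $G\preceq G_3^2$, then $G\cong G_3^2$. Finally, $G_3^1$ and $G_3^2$ are not comparable: neither $G_3^1\preceq G_3^2$ nor $G_3^2\preceq G_3^1$.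 -/

import Mathlib

universe u v

namespace SignlessLaplacian

open Classical in
/-- The signless Laplacian matrix `Q(G) = D(G) + A(G)` of a finite simple graph. -/
noncomputable def signlessLaplacian {V : Type u} [Fintype V] (G : SimpleGraph V) :
    Matrix V V ℤ :=
  G.degMatrix ℤ + G.adjMatrix ℤ

open Classical in
/-- The signless Laplacian coefficient `φ_i(G)`, for `0 ≤ i ≤ n = |V|`: by definition
`det (x I - Q(G)) = ∑_{i = 0}^{n} (-1)^i φ_i(G) x^(n - i)`. -/
noncomputable def phi {V : Type u} [Fintype V] (G : SimpleGraph V) (i : ℕ) : ℤ :=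
  (-1) ^ i * (signlessLaplacian G).charpoly.coeff (Fintype.card V - i)

/-- The coefficientwise comparison of graphs on `n` vertices:
`φ_i(G) ≤ φ_i(H)` for all `i = 0, 1, …, n`. -/
def CoeffLE (n : ℕ) {V : Type u} [Fintype V] (G : SimpleGraph V)
    {W : Type v} [Fintype W] (H : SimpleGraph W) : Prop :=
  ∀ i ≤ n, phi G i ≤ phi H i

/-- The matching number: the largest number of edges of a matching of `G`
(a maximum for a finite graph). -/
noncomputable def matchingNumber {V : Type u} (G : SimpleGraph V) : ℕ :=
  sSup {k : ℕ | ∃ M : G.Subgraph, M.IsMatching ∧ M.edgeSet.ncard = k}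

/-- A finite graph is unicyclic if it is connected and has as many edges as vertices. -/
def IsUnicyclic {V : Type u} [Fintype V] (G : SimpleGraph V) : Prop :=
  G.Connected ∧ G.edgeSet.ncard = Fintype.card V

/-- `G` is a unicyclic graph with `n` vertices, odd girth and matching number `m`. -/
structure IsOddUnicyclic (n m : ℕ) {V : Type u} [Fintype V] (G : SimpleGraph V) : Prop where
  card_eq : Fintype.card V = n
  unicyclic : IsUnicyclic G
  odd_girth : Odd G.girth
  matchingNumber_eq : matchingNumber G = m

/-- The vertices of `G_g(s_1, t_1; …; s_g, t_g)`, in this order: the cycle vertices `u_i`; the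
middle vertices of the pendent paths of length two at the `u_i`; the end vertices of these
paths; the ends of the pendent edges at the `u_i`. -/
abbrev CycleVertex (g : ℕ) (s t : Fin g → ℕ) : Type :=
  Fin g ⊕ (Σ i : Fin g, Fin (s i)) ⊕ (Σ i : Fin g, Fin (s i)) ⊕ (Σ i : Fin g, Fin (t i))

/-- The edges of `G_g(s_1, t_1; …; s_g, t_g)`, each cycle edge listed in both directions and each
other edge in one. -/
def cycleRel (g : ℕ) (s t : Fin g → ℕ) : CycleVertex g s t → CycleVertex g s t → Prop
  | .inl i, .inl j => (SimpleGraph.cycleGraph g).Adj i j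
  | .inl i, .inr (.inl p) => p.1 = i
  | .inr (.inl p), .inr (.inr (.inl q)) => p = q
  | .inl i, .inr (.inr (.inr l)) => l.1 = i
  | _, _ => False

/-- The graph `G_g(s_1, t_1; …; s_g, t_g)`: a cycle `u_1 u_2 … u_g u_1` with `s_i` pendent paths
of length two and `t_i` pendent edges attached at `u_i`, for each `i`. -/
def cycleWithPendants (g : ℕ) (s t : Fin g → ℕ) : SimpleGraph (CycleVertex g s t) :=
  SimpleGraph.fromRel (cycleRel g s t)

/-- `G_3^1 = G_3(0, 0; 0, 0; m - 2, n - 2m + 1)`, meant for `m ≥ 2` and `n ≥ 2m`. -/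
abbrev G31 (n m : ℕ) :
    SimpleGraph (CycleVertex 3 ![0, 0, m - 2] ![0, 0, n - 2 * m + 1]) :=
  cycleWithPendants 3 ![0, 0, m - 2] ![0, 0, n - 2 * m + 1]

/-- `G_3^2 = G_3(0, 1; 0, 1; m - 3, n - 2m + 1)`, meant for `m ≥ 3` and `n ≥ 2m`. -/
abbrev G32 (n m : ℕ) :
    SimpleGraph (CycleVertex 3 ![0, 0, m - 3] ![1, 1, n - 2 * m + 1]) :=
  cycleWithPendants 3 ![0, 0, m - 3] ![1, 1, n - 2 * m + 1]

end SignlessLaplacian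

open SignlessLaplacian

/-! All coefficients are kept together in `phiPoly G` $=\det(1+yQ(G))$, compared coefficientwise.
This is an ordered ring with $y\ge 0$, so an inequality follows once a difference is written with
nonnegative terms.

Lower bound. A graph of the class is an odd cycle with rooted trees. For a rooted tree let
$p=\det(1+yQ)$ and let $q$ be the same determinant with the row and column of the root deleted.
Eliminating the trees leaves a cyclic tridiagonal determinant, that is, the trace of a product of
$2\times2$ transfer matrices with nonnegative entries plus twice $\prod yq_i$ (`IsPair.phiPoly_eq`,
`det_cycMat_eq_cyclicVal`). A root carrying $t$ pendent edges and $s$ pendent paths of length two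
has $q=\alpha$ and $p=\alpha+\sigma$, where
$\alpha+\sigma\varepsilon=(1+y+y\varepsilon)^t(1+3y+y^2+y(1+2y)\varepsilon)^s$ as a dual number.
Matching greedily from the leaves labels every root as covered or exposed and bounds its pair by
such a broom with the same number of vertices and the same number of marked vertices
(`Labelling.treeBound`). The cycle is then cut into letters: a covered vertex, or two consecutive
vertices paired with each other (`exists_word`). The value of a cyclic word is at least what remains
when all brooms are gathered in one place (`WordBound.wordVal_ge`), and the finitely many types of
bare words are compared with a triangle having one broom (`WordBound.oneTree_le`). The result is the
polynomial of $G_3^1$, except for a triangle with three covered vertices whose matching has as many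
edges as there are marked vertices; there the bound is the polynomial of $G_3^2$. Fewer matching
edges only lower the target (`oneTree_mono`). All this is `main_bound`.

Uniqueness. The second coefficient determines $\sum d(v)^2$, in the reverse order, because all
degree sums equal $2n$. Hence $G\preceq G_3^1$ makes $\sum d(v)^2$ as large as the maximum allowed
by a maximum matching $A$. In that case the edges outside $A$ pairwise meet, so they form a star or
a triangle; the triangle is excluded when $n-m>3$ or $m<3$, and the star forces $G_3^1$. For $G_3^2$
the lower bound first shows that the cycle is a triangle avoided by $A$, and a refined count of the
same kind finishes.

Incomparability. $\sum d(v)^2$ is larger for $G_3^1$ by $2(n-m-3)$, which excludes $G_3^2\preceq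
G_3^1$ when $n-m>3$. Evaluation at a large integer excludes $G_3^1\preceq G_3^2$. If $n-m\le 3\le
m$, then $n=6$ and $m=3$, and $G_3^2\preceq G_3^1$ is checked directly. -/

namespace SignlessLaplacian

/-! ### The coefficientwise order and the generating polynomial. -/

open Polynomial Matrix

/-- Polynomials with integer coefficients are ordered coefficientwise. -/
instance coeffPartialOrder : PartialOrder ℤ[X] where
  le f g := ∀ i, f.coeff i ≤ g.coeff i
  le_refl _ _ := le_rfl
  le_trans _ _ _ h₁ h₂ i := (h₁ i).trans (h₂ i)
  le_antisymm _ _ h₁ h₂ := Polynomial.ext fun i => le_antisymm (h₁ i) (h₂ i)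

instance coeffIsOrderedRing : IsOrderedRing ℤ[X] where
  add_le_add_left f g h k i := by simpa using h i
  zero_le_one i := by
    rw [coeff_zero, coeff_one]; split_ifs <;> simp
  mul_le_mul_of_nonneg_left f hf g h hgh i := by
    rw [coeff_mul, coeff_mul]
    exact Finset.sum_le_sum fun x _ => mul_le_mul_of_nonneg_left (hgh _) (by simpa using hf x.1)
  mul_le_mul_of_nonneg_right f hf g h hgh i := by
    rw [coeff_mul, coeff_mul]
    exact Finset.sum_le_sum fun x _ => mul_le_mul_of_nonneg_right (hgh _) (by simpa using hf x.2)

theorem X_nonneg : (0 : ℤ[X]) ≤ X := by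
  intro i
  rw [coeff_zero, coeff_X]
  split_ifs <;> simp

/-- `det (1 + y Q)`, the generating polynomial of the signless Laplacian coefficients. -/
noncomputable def phiPoly {V : Type*} [Fintype V] (G : SimpleGraph V) : ℤ[X] := by
  classical exact det (1 + (X : ℤ[X]) • (signlessLaplacian G).map C)

/-- Both sides are the sum of the principal minors of order `i`; the sign in `phi` cancels the one
in the characteristic polynomial. -/
theorem coeff_phiPoly {V : Type*} [Fintype V] (G : SimpleGraph V) (i : ℕ)
    (hi : i ≤ Fintype.card V) : (phiPoly G).coeff i = phi G i := by
  classical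
  unfold phi
  rw [charpoly_coeff_eq_sum_minors _ _ hi, phiPoly, coeff_det_one_add_X_smul_eq_sum_minors,
    ← mul_assoc, ← mul_pow]
  simp only [mul_neg, mul_one, neg_neg, one_pow, one_mul]

theorem coeff_phiPoly_of_lt {V : Type*} [Fintype V] (G : SimpleGraph V) (i : ℕ)
    (hi : Fintype.card V < i) : (phiPoly G).coeff i = 0 := by
  classical
  rw [phiPoly, coeff_det_one_add_X_smul_eq_sum_minors, Finset.powersetCard_eq_empty.2 (by simpa),
    Finset.sum_empty]

theorem coeffLE_iff {V W : Type*} [Fintype V] [Fintype W] (G : SimpleGraph V) (H : SimpleGraph W)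
    {n : ℕ} (hV : Fintype.card V = n) (hW : Fintype.card W = n) :
    CoeffLE n G H ↔ phiPoly G ≤ phiPoly H := by
  refine ⟨fun h i => ?_, fun h i hi => ?_⟩
  · by_cases hi : i ≤ n
    · rw [coeff_phiPoly _ _ (hV ▸ hi), coeff_phiPoly _ _ (hW ▸ hi)]
      exact h i hi
    · rw [coeff_phiPoly_of_lt _ _ (by omega), coeff_phiPoly_of_lt _ _ (by omega)]
  · rw [← coeff_phiPoly _ _ (hV ▸ hi), ← coeff_phiPoly _ _ (hW ▸ hi)]
    exact h i

/-! ### Bounds for rooted trees -/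

section Bounds

variable {R : Type*} [CommRing R] [PartialOrder R] [IsOrderedRing R]

theorem exists_eq_add {f g : R} (h : f ≤ g) : ∃ e : R, 0 ≤ e ∧ g = f + e :=
  ⟨g - f, sub_nonneg.2 h, by ring⟩

/-- Lower bounds for the pair `(p, q)` of a rooted tree whose root is exposed. -/
structure Exposed (y p q α σ : R) : Prop where
  hα : 0 ≤ α
  hσ : 0 ≤ σ
  hq : α ≤ q
  hp : α ≤ p
  hg : (1 + 2 * y) * α + (1 + y) * σ ≤ (1 + y) * p + y * q

/-- Lower bounds for the pair `(p, q)` of a rooted tree whose root is covered. -/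
structure Covered (y p q α σ : R) : Prop where
  hα : 0 ≤ α
  hσ : 0 ≤ σ
  hq : (1 + y) * α ≤ q
  hp : (1 + 2 * y) * α + (1 + y) * σ ≤ p

theorem exposed_single (y : R) : Exposed y 1 1 1 0 := by
  refine ⟨zero_le_one, le_rfl, le_rfl, le_rfl, ?_⟩
  rw [← sub_nonneg]; ring_nf; exact le_rfl

theorem Exposed.exists_eq {y p q α σ : R} (h : Exposed y p q α σ) :
    ∃ e₁ e₂ e₃ : R, 0 ≤ e₁ ∧ 0 ≤ e₂ ∧ 0 ≤ e₃ ∧ q = α + e₁ ∧ p = α + e₂ ∧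
      (1 + y) * p + y * q = (1 + 2 * y) * α + (1 + y) * σ + e₃ := by
  obtain ⟨e₁, he₁, hq⟩ := exists_eq_add h.hq
  obtain ⟨e₂, he₂, hp⟩ := exists_eq_add h.hp
  obtain ⟨e₃, he₃, hg⟩ := exists_eq_add h.hg
  exact ⟨e₁, e₂, e₃, he₁, he₂, he₃, hq, hp, hg⟩

theorem Covered.exists_eq {y p q α σ : R} (h : Covered y p q α σ) :
    ∃ e₁ e₂ : R, 0 ≤ e₁ ∧ 0 ≤ e₂ ∧ q = (1 + y) * α + e₁ ∧
      p = (1 + 2 * y) * α + (1 + y) * σ + e₂ := by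
  obtain ⟨e₁, he₁, hq⟩ := exists_eq_add h.hq
  obtain ⟨e₂, he₂, hp⟩ := exists_eq_add h.hp
  exact ⟨e₁, e₂, he₁, he₂, hq, hp⟩

variable [Nontrivial R]

/-- `Covered` reserves one pendent edge outside of `α` and `σ`. Counting it among the others
multiplies `α + σ ε` by `1 + y + y ε`. -/
theorem Covered.exposed {y p q α σ : R} (hy : 0 ≤ y) (h : Covered y p q α σ) :
    Exposed y p q ((1 + y) * α) ((1 + y) * σ + y * α) := by
  obtain ⟨e₁, he₁, hq⟩ := exists_eq_add h.hq
  obtain ⟨e₂, he₂, hp⟩ := exists_eq_add h.hp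
  have hα := h.hα
  have hσ := h.hσ
  subst hq hp
  refine ⟨by positivity, by positivity, ?_, ?_, ?_⟩ <;> rw [← sub_nonneg] <;> ring_nf <;>
    positivity

/-- An exposed root with a new child that is covered in its own branch. -/
theorem Exposed.join_covered {y p q α σ p' q' α' σ' : R} (hy : 0 ≤ y) (h : Exposed y p q α σ)
    (h' : Covered y p' q' α' σ') :
    Exposed y ((p' + y * q') * p + y * p' * q) ((p' + y * q') * q)
      ((1 + 3 * y + y ^ 2) * (α * α'))
      ((1 + 3 * y + y ^ 2) * (α * σ' + σ * α') + y * (1 + 2 * y) * (α * α')) := by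
  obtain ⟨e₁, e₂, e₃, he₁, he₂, he₃, hq, hp, hg⟩ := h.exists_eq
  obtain ⟨d₁, d₂, hd₁, hd₂, hq', hp'⟩ := h'.exists_eq
  have := h.hα
  have := h.hσ
  have := h'.hα
  have := h'.hσ
  refine ⟨by positivity, by positivity, ?_, ?_, ?_⟩
  · rw [← sub_nonneg, hq, hp', hq']; ring_nf; positivity
  · rw [← sub_nonneg, hp, hq, hp', hq']; ring_nf; positivity
  -- The new combination `(1 + y) p + y q` contains the old one as a factor, so the old bound `hg`,
  -- which does not follow from those for `p` and `q` alone, is inserted before expanding.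
  · rw [show (1 + y) * ((p' + y * q') * p + y * p' * q) + y * ((p' + y * q') * q) =
      (p' + y * q') * ((1 + y) * p + y * q) + (1 + y) * y * p' * q by ring, hg, ← sub_nonneg, hq,
      hp', hq']
    ring_nf; positivity

/-- An exposed root may be matched to a new child, even when that child was covered. -/
theorem Exposed.match_covered {y p q α σ p' q' α' σ' : R} (hy : 0 ≤ y) (h : Exposed y p q α σ)
    (h' : Covered y p' q' α' σ') :
    Covered y ((p' + y * q') * p + y * p' * q) ((p' + y * q') * q)
      ((1 + y) * (α * α')) ((1 + y) * (α * σ' + σ * α') + y * (α * α')) := by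
  obtain ⟨e₁, e₂, e₃, he₁, he₂, he₃, hq, hp, hg⟩ := h.exists_eq
  obtain ⟨d₁, d₂, hd₁, hd₂, hq', hp'⟩ := h'.exists_eq
  have := h.hα
  have := h.hσ
  have := h'.hα
  have := h'.hσ
  refine ⟨by positivity, by positivity, ?_, ?_⟩
  · rw [← sub_nonneg, hq, hp', hq']; ring_nf; positivity
  · rw [show (p' + y * q') * p + y * p' * q =
      ((1 + y) * p + y * q) * ((1 + y) * α') + p * (p' + y * q' - (1 + y) * ((1 + y) * α'))
        + y * q * (p' - ((1 + y) * α')) by ring, hg, ← sub_nonneg, hq, hp, hp', hq']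
    ring_nf; positivity

/-- A covered root with a new child that is covered in its own branch. -/
theorem Covered.join_covered {y p q α σ p' q' α' σ' : R} (hy : 0 ≤ y) (h : Covered y p q α σ)
    (h' : Covered y p' q' α' σ') :
    Covered y ((p' + y * q') * p + y * p' * q) ((p' + y * q') * q)
      ((1 + 3 * y + y ^ 2) * (α * α'))
      ((1 + 3 * y + y ^ 2) * (α * σ' + σ * α') + y * (1 + 2 * y) * (α * α')) := by
  obtain ⟨e₁, e₂, he₁, he₂, hq, hp⟩ := h.exists_eq
  obtain ⟨d₁, d₂, hd₁, hd₂, hq', hp'⟩ := h'.exists_eq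
  have := h.hα
  have := h.hσ
  have := h'.hα
  have := h'.hσ
  refine ⟨by positivity, by positivity, ?_, ?_⟩
  · rw [← sub_nonneg, hq, hp', hq']; ring_nf; positivity
  · rw [← sub_nonneg, hp, hq, hp', hq']; ring_nf; positivity

/-- A covered root with a new child that is exposed in its own branch. -/
theorem Covered.join_exposed {y p q α σ p' q' α' σ' : R} (hy : 0 ≤ y) (h : Covered y p q α σ)
    (h' : Exposed y p' q' α' σ') :
    Covered y ((p' + y * q') * p + y * p' * q) ((p' + y * q') * q)
      ((1 + y) * (α * α')) ((1 + y) * (α * σ' + σ * α') + y * (α * α')) := by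
  obtain ⟨e₁, e₂, he₁, he₂, hq, hp⟩ := h.exists_eq
  obtain ⟨d₁, d₂, d₃, hd₁, hd₂, hd₃, hq', hp', hg'⟩ := h'.exists_eq
  have := h.hα
  have := h.hσ
  have := h'.hα
  have := h'.hσ
  refine ⟨by positivity, by positivity, ?_, ?_⟩
  · rw [← sub_nonneg, hq, hp', hq']; ring_nf; positivity
  · rw [show (p' + y * q') * p + y * p' * q =
      ((1 + y) * p' + y * q') * ((1 + y) * α) + (p' + y * q') * (p - (1 + y) * α)
        + y * p' * (q - (1 + y) * α) by ring, hg', ← sub_nonneg, hq, hp, hp', hq']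
    ring_nf; positivity

/-- A single root matched to an exposed child. -/
theorem Exposed.match_single {y p' q' α' σ' : R} (hy : 0 ≤ y) (h' : Exposed y p' q' α' σ') :
    Covered y ((p' + y * q') * 1 + y * p' * 1) ((p' + y * q') * 1) α' σ' := by
  obtain ⟨d₁, d₂, d₃, hd₁, hd₂, hd₃, hq', hp', hg'⟩ := h'.exists_eq
  refine ⟨h'.hα, h'.hσ, ?_, ?_⟩
  · rw [← sub_nonneg, hp', hq']; ring_nf; positivity
  · rw [show (p' + y * q') * 1 + y * p' * 1 = (1 + y) * p' + y * q' by ring]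
    exact h'.hg

end Bounds

end SignlessLaplacian

namespace SignlessLaplacian

open Polynomial Matrix

/-! ### Cyclic words -/

section Words

variable {R : Type*} [CommRing R]

/-- The transfer matrix of a cycle vertex whose hanging tree has the pair `(p, q)`. -/
def transfer (y p q : R) : Matrix (Fin 2) (Fin 2) R := !![p + y * q, y * q; p, y * q]

/-- The generating polynomial of a cycle of odd length whose vertices carry the pairs in `l`. -/
def cyclicVal (y : R) (l : List (R × R)) : R :=
  ((l.map fun v => transfer y v.1 v.2).prod).trace + 2 * (l.map fun v => y * v.2).prod

theorem cyclicVal_append_comm (y : R) (l l' : List (R × R)) :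
    cyclicVal y (l ++ l') = cyclicVal y (l' ++ l) := by
  simp only [cyclicVal, List.map_append, List.prod_append]
  rw [Matrix.trace_mul_comm, mul_comm (List.prod (l.map fun v => y * v.2))]

/-- A letter: a covered cycle vertex, or two consecutive cycle vertices matched to each other. -/
inductive Letter (R : Type*)
  | single (p q : R) : Letter R
  | pair (p q p' q' : R) : Letter R

/-- The vertices of a letter. -/
def Letter.verts : Letter R → List (R × R)
  | .single p q => [(p, q)]
  | .pair p q p' q' => [(p, q), (p', q')]

/-- The vertices of a word. -/
def wordVerts (w : List (Letter R)) : List (R × R) := w.flatMap Letter.verts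

/-- The transfer matrix of a letter. -/
def Letter.mat (y : R) : Letter R → Matrix (Fin 2) (Fin 2) R
  | .single p q => !![p + y * q, y * q; p, y * q]
  | .pair p q p' q' =>
    !![(p + y * q) * (p' + y * q') + y * q * p', (p + y * q) * (y * q') + y * q * (y * q');
      p * (p' + y * q') + y * q * p', p * (y * q') + y * q * (y * q')]

/-- The contribution of a letter to the cycle term. -/
def Letter.bonus (y : R) : Letter R → R
  | .single _ q => y * q
  | .pair _ q _ q' => y * q * (y * q')

/-- The transfer matrix of a word. -/
def wordMat (y : R) (w : List (Letter R)) : Matrix (Fin 2) (Fin 2) R := (w.map (Letter.mat y)).prod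

/-- The contribution of a word to the cycle term. -/
def wordBonus (y : R) (w : List (Letter R)) : R := (w.map (Letter.bonus y)).prod

/-- The value of a cyclic word. -/
def wordVal (y : R) (w : List (Letter R)) : R := (wordMat y w).trace + 2 * wordBonus y w

theorem Letter.mat_eq (y : R) (l : Letter R) :
    (l.verts.map fun v => transfer y v.1 v.2).prod = l.mat y := by
  cases l <;> simp [Letter.verts, Letter.mat, transfer]

theorem Letter.bonus_eq (y : R) (l : Letter R) :
    (l.verts.map fun v => y * v.2).prod = l.bonus y := by
  cases l <;> simp [Letter.verts, Letter.bonus]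

theorem cyclicVal_wordVerts (y : R) (w : List (Letter R)) :
    cyclicVal y (wordVerts w) = wordVal y w := by
  have h₁ : ∀ w : List (Letter R), ((wordVerts w).map fun v => transfer y v.1 v.2).prod = wordMat y w := by
    intro w
    induction w with
    | nil => simp [wordVerts, wordMat]
    | cons l w ih =>
      simp only [wordVerts, wordMat, List.flatMap_cons, List.map_append, List.prod_append,
        Letter.mat_eq, List.map_cons, List.prod_cons] at ih ⊢
      rw [ih]
  have h₂ : ∀ w : List (Letter R), ((wordVerts w).map fun v => y * v.2).prod = wordBonus y w := by
    intro w
    induction w with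
    | nil => simp [wordVerts, wordBonus]
    | cons l w ih =>
      simp only [wordVerts, wordBonus, List.flatMap_cons, List.map_append, List.prod_append,
        Letter.bonus_eq, List.map_cons, List.prod_cons] at ih ⊢
      rw [ih]
  rw [cyclicVal, wordVal, h₁, h₂]

theorem wordVal_append_comm (y : R) (w w' : List (Letter R)) :
    wordVal y (w ++ w') = wordVal y (w' ++ w) := by
  simp only [wordVal, wordMat, wordBonus, List.map_append, List.prod_append]
  rw [Matrix.trace_mul_comm, mul_comm (List.prod (w.map (Letter.bonus y)))]

theorem wordMat_cons_apply (y : R) (l : Letter R) (w : List (Letter R)) (i j : Fin 2) :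
    wordMat y (l :: w) i j = l.mat y i 0 * wordMat y w 0 j + l.mat y i 1 * wordMat y w 1 j := by
  simp [wordMat, Matrix.mul_apply, Fin.sum_univ_two]

theorem wordVal_cons (y : R) (l : Letter R) (w : List (Letter R)) :
    wordVal y (l :: w) = l.mat y 0 0 * wordMat y w 0 0 + l.mat y 0 1 * wordMat y w 1 0 +
      (l.mat y 1 0 * wordMat y w 0 1 + l.mat y 1 1 * wordMat y w 1 1) +
      2 * (l.bonus y * wordBonus y w) := by
  rw [wordVal, Matrix.trace_fin_two, wordMat_cons_apply, wordMat_cons_apply]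
  simp [wordBonus]

/-- The letter obtained by replacing all trees by the smallest ones. -/
def Letter.base (y : R) : Letter R → Letter R
  | .single _ _ => .single (1 + 2 * y) (1 + y)
  | .pair _ _ _ _ => .pair 1 1 1 1

variable [PartialOrder R]

/-- Lower bounds for all trees of a word, multiplied together as dual numbers. -/
inductive WordBound (y : R) : List (Letter R) → R → R → Prop
  | nil : WordBound y [] 1 0
  | single {p q α σ : R} (h : Covered y p q α σ) {w : List (Letter R)} {α' σ' : R}
      (hw : WordBound y w α' σ') :
      WordBound y (.single p q :: w) (α * α') (α * σ' + σ * α')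
  | pair {p q α σ p' q' α' σ' : R} (h : Exposed y p q α σ) (h' : Exposed y p' q' α' σ')
      {w : List (Letter R)} {α'' σ'' : R} (hw : WordBound y w α'' σ'') :
      WordBound y (.pair p q p' q' :: w) (α * α' * α'')
        (α * α' * σ'' + (α * σ' + σ * α') * α'')

theorem WordBound.append {y : R} {w w' : List (Letter R)} {α σ α' σ' : R}
    (h : WordBound y w α σ) (h' : WordBound y w' α' σ') :
    WordBound y (w ++ w') (α * α') (α * σ' + σ * α') := by
  induction h with
  | nil => simpa using h'
  | single hc _ ih => convert WordBound.single hc ih using 1 <;> first | rfl | ring1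
  | pair he he' _ ih => convert WordBound.pair he he' ih using 1 <;> first | rfl | ring1

variable [IsOrderedRing R]

theorem WordBound.nonneg {y : R} {w : List (Letter R)} {α σ : R} (h : WordBound y w α σ) :
    0 ≤ α ∧ 0 ≤ σ := by
  induction h with
  | nil => exact ⟨zero_le_one, le_rfl⟩
  | single h _ ih =>
    obtain ⟨h₁, h₂⟩ := ih
    have := h.hα
    have := h.hσ
    constructor <;> positivity
  | pair h h' _ ih =>
    obtain ⟨h₁, h₂⟩ := ih
    have := h.hα
    have := h.hσ
    have := h'.hα
    have := h'.hσ
    constructor <;> positivity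

theorem Covered.leaf {y : R} : Covered y (1 + 2 * y) (1 + y) 1 0 :=
  ⟨zero_le_one, le_rfl, by simp, by simp⟩

theorem wordBound_base (y : R) (w : List (Letter R)) : WordBound y (w.map (Letter.base y)) 1 0 := by
  induction w with
  | nil => exact .nil
  | cons l w ih =>
    cases l with
    | single p q => convert WordBound.single Covered.leaf ih using 1 <;> simp [Letter.base]
    | pair p q p' q' =>
      convert WordBound.pair (exposed_single y) (exposed_single y) ih using 1 <;> simp [Letter.base]

variable [Nontrivial R]

/-- A transfer matrix is bounded below by a multiple of that of a vertex with a pendent edge. -/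
structure MatBound (y A : R) (M : Matrix (Fin 2) (Fin 2) R) : Prop where
  h00 : A * (1 + 3 * y + y ^ 2) ≤ M 0 0
  h01 : A * (y * (1 + y)) ≤ M 0 1
  h10 : A * (1 + 2 * y) ≤ M 1 0
  h11 : A * (y * (1 + y)) ≤ M 1 1

theorem Covered.matBound {y p q α σ : R} (hy : 0 ≤ y) (h : Covered y p q α σ) :
    MatBound y α ((Letter.single p q).mat y) := by
  obtain ⟨e₁, e₂, he₁, he₂, rfl, rfl⟩ := h.exists_eq
  have := h.hα
  have := h.hσ
  refine ⟨?_, ?_, ?_, ?_⟩ <;> simp only [Letter.mat, Matrix.of_apply, Matrix.cons_val] <;>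
    rw [← sub_nonneg] <;> ring_nf <;> positivity

/-- Two bare consecutive vertices have a transfer matrix that dominates entrywise the one of a
single vertex with a leaf, so letters of both kinds obey the same bound. -/
theorem Exposed.matBound {y p q α σ p' q' α' σ' : R} (hy : 0 ≤ y) (h : Exposed y p q α σ)
    (h' : Exposed y p' q' α' σ') :
    MatBound y (α * α') ((Letter.pair p q p' q').mat y) := by
  obtain ⟨e₁, e₂, e₃, he₁, he₂, -, rfl, rfl, -⟩ := h.exists_eq
  obtain ⟨d₁, d₂, d₃, hd₁, hd₂, -, rfl, rfl, -⟩ := h'.exists_eq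
  have := h.hα
  have := h'.hα
  refine ⟨?_, ?_, ?_, ?_⟩ <;> simp only [Letter.mat, Matrix.of_apply, Matrix.cons_val] <;>
    rw [← sub_nonneg] <;> ring_nf <;> positivity

/-- Lower bounds for the transfer matrix of a word with `k` letters. -/
structure ContextBound (y α : R) (k : ℕ) (M : Matrix (Fin 2) (Fin 2) R) : Prop where
  h00 : α * (1 + 3 * y + y ^ 2) ^ k ≤ M 0 0
  h01 : 0 ≤ M 0 1
  h10 : 0 ≤ M 1 0
  h11 : 0 ≤ M 1 1
  hrow : 2 ≤ k → α * ((1 + 3 * y + y ^ 2) ^ (k - 1) * (1 + 5 * y + 3 * y ^ 2)) ≤ M 0 0 + M 0 1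
  hrow₀ : k = 0 → α ≤ M 0 0 + M 0 1 ∧ α ≤ M 1 0 + M 1 1
  hrow₁ : k = 1 → α * (1 + 4 * y + 2 * y ^ 2) ≤ M 0 0 + M 0 1 ∧
    α * (1 + 3 * y + y ^ 2) ≤ M 1 0 + M 1 1

/-- The first row sum of a product involves both row sums of the right factor. Zero letters and one
letter are recorded separately, since the factor `1 + 5 * y + 3 * y ^ 2` appears only from the
second letter on; afterwards the diagonal entry alone propagates it. -/
theorem ContextBound.cons {y A α : R} (hy : 0 ≤ y) (hA : 0 ≤ A) (hα : 0 ≤ α) {k : ℕ}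
    {L M : Matrix (Fin 2) (Fin 2) R} (hL : MatBound y A L) (hM : ContextBound y α k M) :
    ContextBound y (A * α) (k + 1) (L * M) := by
  have hb : (0 : R) ≤ 1 + 3 * y + y ^ 2 := by positivity
  have l00 : 0 ≤ L 0 0 := le_trans (by positivity) hL.h00
  have l01 : 0 ≤ L 0 1 := le_trans (by positivity) hL.h01
  have l10 : 0 ≤ L 1 0 := le_trans (by positivity) hL.h10
  have l11 : 0 ≤ L 1 1 := le_trans (by positivity) hL.h11
  have m00 : 0 ≤ M 0 0 := le_trans (by positivity) hM.h00
  have m01 := hM.h01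
  have m10 := hM.h10
  have m11 := hM.h11
  have hmul : ∀ i j, (L * M) i j = L i 0 * M 0 j + L i 1 * M 1 j := fun i j => by
    simp [Matrix.mul_apply, Fin.sum_univ_two]
  refine ⟨?_, ?_, ?_, ?_, ?_, fun h => absurd h (by omega), ?_⟩
  · rw [hmul]
    calc _ = (A * (1 + 3 * y + y ^ 2)) * (α * (1 + 3 * y + y ^ 2) ^ k) := by ring
      _ ≤ L 0 0 * M 0 0 := mul_le_mul hL.h00 hM.h00 (by positivity) l00
      _ ≤ _ := le_add_of_nonneg_right (by positivity)
  · rw [hmul]; positivity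
  · rw [hmul]; positivity
  · rw [hmul]; positivity
  · intro hk
    have key : (L * M) 0 0 + (L * M) 0 1 =
        L 0 0 * (M 0 0 + M 0 1) + L 0 1 * (M 1 0 + M 1 1) := by rw [hmul, hmul]; ring
    rw [key]
    rcases Nat.lt_or_ge k 2 with h | h
    · obtain rfl : k = 1 := by omega
      obtain ⟨h₁, h₂⟩ := hM.hrow₁ rfl
      calc _ = (A * (1 + 3 * y + y ^ 2)) * (α * (1 + 4 * y + 2 * y ^ 2)) +
            (A * (y * (1 + y))) * (α * (1 + 3 * y + y ^ 2)) := by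
              simp only [Nat.add_sub_cancel]; ring
        _ ≤ _ := add_le_add (mul_le_mul hL.h00 h₁ (by positivity) l00)
            (mul_le_mul hL.h01 h₂ (by positivity) l01)
    · obtain ⟨j, rfl⟩ : ∃ j, k = j + 1 := ⟨k - 1, by omega⟩
      have h₁ := hM.hrow h
      calc _ = (A * (1 + 3 * y + y ^ 2)) * (α * ((1 + 3 * y + y ^ 2) ^ j *
              (1 + 5 * y + 3 * y ^ 2))) := by
              simp only [Nat.add_sub_cancel]; ring
        _ ≤ L 0 0 * (M 0 0 + M 0 1) := mul_le_mul hL.h00 h₁ (by positivity) l00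
        _ ≤ _ := le_add_of_nonneg_right (by positivity)
  · intro hk
    obtain rfl : k = 0 := by omega
    obtain ⟨h₁, h₂⟩ := hM.hrow₀ rfl
    constructor
    · calc _ = (A * (1 + 3 * y + y ^ 2)) * α + (A * (y * (1 + y))) * α := by ring
        _ ≤ L 0 0 * (M 0 0 + M 0 1) + L 0 1 * (M 1 0 + M 1 1) :=
            add_le_add (mul_le_mul hL.h00 h₁ hα l00) (mul_le_mul hL.h01 h₂ hα l01)
        _ = _ := by rw [hmul, hmul]; ring
    · calc _ = (A * (1 + 2 * y)) * α + (A * (y * (1 + y))) * α := by ring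
        _ ≤ L 1 0 * (M 0 0 + M 0 1) + L 1 1 * (M 1 0 + M 1 1) :=
            add_le_add (mul_le_mul hL.h10 h₁ hα l10) (mul_le_mul hL.h11 h₂ hα l11)
        _ = _ := by rw [hmul, hmul]; ring

theorem WordBound.contextBound {y : R} (hy : 0 ≤ y) {w : List (Letter R)} {α σ : R}
    (h : WordBound y w α σ) : ContextBound y α w.length (wordMat y w) := by
  induction h with
  | nil => exact ⟨by simp [wordMat], by simp [wordMat], by simp [wordMat], by simp [wordMat],
      by simp, by simp [wordMat], by simp⟩
  | single hc hw ih =>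
    have := ih.cons hy hc.hα hw.nonneg.1 (hc.matBound hy)
    simpa [wordMat] using this
  | pair he he' hw ih =>
    have := ih.cons hy (mul_nonneg he.hα he'.hα) hw.nonneg.1 (he.matBound hy he')
    simpa [wordMat] using this

theorem WordBound.bonus_nonneg {y : R} (hy : 0 ≤ y) {w : List (Letter R)} {α σ : R}
    (h : WordBound y w α σ) : 0 ≤ wordBonus y w := by
  induction h with
  | nil => simp [wordBonus]
  | @single p q α σ hc w α' σ' hw ih =>
    have : 0 ≤ q := le_trans (by have := hc.hα; positivity) hc.hq
    simp only [wordBonus, List.map_cons, List.prod_cons, Letter.bonus] at ih ⊢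
    positivity
  | @pair p q α σ p' q' α' σ' he he' w α'' σ'' hw ih =>
    have : 0 ≤ q := he.hα.trans he.hq
    have : 0 ≤ q' := he'.hα.trans he'.hq
    simp only [wordBonus, List.map_cons, List.prod_cons, Letter.bonus] at ih ⊢
    positivity

/-- Replacing the trees of one letter by the smallest ones. -/
theorem wordVal_single_ge_sharp {y : R} (hy : 0 ≤ y) {p q α σ : R} (h : Covered y p q α σ)
    {w : List (Letter R)} {α' σ' : R} (hw : WordBound y w α' σ') (hk : 2 ≤ w.length) :
    α * wordVal y (.single (1 + 2 * y) (1 + y) :: w) +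
      σ * α' * ((1 + y) * (1 + 3 * y + y ^ 2) ^ (w.length - 1) * (1 + 5 * y + 3 * y ^ 2)) ≤
      wordVal y (.single p q :: w) := by
  obtain ⟨e₁, e₂, he₁, he₂, rfl, rfl⟩ := h.exists_eq
  have hM := hw.contextBound hy
  have hα' := hw.nonneg.1
  have hβ := hw.bonus_nonneg hy
  have m00 : 0 ≤ wordMat y w 0 0 := le_trans (by positivity) hM.h00
  have m01 := hM.h01
  have m10 := hM.h10
  have m11 := hM.h11
  have hσ := h.hσ
  obtain ⟨d, hd, hrow⟩ := exists_eq_add (hM.hrow hk)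
  -- The value is affine in the pair, and the surplus of `p` meets exactly the first row sum of the
  -- remaining word, which `hrow` bounds.
  have key : wordVal y (.single ((1 + 2 * y) * α + (1 + y) * σ + e₂) ((1 + y) * α + e₁) :: w) =
      α * wordVal y (.single (1 + 2 * y) (1 + y) :: w) +
      ((1 + y) * σ + e₂) * (wordMat y w 0 0 + wordMat y w 0 1) +
      e₁ * (y * (wordMat y w 0 0 + wordMat y w 1 0 + wordMat y w 1 1)) +
      2 * (y * e₁ * wordBonus y w) := by
    rw [wordVal_cons, wordVal_cons]
    simp only [Letter.mat, Letter.bonus, Matrix.of_apply, Matrix.cons_val]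
    ring
  rw [key, hrow, ← sub_nonneg]
  have : 0 ≤ (1 + 3 * y + y ^ 2) ^ (w.length - 1) := by positivity
  set P := (1 + 3 * y + y ^ 2) ^ (w.length - 1)
  have h2 : 0 ≤ e₂ * (α' * (P * (1 + 5 * y + 3 * y ^ 2)) + d) := by positivity
  have h3 : 0 ≤ e₁ * (y * (wordMat y w 0 0 + wordMat y w 1 0 + wordMat y w 1 1)) := by positivity
  have h4 : 0 ≤ (1 + y) * σ * d := by positivity
  have h5 : 0 ≤ 2 * (y * e₁ * wordBonus y w) := by positivity
  calc (0 : R) ≤ _ := add_nonneg (add_nonneg h2 h3) (add_nonneg h4 h5)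
    _ = _ := by ring

/-- Replacing the trees of one letter by the smallest ones. -/
theorem wordVal_single_ge {y : R} (hy : 0 ≤ y) {p q α σ : R} (h : Covered y p q α σ)
    {w : List (Letter R)} {α' σ' : R} (hw : WordBound y w α' σ') (hk : 2 ≤ w.length) :
    α * wordVal y (.single (1 + 2 * y) (1 + y) :: w) +
      σ * α' * ((1 + y) ^ 2 * (1 + 3 * y + y ^ 2) ^ (w.length - 1) * (1 + 3 * y)) ≤
      wordVal y (.single p q :: w) := by
  refine le_trans ?_ (wordVal_single_ge_sharp hy h hw hk)
  have hσ := h.hσ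
  have hα' := hw.nonneg.1
  have h0 : 0 ≤ σ * α' * ((1 + y) * (1 + 3 * y + y ^ 2) ^ (w.length - 1) * y) := by positivity
  rw [← sub_nonneg]
  refine h0.trans_eq ?_
  ring

/-- Replacing the tree at the first vertex of a pair by the smallest one. -/
theorem wordVal_pair_left_ge {y : R} (hy : 0 ≤ y) {p q α σ p' q' α' σ' : R}
    (h : Exposed y p q α σ) (h' : Exposed y p' q' α' σ')
    {w : List (Letter R)} {α'' σ'' : R} (hw : WordBound y w α'' σ'') (hk : 2 ≤ w.length) :
    α * wordVal y (.pair 1 1 p' q' :: w) +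
      σ * (α' * α'') * ((1 + y) ^ 2 * (1 + 3 * y + y ^ 2) ^ (w.length - 1) * (1 + 3 * y)) ≤
      wordVal y (.pair p q p' q' :: w) := by
  have hM := hw.contextBound hy
  have hα'' := hw.nonneg.1
  have hβ := hw.bonus_nonneg hy
  have m01 := hM.h01
  have m10 := hM.h10
  have m11 := hM.h11
  have hσ := h.hσ
  have hα := h.hα
  have hα' := h'.hα
  obtain ⟨d, hd, hrow⟩ := exists_eq_add (hM.hrow hk)
  obtain ⟨d', hd', hm00⟩ := exists_eq_add hM.h00
  obtain ⟨e₁, e₂, e₃, he₁, he₂, he₃, hq, hp, hg⟩ := h.exists_eq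
  obtain ⟨f₁, f₂, f₃, hf₁, hf₂, -, rfl, rfl, -⟩ := h'.exists_eq
  obtain ⟨j, hj⟩ : ∃ j, w.length = j + 1 := ⟨w.length - 1, by omega⟩
  rw [hj, pow_succ] at hm00
  rw [hj] at hrow ⊢
  simp only [Nat.add_sub_cancel] at hrow ⊢
  have : 0 ≤ (1 + 3 * y + y ^ 2) ^ j := by positivity
  set P := (1 + 3 * y + y ^ 2) ^ j
  have m00 : 0 ≤ wordMat y w 0 0 := by rw [hm00]; positivity
  set K := α' * α'' * ((1 + y) * P * (1 + 3 * y)) with hK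
  set β := wordBonus y w
  set r00 := wordMat y w 0 0
  set r01 := wordMat y w 0 1
  set r10 := wordMat y w 1 0
  set r11 := wordMat y w 1 1
  set κ := (α' + f₂ + y * (α' + f₁)) * (r00 + r01) + y * (α' + f₁) * (r10 + r11) with hκ
  set μ := y * (α' + f₂ + y * (α' + f₁)) * r00 + y * (α' + f₂) * r00 +
    2 * (y ^ 2 * (α' + f₁) * r10) + y * (α' + f₂) * r01 + y ^ 2 * (α' + f₁) * r11 +
    2 * (y ^ 2 * (α' + f₁) * β) with hμ
  -- The value is linear in the pair, `p κ + q μ`. Since `κ ≥ (1 + y) K` and `μ ≥ y K`, the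
  -- combination `(1 + y) p + y q` controlled by `Exposed.hg` splits off with weight `K`; the rest
  -- needs only `α ≤ p` and `α ≤ q`.
  have hval : ∀ p q : R, wordVal y (.pair p q (α' + f₂) (α' + f₁) :: w) = p * κ + q * μ := by
    intro p q
    rw [wordVal_cons]
    simp only [Letter.mat, Letter.bonus, Matrix.of_apply, Matrix.cons_val]
    ring
  have hκK : 0 ≤ κ - (1 + y) * K := by
    rw [hκ, hrow, hK]; ring_nf; positivity
  have hμK : 0 ≤ μ - y * K := by
    have h0 : 0 ≤ 2 * (y ^ 2 * (α' + f₁) * r10) + y * (α' + f₂) * r01 +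
      y ^ 2 * (α' + f₁) * r11 + 2 * (y ^ 2 * (α' + f₁) * β) := by positivity
    have h1 : 0 ≤ y * (α' + f₂ + y * (α' + f₁)) * r00 + y * (α' + f₂) * r00 - y * K := by
      rw [hm00, hK]; ring_nf; positivity
    refine (add_nonneg h0 h1).trans_eq ?_
    rw [hμ]; ring
  rw [hval, hval, show p * κ + q * μ = ((1 + y) * p + y * q) * K + p * (κ - (1 + y) * K) +
    q * (μ - y * K) by ring, hg, hp, hq, ← sub_nonneg]
  have h0 : 0 ≤ e₃ * K + e₂ * (κ - (1 + y) * K) + e₁ * (μ - y * K) := by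
    have hK0 : 0 ≤ K := by rw [hK]; positivity
    exact add_nonneg (add_nonneg (mul_nonneg he₃ hK0) (mul_nonneg he₂ hκK)) (mul_nonneg he₁ hμK)
  refine h0.trans_eq ?_
  rw [hK]; ring

/-- Replacing the tree at the second vertex of a pair by the smallest one. -/
theorem wordVal_pair_right_ge {y : R} (hy : 0 ≤ y) {p q α σ p' q' α' σ' : R}
    (h : Exposed y p q α σ) (h' : Exposed y p' q' α' σ')
    {w : List (Letter R)} {α'' σ'' : R} (hw : WordBound y w α'' σ'') (hk : 2 ≤ w.length) :
    α' * wordVal y (.pair p q 1 1 :: w) +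
      σ' * (α * α'') * ((1 + y) ^ 2 * (1 + 3 * y + y ^ 2) ^ (w.length - 1) * (1 + 3 * y)) ≤
      wordVal y (.pair p q p' q' :: w) := by
  have hM := hw.contextBound hy
  have hα'' := hw.nonneg.1
  have hβ := hw.bonus_nonneg hy
  have m01 := hM.h01
  have m10 := hM.h10
  have m11 := hM.h11
  have hσ' := h'.hσ
  have hα := h.hα
  have hα' := h'.hα
  obtain ⟨d, hd, hrow⟩ := exists_eq_add (hM.hrow hk)
  have m00 : 0 ≤ wordMat y w 0 0 := le_trans (by positivity) hM.h00
  obtain ⟨e₁, e₂, e₃, he₁, he₂, he₃, hq, hp, hg⟩ := h'.exists_eq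
  obtain ⟨f₁, f₂, f₃, hf₁, hf₂, -, rfl, rfl, -⟩ := h.exists_eq
  have : 0 ≤ (1 + 3 * y + y ^ 2) ^ (w.length - 1) := by positivity
  set P := (1 + 3 * y + y ^ 2) ^ (w.length - 1)
  set K := α * α'' * ((1 + y) * P * (1 + 3 * y)) with hK
  set β := wordBonus y w
  set r00 := wordMat y w 0 0
  set r01 := wordMat y w 0 1
  set r10 := wordMat y w 1 0
  set r11 := wordMat y w 1 1
  set κ := (α + f₂ + y * (α + f₁)) * (r00 + r01) + y * (α + f₁) * r00 with hκ
  set μ := y * (α + f₂) * (r00 + r01) + y ^ 2 * (α + f₁) * r00 +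
    (y * (α + f₂ + y * (α + f₁)) + y ^ 2 * (α + f₁)) * r10 +
    (y * (α + f₂) + y ^ 2 * (α + f₁)) * r11 + 2 * (y ^ 2 * (α + f₁) * β) with hμ
  have hval : ∀ p q : R, wordVal y (.pair (α + f₂) (α + f₁) p q :: w) = p * κ + q * μ := by
    intro p q
    rw [wordVal_cons]
    simp only [Letter.mat, Letter.bonus, Matrix.of_apply, Matrix.cons_val]
    ring
  have hκK : 0 ≤ κ - (1 + y) * K := by
    rw [hκ, hrow, hK]; ring_nf; positivity
  have hμK : 0 ≤ μ - y * K := by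
    rw [hμ, hrow, hK]; ring_nf; positivity
  rw [hval, hval, show p' * κ + q' * μ = ((1 + y) * p' + y * q') * K + p' * (κ - (1 + y) * K) +
    q' * (μ - y * K) by ring, hg, hp, hq, ← sub_nonneg]
  have h0 : 0 ≤ e₃ * K + e₂ * (κ - (1 + y) * K) + e₁ * (μ - y * K) := by
    have hK0 : 0 ≤ K := by rw [hK]; positivity
    exact add_nonneg (add_nonneg (mul_nonneg he₃ hK0) (mul_nonneg he₂ hκK)) (mul_nonneg he₁ hμK)
  refine h0.trans_eq ?_
  rw [hK]; ring

/-- All trees of a word may be replaced by the smallest ones. -/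
theorem WordBound.wordVal_ge {y : R} (hy : 0 ≤ y) {w : List (Letter R)} {α σ : R}
    (h : WordBound y w α σ) (hk : 3 ≤ w.length) :
    α * wordVal y (w.map (Letter.base y)) +
      σ * ((1 + y) ^ 2 * (1 + 3 * y + y ^ 2) ^ (w.length - 2) * (1 + 3 * y)) ≤ wordVal y w := by
  -- The list `v` holds letters that are already reduced. A reduced letter is rotated to the end of
  -- the cyclic word, which brings the next one to the front while the total length stays fixed.
  suffices H : ∀ v : List (Letter R), 3 ≤ w.length + v.length →
      α * wordVal y (w.map (Letter.base y) ++ v.map (Letter.base y)) +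
        σ * ((1 + y) ^ 2 * (1 + 3 * y + y ^ 2) ^ (w.length + v.length - 2) * (1 + 3 * y)) ≤
        wordVal y (w ++ v.map (Letter.base y)) by
    simpa using H [] (by simpa using hk)
  clear hk
  induction h with
  | nil => intro v _; simp
  | @single p q α σ hc w α' σ' hw ih =>
    intro v hv
    simp only [List.length_cons] at hv
    have hctx := hw.append (wordBound_base y v)
    have h₁ := wordVal_single_ge hy hc hctx (by simp; omega)
    have h₂ := ih (v ++ [.single p q]) (by simp; omega)
    have e₁ : wordVal y (w ++ List.map (Letter.base y) (v ++ [.single p q])) =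
        wordVal y (.single (1 + 2 * y) (1 + y) :: (w ++ v.map (Letter.base y))) := by
      rw [List.map_append, ← List.append_assoc]
      exact wordVal_append_comm _ _ _
    have e₂ : wordVal y (w.map (Letter.base y) ++ List.map (Letter.base y) (v ++ [.single p q])) =
        wordVal y (.single (1 + 2 * y) (1 + y) ::
          (w.map (Letter.base y) ++ v.map (Letter.base y))) := by
      rw [List.map_append, ← List.append_assoc]
      exact wordVal_append_comm _ _ _
    rw [e₁, e₂] at h₂
    simp only [List.length_append, List.length_map, List.length_cons, List.length_nil,
      List.map_cons, List.cons_append, mul_one, zero_add] at h₁ h₂ ⊢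
    rw [show w.length + (v.length + 1) - 2 = w.length + v.length - 1 by omega] at h₂
    rw [show w.length + 1 + v.length - 2 = w.length + v.length - 1 by omega]
    have h₃ := mul_le_mul_of_nonneg_left h₂ hc.hα
    refine le_trans (le_of_eq ?_) (le_trans (add_le_add_left h₃ _) h₁)
    simp only [Letter.base]
    ring
  | @pair p q α σ p' q' α' σ' he he' w α'' σ'' hw ih =>
    intro v hv
    simp only [List.length_cons] at hv
    have hctx := hw.append (wordBound_base y v)
    have h₀ := wordVal_pair_left_ge hy he he' hctx (by simp; omega)
    have h₁ := wordVal_pair_right_ge hy (exposed_single y) he' hctx (by simp; omega)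
    have h₂ := ih (v ++ [.pair p q p' q']) (by simp; omega)
    have e₁ : wordVal y (w ++ List.map (Letter.base y) (v ++ [.pair p q p' q'])) =
        wordVal y (.pair 1 1 1 1 :: (w ++ v.map (Letter.base y))) := by
      rw [List.map_append, ← List.append_assoc]
      exact wordVal_append_comm _ _ _
    have e₂ : wordVal y (w.map (Letter.base y) ++
        List.map (Letter.base y) (v ++ [.pair p q p' q'])) =
        wordVal y (.pair 1 1 1 1 :: (w.map (Letter.base y) ++ v.map (Letter.base y))) := by
      rw [List.map_append, ← List.append_assoc]
      exact wordVal_append_comm _ _ _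
    rw [e₁, e₂] at h₂
    simp only [List.length_append, List.length_map, List.length_cons, List.length_nil,
      List.map_cons, List.cons_append, mul_one, one_mul, zero_add] at h₀ h₁ h₂ ⊢
    rw [show w.length + (v.length + 1) - 2 = w.length + v.length - 1 by omega] at h₂
    rw [show w.length + 1 + v.length - 2 = w.length + v.length - 1 by omega]
    have h₃ := mul_le_mul_of_nonneg_left h₂ (mul_nonneg he.hα he'.hα)
    have h₄ := mul_le_mul_of_nonneg_left h₁ he.hα
    refine le_trans (le_of_eq ?_) (le_trans (add_le_add_left (le_trans (add_le_add_left
      (le_trans h₃ (le_of_eq (mul_assoc _ _ _))) _) (le_trans (le_of_eq (mul_add _ _ _).symm) h₄)) _) h₀)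
    simp only [Letter.base]
    ring

end Words

end SignlessLaplacian

namespace SignlessLaplacian

open Polynomial Matrix

/-! ### Dual-number weights and the two target values; words of a triangle. -/

section Targets

variable {R : Type*} [CommRing R]

/-- The weight of `t` pendent edges and `s` pendent paths of length two. -/
def al (y : R) (t s : ℕ) : R := (1 + y) ^ t * (1 + 3 * y + y ^ 2) ^ s

/-- The derivative part of the dual number `(1 + y + y ε) ^ t * (b + y (1 + 2 y) ε) ^ s`, where
`b = 1 + 3 y + y ^ 2`. -/
def sg (y : R) (t s : ℕ) : R :=
  t * y * (1 + y) ^ (t - 1) * (1 + 3 * y + y ^ 2) ^ s +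
    s * (y * (1 + 2 * y)) * (1 + y) ^ t * (1 + 3 * y + y ^ 2) ^ (s - 1)

theorem al_add (y : R) (t s t' s' : ℕ) : al y (t + t') (s + s') = al y t s * al y t' s' := by
  simp only [al, pow_add]; ring

/-- The product rule: `al + sg ε` is multiplicative in the pendent pieces. -/
theorem sg_add (y : R) (t s t' s' : ℕ) :
    sg y (t + t') (s + s') = al y t s * sg y t' s' + sg y t s * al y t' s' := by
  -- The truncated exponent `m + n - 1` is harmless because the factor `m + n` vanishes when it
  -- truncates.
  have aux : ∀ (x : R) (m n : ℕ), ((m + n : ℕ) : R) * x ^ (m + n - 1) =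
      x ^ m * (n * x ^ (n - 1)) + m * x ^ (m - 1) * x ^ n := by
    intro x m n
    rcases m with _ | m
    · simp
    rcases n with _ | n
    · simp
    rw [show m + 1 + (n + 1) - 1 = m + n + 1 by omega]
    simp only [Nat.add_sub_cancel, Nat.cast_add, Nat.cast_one]
    ring
  have h₁ := aux (1 + y) t t'
  have h₂ := aux (1 + 3 * y + y ^ 2) s s'
  simp only [sg, al, pow_add]
  linear_combination y * (1 + 3 * y + y ^ 2) ^ s * (1 + 3 * y + y ^ 2) ^ s' * h₁ +
    y * (1 + 2 * y) * (1 + y) ^ t * (1 + y) ^ t' * h₂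

@[simp] theorem al_zero (y : R) : al y 0 0 = 1 := by simp [al]
@[simp] theorem sg_zero (y : R) : sg y 0 0 = 0 := by simp [sg]
theorem al_one_zero (y : R) : al y 1 0 = 1 + y := by simp [al]
theorem sg_one_zero (y : R) : sg y 1 0 = y := by simp [sg]
theorem al_zero_one (y : R) : al y 0 1 = 1 + 3 * y + y ^ 2 := by simp [al]
theorem sg_zero_one (y : R) : sg y 0 1 = y * (1 + 2 * y) := by simp [sg]

/-- The value of a triangle with one tree, whose pair is `(α + σ, α)`. -/
def oneTree (y α σ : R) : R :=
  (1 + y) * (1 + 3 * y) * (α + σ) + 2 * (y * (1 + y) * (1 + 2 * y)) * α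

/-- Linearity in the dual number separates the target into the two summands that
`WordBound.wordVal_ge` produces. -/
theorem oneTree_mul (y α σ α' σ' : R) : oneTree y (α * α') (α * σ' + σ * α') =
    α * oneTree y α' σ' + σ * ((1 + y) * (1 + 3 * y) * α') := by
  simp only [oneTree]; ring

/-- The value of a triangle with a pendent edge at two vertices and a tree with the pair
`(α + σ, α)` at the third one. -/
def threeTrees (y α σ : R) : R :=
  cyclicVal y [(1 + 2 * y, 1 + y), (1 + 2 * y, 1 + y), (α + σ, α)]

theorem cyclicVal_oneTree (y α σ : R) :
    cyclicVal y [(1, 1), (1, 1), (α + σ, α)] = oneTree y α σ := by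
  simp [cyclicVal, transfer, oneTree, Matrix.trace_fin_two]; ring

variable [PartialOrder R] [IsOrderedRing R]

theorem al_nonneg {y : R} (hy : 0 ≤ y) (t s : ℕ) : 0 ≤ al y t s := by
  nontriviality R
  unfold al; positivity

theorem sg_nonneg {y : R} (hy : 0 ≤ y) (t s : ℕ) : 0 ≤ sg y t s := by
  nontriviality R
  unfold sg; positivity

variable [Nontrivial R]

/-! ### Triangles -/

-- The two-letter words are the triangles with one covered vertex and a pair. Only here is the
-- remaining word too short for the row bound of `ContextBound`, so the estimate is made by hand
-- from the linear form `p A + q B`.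
set_option maxHeartbeats 1000000 in
theorem wordVal_single_pair_ge {y : R} (hy : 0 ≤ y) {p q p₁ q₁ p₂ q₂ α σ α₁ σ₁ α₂ σ₂ : R}
    (h : Covered y p q α σ) (h₁ : Exposed y p₁ q₁ α₁ σ₁) (h₂ : Exposed y p₂ q₂ α₂ σ₂) :
    oneTree y ((1 + y) * (α * (α₁ * α₂)))
      ((1 + y) * (α * (α₁ * σ₂ + σ₁ * α₂) + σ * (α₁ * α₂)) + y * (α * (α₁ * α₂))) ≤
      wordVal y [.single p q, .pair p₁ q₁ p₂ q₂] := by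
  obtain ⟨e₁, e₂, he₁, he₂, hq, hp⟩ := h.exists_eq
  obtain ⟨c₁, c₂, c₃, hc₁, hc₂, hc₃, hq₁, hp₁, hg₁⟩ := h₁.exists_eq
  obtain ⟨d₁, d₂, d₃, hd₁, hd₂, hd₃, hq₂, hp₂, hg₂⟩ := h₂.exists_eq
  have hα := h.hα
  have hσ := h.hσ
  have := h₁.hα
  have := h₁.hσ
  have := h₂.hα
  have := h₂.hσ
  -- the coefficients of `p` and `q`
  obtain ⟨A, hA⟩ : ∃ A, A = (p₁ + y * q₁) * (p₂ + y * q₂) +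
    y * (q₁ * (p₂ + y * q₂) + q₂ * (p₁ + y * q₁)) := ⟨_, rfl⟩
  obtain ⟨B, hB⟩ : ∃ B, B = 2 * (y * (p₁ + y * q₁) * (p₂ + y * q₂)) +
    y ^ 2 * (q₁ * (p₂ + y * q₂) + q₂ * (p₁ + y * q₁)) := ⟨_, rfl⟩
  have hval : wordVal y [.single p q, .pair p₁ q₁ p₂ q₂] = p * A + q * B := by
    rw [hA, hB]
    simp [wordVal, wordMat, wordBonus, Letter.mat, Letter.bonus, Matrix.trace_fin_two]
    ring
  have hA0 : (1 + y) * (1 + 3 * y) * (α₁ * α₂) ≤ A := by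
    rw [hA, ← sub_nonneg, hp₁, hq₁, hp₂, hq₂]; ring_nf; positivity
  have hB0 : 0 ≤ B := by
    rw [hB, hp₁, hq₁, hp₂, hq₂]; positivity
  have hAB : (1 + y) * ((1 + 3 * y) * (1 + 2 * y) * (α₁ * α₂) +
      (1 + y) * (1 + 3 * y) * (α₁ * σ₂ + σ₁ * α₂)) +
      2 * (y * (1 + y) ^ 2 * (1 + 2 * y)) * (α₁ * α₂) ≤ (1 + 2 * y) * A + (1 + y) * B := by
    have key : (1 + 2 * y) * A + (1 + y) * B =
        ((1 + y) * p₁ + y * q₁) * ((1 + y) * p₂ + y * q₂) +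
        y * (q₁ * ((1 + y) * p₂ + y * q₂) + q₂ * ((1 + y) * p₁ + y * q₁)) +
        (2 * y * (p₁ + y * q₁) * (p₂ + y * q₂) +
          y ^ 2 * (p₁ * (p₂ + y * q₂) + y * q₁ * p₂) +
          y * (3 * y + 2 * y ^ 2) * ((p₁ + y * q₁) * q₂ + q₁ * (p₂ + y * q₂)) +
          2 * y ^ 3 * q₁ * q₂) := by
      rw [hA, hB]; ring
    -- A multiple of the two identities `hg₁` and `hg₂`, hence zero. Adding it trades `e`-type slack
    -- between `p`, `q` and their combination so that every monomial after expansion is nonnegative.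
    have hz : α₁ * (y + 3 * y ^ 2) * ((1 + y) * σ₂ + d₃ - (1 + y) * d₂ - y * d₁) +
        α₂ * (y + 3 * y ^ 2) * ((1 + y) * σ₁ + c₃ - (1 + y) * c₂ - y * c₁) = 0 := by
      rw [hp₁, hq₁] at hg₁
      rw [hp₂, hq₂] at hg₂
      linear_combination (-(α₁ * (y + 3 * y ^ 2))) * hg₂ - α₂ * (y + 3 * y ^ 2) * hg₁
    have aux : ∀ r : R, 0 ≤ r + (α₁ * (y + 3 * y ^ 2) *
        ((1 + y) * σ₂ + d₃ - (1 + y) * d₂ - y * d₁) +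
        α₂ * (y + 3 * y ^ 2) * ((1 + y) * σ₁ + c₃ - (1 + y) * c₂ - y * c₁)) → 0 ≤ r := by
      intro r h
      rwa [hz, add_zero] at h
    rw [key, hg₁, hg₂, ← sub_nonneg, hp₁, hq₁, hp₂, hq₂]
    refine aux _ ?_
    ring_nf
    positivity
  obtain ⟨a', ha', hA'⟩ := exists_eq_add hA0
  obtain ⟨b', hb', hB'⟩ := exists_eq_add hAB
  rw [hval, hp, hq]
  have key : ((1 + 2 * y) * α + (1 + y) * σ + e₂) * A + ((1 + y) * α + e₁) * B =
      α * ((1 + 2 * y) * A + (1 + y) * B) + (1 + y) * σ * A + (e₂ * A + e₁ * B) := by ring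
  have hA1 : 0 ≤ A := le_trans (by positivity) hA0
  have h3 : 0 ≤ α * b' + (1 + y) * σ * a' + (e₂ * A + e₁ * B) := by positivity
  rw [key, ← sub_nonneg]
  refine h3.trans_eq ?_
  rw [hB', hA', oneTree]
  ring

/-- The three brooms are removed one after the other with the sharp row bound. For two remaining
letters its coefficient is exactly the coefficient of `σ` in `threeTrees`, so nothing is lost. -/
theorem wordVal_three_singles_ge {y : R} (hy : 0 ≤ y) {p₁ q₁ p₂ q₂ p₃ q₃ α₁ σ₁ α₂ σ₂ α₃ σ₃ : R}
    (h₁ : Covered y p₁ q₁ α₁ σ₁) (h₂ : Covered y p₂ q₂ α₂ σ₂) (h₃ : Covered y p₃ q₃ α₃ σ₃) :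
    threeTrees y ((1 + y) * (α₁ * (α₂ * α₃)))
      ((1 + y) * (α₁ * (α₂ * σ₃ + σ₂ * α₃) + σ₁ * (α₂ * α₃)) + y * (α₁ * (α₂ * α₃))) ≤
      wordVal y [.single p₁ q₁, .single p₂ q₂, .single p₃ q₃] := by
  have hB := wordBound_base y [Letter.single p₁ q₁]
  simp only [List.map_cons, List.map_nil, Letter.base] at hB
  have k₁ := wordVal_single_ge_sharp hy h₁ (.single h₂ (.single h₃ .nil)) le_rfl
  have k₂ := wordVal_single_ge_sharp hy h₂ (.single h₃ hB) le_rfl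
  have k₃ := wordVal_single_ge_sharp hy h₃ (hB.append hB) le_rfl
  have r₁ := wordVal_append_comm y [Letter.single (1 + 2 * y) (1 + y)]
    [.single p₂ q₂, .single p₃ q₃]
  have r₂ := wordVal_append_comm y [Letter.single (1 + 2 * y) (1 + y)]
    [.single p₃ q₃, .single (1 + 2 * y) (1 + y)]
  simp only [List.cons_append, List.nil_append] at r₁ r₂ k₃
  rw [r₁] at k₁
  rw [r₂] at k₂
  simp only [List.length_cons, List.length_nil] at k₁ k₂ k₃
  have e₁ := mul_le_mul_of_nonneg_left k₂ h₁.hα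
  have e₂ := mul_le_mul_of_nonneg_left k₃ (mul_nonneg h₁.hα h₂.hα)
  have e₃ := add_le_add (add_le_add k₁ e₁) e₂
  have key : wordVal y [.single (1 + 2 * y) (1 + y), .single (1 + 2 * y) (1 + y),
      .single (1 + 2 * y) (1 + y)] = threeTrees y (1 + y) y := by
    simp [wordVal, wordMat, wordBonus, Letter.mat, Letter.bonus, threeTrees, cyclicVal, transfer]
    ring_nf
  have lin : ∀ α σ : R, threeTrees y ((1 + y) * α) ((1 + y) * σ + y * α) =
      α * threeTrees y (1 + y) y +
        σ * ((1 + y) * ((1 + 3 * y + y ^ 2) * (1 + 5 * y + 3 * y ^ 2))) := by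
    intro α σ
    simp [threeTrees, cyclicVal, transfer, Matrix.trace_fin_two]
    ring
  rw [lin, ← key, ← sub_nonneg]
  rw [← sub_nonneg] at e₃
  refine e₃.trans_eq ?_
  ring

end Targets

end SignlessLaplacian

namespace SignlessLaplacian

open Polynomial Matrix

/-! ### Words whose trees are as small as possible. -/

section BaseWords

variable {R : Type*} [CommRing R]

/-- The letters without superfluous trees. -/
def IsBaseLetter (y : R) (l : Letter R) : Prop :=
  l = .single (1 + 2 * y) (1 + y) ∨ l = .pair 1 1 1 1

theorem isBaseLetter_base (y : R) (l : Letter R) : IsBaseLetter y (l.base y) := by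
  cases l
  · exact Or.inl rfl
  · exact Or.inr rfl

variable [PartialOrder R] [IsOrderedRing R] [Nontrivial R]

/-- Comparison of the transfer matrix of a word with its cycle term. -/
structure BonusBound (y β : R) (k : ℕ) (M : Matrix (Fin 2) (Fin 2) R) : Prop where
  h0 : 0 ≤ β
  h00 : β ≤ M 0 0
  h01 : 0 ≤ M 0 1
  h10 : 0 ≤ M 1 0
  h11 : β ≤ M 1 1
  hone : 1 ≤ k → β ≤ y * M 1 0
  htwo : 2 ≤ k → 2 * β ≤ y * M 1 0

/-- The lower left entry of the product is a sum of two terms, each of which dominates the cycle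
term after multiplication by `y`; this is the source of the factor 2 in `htwo`. -/
theorem BonusBound.mul {y β γ : R} (hy : 0 ≤ y) {k : ℕ} {L M : Matrix (Fin 2) (Fin 2) R}
    (hL : BonusBound y γ 1 L) (hM : BonusBound y β k M) :
    BonusBound y (γ * β) (k + 1) (L * M) := by
  have l0 := hL.h0
  have m0 := hM.h0
  have l00 := l0.trans hL.h00
  have l11 := l0.trans hL.h11
  have m00 := m0.trans hM.h00
  have m11 := m0.trans hM.h11
  have l01 := hL.h01
  have l10 := hL.h10
  have m01 := hM.h01
  have m10 := hM.h10
  have hmul : ∀ i j, (L * M) i j = L i 0 * M 0 j + L i 1 * M 1 j := fun i j => by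
    simp [Matrix.mul_apply, Fin.sum_univ_two]
  have h1 : γ * β ≤ y * L 1 0 * M 0 0 :=
    mul_le_mul (hL.hone le_rfl) hM.h00 m0 (by positivity)
  refine ⟨by positivity, ?_, ?_, ?_, ?_, fun _ => ?_, fun h => ?_⟩
  · rw [hmul]
    exact (mul_le_mul hL.h00 hM.h00 m0 l00).trans (le_add_of_nonneg_right (by positivity))
  · rw [hmul]; positivity
  · rw [hmul]; positivity
  · rw [hmul]
    exact (mul_le_mul hL.h11 hM.h11 m0 l11).trans (le_add_of_nonneg_left (by positivity))
  · rw [hmul, mul_add, ← mul_assoc]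
    exact h1.trans (le_add_of_nonneg_right (by positivity))
  · have h2 : γ * β ≤ L 1 1 * (y * M 1 0) :=
      mul_le_mul hL.h11 (hM.hone (by omega)) m0 l11
    rw [hmul]
    refine (add_le_add h1 h2).trans_eq' ?_ |>.trans_eq ?_
    · ring
    · ring

theorem IsBaseLetter.bonusBound {y : R} (hy : 0 ≤ y) {l : Letter R} (h : IsBaseLetter y l) :
    BonusBound y (l.bonus y) 1 (l.mat y) := by
  rcases h with rfl | rfl <;>
  refine ⟨?_, ?_, ?_, ?_, ?_, fun _ => ?_, fun h => absurd h (by omega)⟩ <;>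
  simp only [Letter.mat, Letter.bonus, Matrix.of_apply, Matrix.cons_val] <;>
  rw [← sub_nonneg] <;> ring_nf <;> positivity

theorem bonusBound_word {y : R} (hy : 0 ≤ y) {w : List (Letter R)}
    (h : ∀ l ∈ w, IsBaseLetter y l) : BonusBound y (wordBonus y w) w.length (wordMat y w) := by
  induction w with
  | nil =>
    refine ⟨?_, ?_, ?_, ?_, ?_, fun h => absurd h (by simp), fun h => absurd h (by simp)⟩ <;>
    simp [wordBonus, wordMat]
  | cons l w ih =>
    have := (h l (by simp)).bonusBound hy |>.mul hy (ih fun l hl => h l (by simp [hl]))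
    simpa [wordBonus, wordMat] using this

/-- Replacing a bare pair by a vertex with a leaf loses `y ^ 2 * M 1 0` in the trace and gains `2 *
y * β` in the cycle term, where `M` and `β` belong to the rest of the word. `BonusBound.htwo` makes
the balance favourable once two letters remain. -/
theorem wordVal_cons_base_ge {y : R} (hy : 0 ≤ y) {l : Letter R} (hl : IsBaseLetter y l)
    {w : List (Letter R)} (h : ∀ l ∈ w, IsBaseLetter y l) (hk : 2 ≤ w.length) :
    wordVal y (.single (1 + 2 * y) (1 + y) :: w) ≤ wordVal y (l :: w) := by
  rcases hl with rfl | rfl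
  · exact le_rfl
  · have := mul_le_mul_of_nonneg_left ((bonusBound_word hy h).htwo hk) hy
    rw [wordVal_cons, wordVal_cons, ← sub_nonneg]
    rw [← sub_nonneg] at this
    refine this.trans_eq ?_
    simp only [Letter.mat, Letter.bonus, Matrix.of_apply, Matrix.cons_val]
    ring

/-- Replacing pairs by single vertices with a pendent edge. -/
theorem wordVal_append_base_ge {y : R} (hy : 0 ≤ y) {w u : List (Letter R)}
    (hw : ∀ l ∈ w, IsBaseLetter y l) (hu : ∀ l ∈ u, IsBaseLetter y l)
    (hk : 3 ≤ w.length + u.length) :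
    wordVal y (List.replicate w.length (.single (1 + 2 * y) (1 + y)) ++ u) ≤
      wordVal y (w ++ u) := by
  induction w generalizing u with
  | nil => simp
  | cons l w ih =>
    have h1 := wordVal_cons_base_ge hy (hw l (by simp)) (w := w ++ u)
      (fun l' hl' => (List.mem_append.1 hl').elim (fun h => hw l' (by simp [h])) (hu l'))
      (by simp at hk ⊢; omega)
    refine le_trans ?_ h1
    have h2 := ih (u := u ++ [.single (1 + 2 * y) (1 + y)])
      (fun l' h => hw l' (by simp [h])) (fun l' hl' => (List.mem_append.1 hl').elim (hu l')
        (fun h => by rw [List.mem_singleton.1 h]; exact Or.inl rfl)) (by simp at hk ⊢; omega)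
    have e1 : ∀ v : List (Letter R), wordVal y (v ++ (u ++ [.single (1 + 2 * y) (1 + y)])) =
        wordVal y (.single (1 + 2 * y) (1 + y) :: (v ++ u)) := by
      intro v
      rw [← List.append_assoc, wordVal_append_comm]; rfl
    rw [e1, e1] at h2
    exact h2

/-- The target for a word with `k + 2` letters. -/
def wordTarget (y : R) (k : ℕ) : R := oneTree y (al y 1 k) (sg y 1 k)

theorem wordTarget_zero (y : R) :
    wordTarget y 0 = (1 + y) * (1 + 3 * y) * (1 + 2 * y) + 2 * y * (1 + y) ^ 2 * (1 + 2 * y) := by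
  simp [wordTarget, oneTree, al, sg]; ring

theorem wordTarget_succ (y : R) (k : ℕ) :
    wordTarget y (k + 1) = (1 + 3 * y + y ^ 2) * wordTarget y k +
      (1 + y) ^ 2 * (y * (1 + 2 * y)) * (1 + 3 * y) * (1 + 3 * y + y ^ 2) ^ k := by
  have h1 := al_add y 1 k 0 1
  have h2 := sg_add y 1 k 0 1
  rw [al_zero_one] at h1 h2
  rw [sg_zero_one] at h2
  simp only [add_zero] at h1 h2
  rw [wordTarget, h1, h2, wordTarget, oneTree, oneTree]
  simp only [al]
  ring

/-- With three letters and an odd number of vertices, this is the only cyclic word besides the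
triangle of three single letters. -/
theorem base_single_pair_pair {y : R} (hy : 0 ≤ y) :
    wordTarget y 1 ≤ wordVal y [.single (1 + 2 * y) (1 + y), .pair 1 1 1 1, .pair 1 1 1 1] := by
  rw [wordTarget_succ, wordTarget_zero]
  simp only [wordVal, wordMat, wordBonus, Letter.mat, Letter.bonus, List.map_cons, List.map_nil,
    List.prod_cons, List.prod_nil, Matrix.trace_fin_two, mul_one, one_mul,
    Matrix.mul_fin_two, Matrix.of_apply, Matrix.cons_val]
  rw [← sub_nonneg]
  ring_nf
  positivity

/-- Four single letters make an even cycle, so a word of four letters keeps one pair. -/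
theorem base_pair_singles {y : R} (hy : 0 ≤ y) :
    wordTarget y 2 ≤ wordVal y [.pair 1 1 1 1, .single (1 + 2 * y) (1 + y),
      .single (1 + 2 * y) (1 + y), .single (1 + 2 * y) (1 + y)] := by
  rw [wordTarget_succ, wordTarget_succ, wordTarget_zero]
  simp only [wordVal, wordMat, wordBonus, Letter.mat, Letter.bonus, List.map_cons, List.map_nil,
    List.prod_cons, List.prod_nil, Matrix.trace_fin_two, mul_one, one_mul,
    Matrix.mul_fin_two, Matrix.of_apply, Matrix.cons_val]
  rw [← sub_nonneg]
  ring_nf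
  positivity

/-- The transfer matrix of a cycle vertex with a pendent edge. -/
def leafMat (y : R) : Matrix (Fin 2) (Fin 2) R :=
  !![1 + 3 * y + y ^ 2, y * (1 + y); 1 + 2 * y, y * (1 + y)]

theorem leafMat_pow_nonneg {y : R} (hy : 0 ≤ y) (k : ℕ) (i j : Fin 2) :
    0 ≤ (leafMat y ^ k) i j := by
  induction k generalizing i j with
  | zero => fin_cases i <;> fin_cases j <;> simp
  | succ k ih =>
    have h : ∀ i j, 0 ≤ leafMat y i j := by
      intro i j
      fin_cases i <;> fin_cases j <;> simp only [leafMat, Fin.zero_eta, Fin.mk_one,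
        Matrix.of_apply, Matrix.cons_val] <;> positivity
    rw [pow_succ', Matrix.mul_apply]
    exact Finset.sum_nonneg fun l _ => mul_nonneg (h _ _) (ih _ _)

theorem leafMat_pow_row {y : R} (hy : 0 ≤ y) {k : ℕ} (hk : 4 ≤ k) :
    2 * (y * (1 + y)) ^ k + (1 + y) * (1 + 3 * y) * (1 + 3 * y + y ^ 2) ^ (k - 1) ≤
      (leafMat y ^ k) 0 0 + (leafMat y ^ k) 0 1 := by
  induction k, hk using Nat.le_induction with
  | base =>
    simp only [pow_succ _ 3, pow_succ _ 2, pow_two, leafMat, Matrix.mul_fin_two, Matrix.of_apply,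
      Matrix.cons_val]
    rw [← sub_nonneg]
    ring_nf
    positivity
  | succ k hk ih =>
    obtain ⟨j, rfl⟩ : ∃ j, k = j + 1 := ⟨k - 1, by omega⟩
    have h10 := leafMat_pow_nonneg hy (j + 1) 1 0
    have h11 := leafMat_pow_nonneg hy (j + 1) 1 1
    obtain ⟨e, he, h⟩ := exists_eq_add ih
    have : (leafMat y ^ (j + 1 + 1)) 0 0 + (leafMat y ^ (j + 1 + 1)) 0 1 =
        (1 + 3 * y + y ^ 2) * ((leafMat y ^ (j + 1)) 0 0 + (leafMat y ^ (j + 1)) 0 1) +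
        y * (1 + y) * ((leafMat y ^ (j + 1)) 1 0 + (leafMat y ^ (j + 1)) 1 1) := by
      rw [pow_succ' _ (j + 1), Matrix.mul_apply, Matrix.mul_apply, Fin.sum_univ_two,
        Fin.sum_univ_two]
      simp only [leafMat, Matrix.of_apply, Matrix.cons_val]
      ring
    rw [this, h, ← sub_nonneg]
    simp only [Nat.add_sub_cancel]
    have h1 : 0 ≤ 2 * (y * (1 + y)) ^ (j + 1) * (1 + 2 * y) + (1 + 3 * y + y ^ 2) * e +
        y * (1 + y) * ((leafMat y ^ (j + 1)) 1 0 + (leafMat y ^ (j + 1)) 1 1) := by positivity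
    refine h1.trans_eq ?_
    ring

theorem wordVal_replicate_leaf (y : R) (k : ℕ) :
    wordVal y (List.replicate k (.single (1 + 2 * y) (1 + y))) =
      (leafMat y ^ k).trace + 2 * (y * (1 + y)) ^ k := by
  have : (Letter.single (1 + 2 * y) (1 + y)).mat y = leafMat y := by
    simp only [Letter.mat, leafMat]
    congr! 3; ring
  simp only [wordVal, wordMat, wordBonus, List.map_replicate, List.prod_replicate, this,
    Letter.bonus]

/-- Both sides obey a recursion with factor `1 + 3 * y + y ^ 2`, and `leafMat_pow_row` compares the
inhomogeneous terms, including the change of the cycle term. The induction starts at five letters,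
the first odd length beyond the triangle. -/
theorem base_singles {y : R} (hy : 0 ≤ y) {k : ℕ} (hk : 5 ≤ k) :
    wordTarget y (k - 2) ≤ wordVal y (List.replicate k (.single (1 + 2 * y) (1 + y))) := by
  rw [wordVal_replicate_leaf]
  induction k, hk using Nat.le_induction with
  | base =>
    simp only [Nat.reduceSub, wordTarget_succ, wordTarget_zero, pow_succ _ 4, pow_succ _ 3,
      pow_succ _ 2, pow_two, leafMat, Matrix.mul_fin_two, Matrix.of_apply,
      Matrix.cons_val, Matrix.trace_fin_two]
    rw [← sub_nonneg]
    ring_nf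
    positivity
  | succ k hk ih =>
    obtain ⟨j, rfl⟩ : ∃ j, k = j + 2 := ⟨k - 2, by omega⟩
    simp only [Nat.add_sub_cancel, show j + 2 + 1 - 2 = j + 1 by omega] at ih ⊢
    obtain ⟨e, he, h⟩ := exists_eq_add ih
    obtain ⟨d, hd, hκ⟩ := exists_eq_add (leafMat_pow_row hy (k := j + 1) (by omega))
    have h10 := leafMat_pow_nonneg hy (j + 1) 1 0
    obtain ⟨M, hM⟩ : ∃ M, M = leafMat y ^ (j + 1) := ⟨_, rfl⟩
    have key : (leafMat y ^ (j + 2 + 1)).trace = (1 + 3 * y + y ^ 2) * (leafMat y ^ (j + 2)).trace +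
        y * (1 + y) * ((1 + 2 * y) * (M 0 0 + M 0 1) + y * (1 + y) * M 1 0) := by
      rw [pow_succ' _ (j + 2), pow_succ' _ (j + 1), ← hM]
      simp only [Matrix.trace_fin_two, Matrix.mul_apply, Fin.sum_univ_two, leafMat,
        Matrix.of_apply, Matrix.cons_val]
      ring
    rw [← hM] at hκ h10
    rw [key, wordTarget_succ, ← sub_nonneg]
    have h1 : 0 ≤ (1 + 3 * y + y ^ 2) * e + y * (1 + y) * ((1 + 2 * y) * d +
      y * (1 + y) * M 1 0) := by positivity
    refine h1.trans_eq ?_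
    rw [hκ, eq_sub_of_add_eq h]
    simp only [Nat.add_sub_cancel]
    ring

end BaseWords

end SignlessLaplacian

namespace SignlessLaplacian

open Polynomial Matrix

/-! ### The bound for all words except the triangle of covered vertices. -/

section WordTheorem

variable {R : Type*} [CommRing R]

/-- The square of the transfer matrix of a cycle vertex without a tree. -/
def bareSqMat (y : R) : Matrix (Fin 2) (Fin 2) R :=
  !![1 + 3 * y + y ^ 2, y * (1 + 2 * y); 1 + 2 * y, y * (1 + y)]

theorem transfer_bare_sq (y : R) : transfer y 1 1 * transfer y 1 1 = bareSqMat y := by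
  ext i j
  fin_cases i <;> fin_cases j <;>
    simp [transfer, bareSqMat, Matrix.mul_apply, Fin.sum_univ_two] <;> ring

variable [PartialOrder R] [IsOrderedRing R] [Nontrivial R]

/-- The inhomogeneous term when two bare vertices are inserted into a bare odd cycle. The extra `3 *
y ^ (2 * j + 4)` pays for the cycle term in `cyclicVal_bare_ge`. -/
theorem bare_context {y : R} (hy : 0 ≤ y) (j : ℕ) (M : Matrix (Fin 2) (Fin 2) R)
    (hM : M = bareSqMat y ^ (j + 1) * transfer y 1 1) :
    (∀ i k, 0 ≤ M i k) ∧
    (1 + y) ^ 3 * (1 + 3 * y) * (1 + 3 * y + y ^ 2) ^ j + 3 * y ^ (2 * j + 4) ≤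
      (1 + 2 * y) * M 0 0 + y * (1 + y) * M 1 0 + (1 + y) * M 0 1 + y * M 1 1 := by
  induction j generalizing M with
  | zero =>
    have : M = !![1 + 5 * y + 6 * y ^ 2 + y ^ 3, y * (1 + 4 * y + 3 * y ^ 2);
      1 + 4 * y + 3 * y ^ 2, y * (1 + 3 * y + y ^ 2)] := by
      rw [hM]
      ext i j
      fin_cases i <;> fin_cases j <;>
        simp [transfer, bareSqMat, Matrix.mul_apply, Fin.sum_univ_two] <;> ring
    rw [this]
    constructor
    · intro i k
      fin_cases i <;> fin_cases k <;> simp only [Fin.zero_eta, Fin.mk_one,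
        Matrix.of_apply, Matrix.cons_val] <;> positivity
    · simp only [Matrix.of_apply, Matrix.cons_val]
      rw [← sub_nonneg]
      ring_nf
      positivity
  | succ j ih =>
    obtain ⟨h0, h⟩ := ih _ rfl
    rw [pow_succ', mul_assoc] at hM
    generalize bareSqMat y ^ (j + 1) * transfer y 1 1 = M' at h0 h hM
    have h00 := h0 0 0
    have h01 := h0 0 1
    have h10 := h0 1 0
    have h11 := h0 1 1
    have e00 : M 0 0 = (1 + 3 * y + y ^ 2) * M' 0 0 + y * (1 + 2 * y) * M' 1 0 := by
      rw [hM, Matrix.mul_apply, Fin.sum_univ_two]; rfl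
    have e01 : M 0 1 = (1 + 3 * y + y ^ 2) * M' 0 1 + y * (1 + 2 * y) * M' 1 1 := by
      rw [hM, Matrix.mul_apply, Fin.sum_univ_two]; rfl
    have e10 : M 1 0 = (1 + 2 * y) * M' 0 0 + y * (1 + y) * M' 1 0 := by
      rw [hM, Matrix.mul_apply, Fin.sum_univ_two]; rfl
    have e11 : M 1 1 = (1 + 2 * y) * M' 0 1 + y * (1 + y) * M' 1 1 := by
      rw [hM, Matrix.mul_apply, Fin.sum_univ_two]; rfl
    constructor
    · intro i k
      fin_cases i <;> fin_cases k <;> simp only [Fin.zero_eta, Fin.mk_one, e00, e01, e10, e11] <;>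
        positivity
    · obtain ⟨e, he, hE⟩ := exists_eq_add h
      have h1 : 0 ≤ (1 + 3 * y + y ^ 2) * e + 3 * y ^ (2 * j + 4) * (1 + 3 * y) +
          y * (1 + y) * (1 + 2 * y) * M' 0 0 + (y ^ 2 + 2 * y ^ 3) * M' 1 0 +
          y * (1 + 2 * y) * M' 0 1 + (y ^ 2 + 2 * y ^ 3) * M' 1 1 := by positivity
      rw [e00, e01, e10, e11, ← sub_nonneg]
      refine h1.trans_eq ?_
      rw [eq_sub_of_add_eq' hE.symm]
      ring

/-- The cyclic word of an odd cycle. -/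
theorem cyclicVal_bare_ge {y : R} (hy : 0 ≤ y) (j : ℕ) :
    oneTree y (al y 2 j) (sg y 2 j) ≤ cyclicVal y (List.replicate (2 * j + 5) (1, 1)) := by
  have hval : ∀ j : ℕ, cyclicVal y (List.replicate (2 * j + 5) ((1 : R), (1 : R))) =
      (bareSqMat y ^ (j + 2) * transfer y 1 1).trace + 2 * y ^ (2 * j + 5) := by
    intro j
    simp only [cyclicVal, List.map_replicate, List.prod_replicate, mul_one]
    rw [pow_succ _ (2 * j + 4), show 2 * j + 4 = 2 * (j + 2) by ring, pow_mul, sq,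
      transfer_bare_sq]
  rw [hval]
  induction j with
  | zero =>
    simp only [oneTree, al, sg, bareSqMat, transfer, zero_add, pow_two, Matrix.mul_fin_two,
      Matrix.trace_fin_two, Matrix.of_apply, Matrix.cons_val, pow_zero]
    rw [← sub_nonneg]
    ring_nf
    positivity
  | succ j ih =>
    obtain ⟨e, he, h⟩ := exists_eq_add ih
    obtain ⟨-, h1⟩ := bare_context hy j _ rfl
    obtain ⟨d, hd, hM⟩ := exists_eq_add h1
    have key : (bareSqMat y ^ (j + 1 + 2) * transfer y 1 1).trace =
        (1 + 3 * y + y ^ 2) * (bareSqMat y ^ (j + 2) * transfer y 1 1).trace +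
        y * (1 + 2 * y) * ((1 + 2 * y) * (bareSqMat y ^ (j + 1) * transfer y 1 1) 0 0 +
          y * (1 + y) * (bareSqMat y ^ (j + 1) * transfer y 1 1) 1 0 +
          (1 + y) * (bareSqMat y ^ (j + 1) * transfer y 1 1) 0 1 +
          y * (bareSqMat y ^ (j + 1) * transfer y 1 1) 1 1) := by
      rw [show j + 1 + 2 = j + 1 + 1 + 1 by ring, show j + 2 = j + 1 + 1 by ring,
        pow_succ' _ (j + 1 + 1), pow_succ' _ (j + 1), mul_assoc, mul_assoc]
      generalize bareSqMat y ^ (j + 1) * transfer y 1 1 = M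
      simp only [Matrix.trace_fin_two, Matrix.mul_apply, Fin.sum_univ_two, bareSqMat,
        Matrix.of_apply, Matrix.cons_val]
      ring
    have hT : oneTree y (al y 2 (j + 1)) (sg y 2 (j + 1)) =
        (1 + 3 * y + y ^ 2) * oneTree y (al y 2 j) (sg y 2 j) +
        (1 + y) ^ 3 * (y * (1 + 2 * y)) * (1 + 3 * y) * (1 + 3 * y + y ^ 2) ^ j := by
      have h1 := al_add y 2 j 0 1
      have h2 := sg_add y 2 j 0 1
      rw [al_zero_one] at h1 h2
      rw [sg_zero_one] at h2
      simp only [add_zero] at h1 h2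
      rw [h1, h2, oneTree, oneTree]
      simp only [al]
      ring
    rw [key, hM, hT, eq_sub_of_add_eq h, ← sub_nonneg]
    -- The surplus of `bare_context` and the change of the cycle term add up to exactly `y ^ (2 * j
    -- + 5)`.
    have h1 : 0 ≤ (1 + 3 * y + y ^ 2) * e + y * (1 + 2 * y) * d + y ^ (2 * j + 5) * 1 := by
      positivity
    refine h1.trans_eq ?_
    ring

/-- A word which is not a triangle of covered vertices. -/
theorem WordBound.oneTree_le {y : R} (hy : 0 ≤ y) {w : List (Letter R)} {α σ : R}
    (h : WordBound y w α σ) (hk : 2 ≤ w.length) (hodd : Odd (wordVerts w).length)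
    (h3 : (wordVerts w).length = 3 → w.length = 2) :
    oneTree y (α * al y 1 (w.length - 2)) (α * sg y 1 (w.length - 2) +
      σ * al y 1 (w.length - 2)) ≤ wordVal y w := by
  rw [oneTree_mul]
  have verts_nil : wordVerts ([] : List (Letter R)) = [] := rfl
  have verts_cons : ∀ (l : Letter R) w, (wordVerts (l :: w)).length =
      l.verts.length + (wordVerts w).length := by
    intro l w; simp [wordVerts]
  obtain h2 | hk' : w.length = 2 ∨ 3 ≤ w.length := by omega
  · obtain ⟨l, l', rfl⟩ := List.length_eq_two.1 h2
    -- By parity, two letters are one single and one pair; their order is immaterial up to rotation.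
    have aux : ∀ p q p₁ q₁ p₂ q₂ : R, ∀ α σ,
        WordBound y [.single p q, .pair p₁ q₁ p₂ q₂] α σ →
        α * oneTree y (al y 1 0) (sg y 1 0) + σ * ((1 + y) * (1 + 3 * y) * al y 1 0) ≤
          wordVal y [.single p q, .pair p₁ q₁ p₂ q₂] := by
      intro p q p₁ q₁ p₂ q₂ α σ h
      cases h with
      | single h hw =>
        cases hw with
        | pair h₁ h₂ hw =>
          cases hw
          refine le_trans (le_of_eq ?_) (wordVal_single_pair_ge hy h h₁ h₂)
          rw [← oneTree_mul, al_one_zero, sg_one_zero]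
          congr 1 <;> ring
    cases h with
    | single h hw =>
      cases hw with
      | single h' hw =>
        exfalso
        rw [verts_cons, verts_cons, verts_nil] at hodd
        simp [Letter.verts, Nat.odd_iff] at hodd
      | pair h₁ h₂ hw => exact aux _ _ _ _ _ _ _ _ (.single h (.pair h₁ h₂ hw))
    | pair h₁ h₂ hw =>
      cases hw with
      | single h hw =>
        cases hw
        have := aux _ _ _ _ _ _ _ _ (.single h (.pair h₁ h₂ .nil))
        rw [show ∀ a b : Letter R, wordVal y [a, b] = wordVal y [b, a] from
          fun a b => wordVal_append_comm y [a] [b]]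
        refine le_trans (le_of_eq ?_) this
        simp only [List.length_cons, List.length_nil]
        ring
      | pair h₃ h₄ hw =>
        exfalso
        rw [verts_cons, verts_cons, verts_nil] at hodd
        simp [Letter.verts, Nat.odd_iff] at hodd
  · refine le_trans (add_le_add (mul_le_mul_of_nonneg_left ?_ h.nonneg.1) (le_of_eq ?_))
      (h.wordVal_ge hy hk')
    · show wordTarget y (w.length - 2) ≤ _
      have hb : ∀ l ∈ w.map (Letter.base y), IsBaseLetter y l := by
        intro l hl
        obtain ⟨l', -, rfl⟩ := List.mem_map.1 hl
        exact isBaseLetter_base y l'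
      have hl : (wordVerts (w.map (Letter.base y))).length = (wordVerts w).length := by
        clear h hk hodd h3 hk' hb
        induction w with
        | nil => rfl
        | cons l w ih =>
          rw [List.map_cons, verts_cons, verts_cons, ih]
          cases l <;> rfl
      rw [← hl] at hodd h3
      have hlen : (w.map (Letter.base y)).length = w.length := List.length_map _
      rw [← hlen] at hk hk' h3 ⊢
      generalize w.map (Letter.base y) = v at *
      clear hlen hl h
      -- From five letters on, all pairs can be replaced by singles. With four letters parity
      -- provides a pair that must stay, and with three the word is known explicitly.
      obtain h5 | h4 | h3' : 5 ≤ v.length ∨ v.length = 4 ∨ v.length = 3 := by omega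
      · refine (base_singles hy h5).trans ?_
        simpa using wordVal_append_base_ge hy (u := []) hb (by simp) (by simpa using hk')
      · by_cases hp : .pair 1 1 1 1 ∈ v
        · obtain ⟨v₁, v₂, rfl⟩ := List.append_of_mem hp
          rw [wordVal_append_comm, List.cons_append, h4]
          have hl : (v₂ ++ v₁).length = 3 := by simp at h4 ⊢; omega
          have := wordVal_append_base_ge hy (w := v₂ ++ v₁) (u := [.pair 1 1 1 1])
            (fun l hl => hb l (by simp at hl ⊢; tauto)) (by simp [IsBaseLetter])
            (by simp at hl ⊢; omega)
          rw [wordVal_append_comm y (v₂ ++ v₁), hl, wordVal_append_comm] at this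
          exact (base_pair_singles hy).trans this
        · exfalso
          have : v = List.replicate 4 (.single (1 + 2 * y) (1 + y)) := by
            rw [List.eq_replicate_iff]
            refine ⟨h4, fun l hl => (hb l hl).resolve_right fun h => hp (h ▸ hl)⟩
          rw [this] at hodd
          simp [wordVerts, Letter.verts, Nat.odd_iff] at hodd
      · obtain ⟨l₁, l₂, l₃, rfl⟩ := List.length_eq_three.1 h3'
        have b₁ := hb l₁ (by simp)
        have b₂ := hb l₂ (by simp)
        have b₃ := hb l₃ (by simp)
        have r₁ : wordVal y [.pair 1 1 1 1, .single (1 + 2 * y) (1 + y), .pair 1 1 1 1] =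
            wordVal y [.single (1 + 2 * y) (1 + y), .pair 1 1 1 1, .pair 1 1 1 1] :=
          wordVal_append_comm y [.pair 1 1 1 1] _
        have r₂ : wordVal y [.pair 1 1 1 1, .pair 1 1 1 1, .single (1 + 2 * y) (1 + y)] =
            wordVal y [.single (1 + 2 * y) (1 + y), .pair 1 1 1 1, .pair 1 1 1 1] :=
          wordVal_append_comm y [.pair 1 1 1 1, .pair 1 1 1 1] _
        have hB := base_single_pair_pair hy
        rw [verts_cons, verts_cons, verts_cons, verts_nil] at hodd h3
        rcases b₁ with rfl | rfl <;> rcases b₂ with rfl | rfl <;> rcases b₃ with rfl | rfl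
        · simp [Letter.verts] at h3
        · simp [Letter.verts, Nat.odd_iff] at hodd
        · simp [Letter.verts, Nat.odd_iff] at hodd
        · exact hB
        · simp [Letter.verts, Nat.odd_iff] at hodd
        · rw [r₁]; exact hB
        · rw [r₂]; exact hB
        · simp [Letter.verts, Nat.odd_iff] at hodd
    · obtain ⟨j, hj⟩ : ∃ j, w.length = j + 2 := ⟨w.length - 2, by omega⟩
      simp only [hj, Nat.add_sub_cancel, al]
      ring

/-- One path of length two and two pendent edges differ, as dual numbers, by `y - y ε`. Multiplied
by `al + sg ε`, its contribution to `α + σ` is just `y * sg`, so the difference of the targets is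
visibly nonnegative. -/
theorem oneTree_mono {y : R} (hy : 0 ≤ y) (t s : ℕ) :
    oneTree y (al y (t + 2) s) (sg y (t + 2) s) ≤ oneTree y (al y t (s + 1)) (sg y t (s + 1)) := by
  have h1 := al_add y t s 0 1
  have h2 := sg_add y t s 0 1
  have h3 := al_add y t s 2 0
  have h4 := sg_add y t s 2 0
  have e1 : al y 2 0 = (1 + y) ^ 2 := by simp [al]
  have e2 : sg y 2 0 = 2 * (y * (1 + y)) := by simp [sg]; ring
  rw [al_zero_one] at h1 h2
  rw [sg_zero_one] at h2
  simp only [add_zero] at h1 h2 h3 h4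
  rw [h1, h2, h3, h4, e1, e2, ← sub_nonneg, oneTree, oneTree]
  have := sg_nonneg hy t s
  have := al_nonneg hy t s
  have h : 0 ≤ (1 + y) * (1 + 3 * y) * (y * sg y t s) + 2 * (y * (1 + y) * (1 + 2 * y)) * (y * al y t s) := by
    positivity
  refine h.trans_eq ?_
  ring

/-- The comparison of the two extremal graphs for six vertices and matching number three. -/
theorem threeTrees_le_oneTree {y : R} (hy : 0 ≤ y) :
    threeTrees y (al y 1 0) (sg y 1 0) ≤ oneTree y (al y 1 1) (sg y 1 1) := by
  rw [← sub_nonneg]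
  simp [threeTrees, oneTree, al, sg, cyclicVal, transfer, Matrix.trace_fin_two]
  rw [← sub_nonneg]
  ring_nf
  positivity

end WordTheorem

end SignlessLaplacian

namespace SignlessLaplacian

open Polynomial Matrix

/-! ### Determinants of cyclic tridiagonal matrices. -/

section CyclicDet

variable {R : Type*} [CommRing R]

/-- The entries of a tridiagonal matrix with diagonal `d` whose off-diagonal entries in row `a`
are both `u a`. -/
def triEntry (d u : ℕ → R) (a b : ℕ) : R :=
  if a = b then d a else if a + 1 = b ∨ b + 1 = a then u a else 0

/-- The tridiagonal matrix on the indices `s, …, s + n - 1`. -/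
def triMat (d u : ℕ → R) (s n : ℕ) : Matrix (Fin n) (Fin n) R :=
  fun i j => triEntry d u (s + i) (s + j)

/-- The cyclic tridiagonal matrix of size `g`. -/
def cycMat (d u : ℕ → R) (g : ℕ) : Matrix (Fin g) (Fin g) R :=
  fun i j => if ((i : ℕ) = 0 ∧ (j : ℕ) + 1 = g) ∨ ((j : ℕ) = 0 ∧ (i : ℕ) + 1 = g) then u i
    else triEntry d u i j

/-- Products of the transfer matrices of continuants. -/
def contProd (d u : ℕ → R) : ℕ → ℕ → Matrix (Fin 2) (Fin 2) R
  | _, 0 => 1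
  | s, n + 1 => !![d s, - u s; u s, 0] * contProd d u (s + 1) n

theorem contProd_succ_last (d u : ℕ → R) (s n : ℕ) :
    contProd d u s (n + 1) = contProd d u s n * !![d (s + n), - u (s + n); u (s + n), 0] := by
  induction n generalizing s with
  | zero => simp [contProd]
  | succ n ih =>
    rw [contProd, ih, contProd, mul_assoc, add_right_comm s 1 n, add_assoc]

theorem contProd_succ_00 (d u : ℕ → R) (s n : ℕ) :
    contProd d u s (n + 1) 0 0 = d s * contProd d u (s + 1) n 0 0 -
      u s * contProd d u (s + 1) n 1 0 := by
  rw [contProd, Matrix.mul_apply, Fin.sum_univ_two]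
  simp [sub_eq_add_neg]

theorem contProd_succ_10 (d u : ℕ → R) (s n : ℕ) :
    contProd d u s (n + 1) 1 0 = u s * contProd d u (s + 1) n 0 0 := by
  rw [contProd, Matrix.mul_apply, Fin.sum_univ_two]
  simp

theorem contProd_succ_11 (d u : ℕ → R) (s n : ℕ) :
    contProd d u s (n + 2) 1 1 = - (u s * u (s + n + 1)) * contProd d u (s + 1) n 0 0 := by
  rw [contProd, contProd_succ_last, Matrix.mul_apply, Fin.sum_univ_two, Matrix.mul_apply,
    Fin.sum_univ_two]
  simp
  rw [add_right_comm s 1 n]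
  ring

theorem det_triMat_succ_succ (d u : ℕ → R) (s n : ℕ) :
    (triMat d u s (n + 2)).det = d s * (triMat d u (s + 1) (n + 1)).det -
      u s * u (s + 1) * (triMat d u (s + 2) n).det := by
  have e1 : (triMat d u s (n + 2)).submatrix Fin.succ Fin.succ = triMat d u (s + 1) (n + 1) := by
    ext i j
    simp only [triMat, Matrix.submatrix_apply, Fin.val_succ]
    congr 1 <;> ring
  have e2 : (((triMat d u s (n + 2)).submatrix Fin.succ (Fin.succAbove 1)).submatrix
      Fin.succ Fin.succ) = triMat d u (s + 2) n := by
    ext i j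
    have : (Fin.succAbove (1 : Fin (n + 2)) j.succ) = j.succ.succ := by
      rw [Fin.succAbove_of_le_castSucc]
      simp [Fin.le_def]
    simp only [triMat, Matrix.submatrix_apply, this, Fin.val_succ]
    congr 1 <;> ring
  rw [Matrix.det_succ_row_zero, Fin.sum_univ_succ, Fin.sum_univ_succ,
    Finset.sum_eq_zero, Fin.succAbove_zero, e1, Fin.succ_zero_eq_one,
    Matrix.det_succ_column_zero ((triMat d u s (n + 2)).submatrix Fin.succ (Fin.succAbove 1)),
    Fin.sum_univ_succ, Finset.sum_eq_zero, Fin.succAbove_zero, e2]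
  · simp [triMat, triEntry]
    ring
  · intro i _
    simp [triMat, triEntry]
    omega
  · intro i _
    simp [triMat, triEntry]
    omega

theorem det_triMat (d u : ℕ → R) (s n : ℕ) :
    (triMat d u s n).det = contProd d u s n 0 0 := by
  induction n using Nat.strong_induction_on generalizing s with
  | _ n ih =>
    match n, ih with
    | 0, _ => simp [contProd]
    | 1, _ => simp [contProd, triMat, triEntry]
    | n + 2, ih =>
      rw [det_triMat_succ_succ, ih (n + 1) (by omega), ih n (by omega), contProd_succ_00 d u s,
        contProd_succ_10]
      ring

theorem cycMat_eq_zero {d u : ℕ → R} {g : ℕ} {i j : Fin g} (h₁ : (i : ℕ) ≠ j)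
    (h₂ : (i : ℕ) + 1 ≠ j) (h₃ : (j : ℕ) + 1 ≠ i) (h₄ : ¬ ((i : ℕ) = 0 ∧ (j : ℕ) + 1 = g))
    (h₅ : ¬ ((j : ℕ) = 0 ∧ (i : ℕ) + 1 = g)) : cycMat d u g i j = 0 := by
  rw [cycMat, if_neg (by tauto), triEntry, if_neg h₁, if_neg (by tauto)]

/-- Expansion along the first row and then along the first column. The minors are tridiagonal,
giving the trace, or triangular, giving the two cyclic permutations; these are even because the
cycle is odd, so both products enter with a plus sign. -/
theorem det_cycMat (d u : ℕ → R) {n : ℕ} (hn : Even n) :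
    (cycMat d u (n + 3)).det = (contProd d u 0 (n + 3)).trace +
      2 * ∏ i : Fin (n + 3), u i := by
  have e1 : (cycMat d u (n + 3)).submatrix Fin.succ Fin.succ = triMat d u 1 (n + 2) := by
    ext i j
    simp [cycMat, triMat, triEntry, add_comm]
  have e2 : (((cycMat d u (n + 3)).submatrix Fin.succ (Fin.succAbove 1)).submatrix
      Fin.succ Fin.succ).det = (triMat d u 2 (n + 1)).det := by
    congr 1
    ext i j
    have : (Fin.succAbove (1 : Fin (n + 3)) j.succ) = j.succ.succ := by
      rw [Fin.succAbove_of_le_castSucc]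
      simp [Fin.le_def]
    simp only [Matrix.submatrix_apply, this, cycMat, triMat, triEntry, Fin.val_succ,
      add_comm 2, add_left_inj, add_assoc, Nat.reduceAdd]
    rw [if_neg (by omega)]
  have e3 : (((cycMat d u (n + 3)).submatrix Fin.succ (Fin.succAbove 1)).submatrix
      Fin.castSucc Fin.succ).det = ∏ i : Fin (n + 1), u (i + 1) := by
    rw [Matrix.det_of_isLowerTriangular]
    · refine Finset.prod_congr rfl fun i _ => ?_
      have : (Fin.succAbove (1 : Fin (n + 3)) i.succ) = i.succ.succ := by
        rw [Fin.succAbove_of_le_castSucc]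
        simp [Fin.le_def]
      simp only [Matrix.submatrix_apply, this]
      simp [cycMat, triEntry]
    · intro i j hij
      have hij' : (i : ℕ) < j := hij
      have : (Fin.succAbove (1 : Fin (n + 3)) j.succ) = j.succ.succ := by
        rw [Fin.succAbove_of_le_castSucc]
        simp [Fin.le_def]
      simp only [Matrix.submatrix_apply, this]
      simp only [cycMat, triEntry, Fin.val_succ, Fin.val_castSucc]
      rw [if_neg (by omega), if_neg (by omega), if_neg (by omega)]
  have e4 : (((cycMat d u (n + 3)).submatrix Fin.succ Fin.castSucc).submatrix
      Fin.succ Fin.succ).det = ∏ i : Fin (n + 1), u (i + 2) := by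
    rw [Matrix.det_of_isUpperTriangular]
    · refine Finset.prod_congr rfl fun i _ => ?_
      simp only [Matrix.submatrix_apply]
      simp [cycMat, triEntry]
    · intro i j hij
      have hij' : (j : ℕ) < i := hij
      simp only [Matrix.submatrix_apply]
      simp only [cycMat, triEntry, Fin.val_succ, Fin.val_castSucc]
      rw [if_neg (by omega), if_neg (by omega), if_neg (by omega)]
  have e5 : (((cycMat d u (n + 3)).submatrix Fin.succ Fin.castSucc).submatrix
      Fin.castSucc Fin.succ).det = (triMat d u 1 (n + 1)).det := by
    congr 1
    ext i j
    simp only [Matrix.submatrix_apply]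
    have := i.2
    have := j.2
    simp only [cycMat, triMat, triEntry, Fin.val_succ, Fin.val_castSucc, add_comm 1]
    rw [if_neg (by omega)]
  have hs : Fin.succAbove (Fin.last (n + 2)) = Fin.castSucc := by
    ext i; simp
  have hs' : Fin.succAbove (Fin.last (n + 1)) = Fin.castSucc := by
    ext i; simp
  obtain ⟨W, hW⟩ : ∃ W, W = ∏ i : Fin n, u (i + 2) := ⟨_, rfl⟩
  have p3 : ∏ i : Fin (n + 1), u (i + 1) = u 1 * W := by
    rw [Fin.prod_univ_succ, hW]; rfl
  have p4 : ∏ i : Fin (n + 1), u (i + 2) = W * u (n + 2) := by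
    rw [Fin.prod_univ_castSucc, hW]; rfl
  have p : ∏ i : Fin (n + 3), u i = u 0 * (u 1 * (W * u (n + 2))) := by
    rw [Fin.prod_univ_succ, Fin.prod_univ_succ, Fin.prod_univ_castSucc, hW]; rfl
  have z00 : cycMat d u (n + 3) 0 0 = d 0 := by simp [cycMat, triEntry]
  have z01 : cycMat d u (n + 3) 0 1 = u 0 := by simp [cycMat, triEntry]
  have zl : cycMat d u (n + 3) 0 (Fin.last (n + 2)) = u 0 := by simp [cycMat]
  have b0 : (cycMat d u (n + 3)).submatrix Fin.succ (Fin.succAbove 1) 0 0 = u 1 := by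
    simp [cycMat, triEntry]
  have bl : (cycMat d u (n + 3)).submatrix Fin.succ (Fin.succAbove 1) (Fin.last (n + 1)) 0 =
      u (n + 2) := by
    simp [cycMat]
  have c0 : (cycMat d u (n + 3)).submatrix Fin.succ Fin.castSucc 0 0 = u 1 := by
    simp [cycMat, triEntry]
  have cl : (cycMat d u (n + 3)).submatrix Fin.succ Fin.castSucc (Fin.last (n + 1)) 0 =
      u (n + 2) := by
    simp [cycMat]
  rw [Matrix.det_succ_row_zero, Fin.sum_univ_succ, Fin.sum_univ_succ, Fin.succ_zero_eq_one,
    Fin.sum_univ_castSucc, Finset.sum_eq_zero, Fin.succAbove_zero, e1, Fin.succ_last, Fin.succ_last, hs,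
    Matrix.det_succ_column_zero ((cycMat d u (n + 3)).submatrix Fin.succ (Fin.succAbove 1)),
    Matrix.det_succ_column_zero ((cycMat d u (n + 3)).submatrix Fin.succ Fin.castSucc),
    Fin.sum_univ_succ, Fin.sum_univ_castSucc, Finset.sum_eq_zero,
    Fin.sum_univ_succ (n := n + 1), Fin.sum_univ_castSucc, Finset.sum_eq_zero, Fin.succAbove_zero,
    Fin.succ_last, hs', e2, e3, e4, e5,
    p, p3, p4, z00, z01, zl, b0, bl, c0, cl]
  · rw [det_triMat, det_triMat, det_triMat, Matrix.trace_fin_two, contProd_succ_11,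
      contProd_succ_00 d u 0, contProd_succ_10]
    simp only [Fin.val_last, pow_succ, hn.neg_one_pow, Nat.succ_eq_add_one, zero_add,
      add_assoc, Nat.reduceAdd, Fin.coe_ofNat_eq_mod, Nat.zero_mod, pow_zero,
      Nat.mod_eq_of_lt (show 1 < n + 3 by omega)]
    ring
  all_goals
    intro i _
    have := i.2
    try simp only [Matrix.submatrix_apply]
    rw [cycMat_eq_zero (by simp) (by simp) (by simp) (by simp; try omega) (by simp; try omega),
      mul_zero, zero_mul]

/-- The continuant matrices have a negative entry. Conjugation by the involution `!![1, 0; 1, -1]`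
turns them into the transfer matrices, whose entries are sums and products of `p`, `q` and `y`, and
leaves the trace unchanged. -/
theorem det_cycMat_eq_cyclicVal (y : R) (p q : ℕ → R) {n : ℕ} (hn : Even n) :
    (cycMat (fun i => p i + 2 * (y * q i)) (fun i => y * q i) (n + 3)).det =
      cyclicVal y (List.ofFn fun i : Fin (n + 3) => (p i, q i)) := by
  have key : ∀ s m : ℕ, !![(1 : R), 0; 1, -1] *
      ((List.ofFn fun i : Fin m => transfer y (p (s + i)) (q (s + i))).prod) =
      contProd (fun i => p i + 2 * (y * q i)) (fun i => y * q i) s m * !![1, 0; 1, -1] := by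
    intro s m
    induction m generalizing s with
    | zero => simp [contProd]
    | succ m ih =>
      rw [List.ofFn_succ, List.prod_cons, contProd, mul_assoc, ← mul_assoc]
      have h1 : !![(1 : R), 0; 1, -1] * transfer y (p (s + (0 : Fin (m + 1)))) (q (s + (0 : Fin (m + 1)))) =
          !![p s + 2 * (y * q s), -(y * q s); y * q s, 0] * !![1, 0; 1, -1] := by
        ext i j
        fin_cases i <;> fin_cases j <;> simp [transfer, Matrix.mul_apply, Fin.sum_univ_two]
        ring
      rw [h1, mul_assoc, ← ih (s + 1)]
      simp only [Fin.val_succ, add_assoc, add_comm 1]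
  have hinv : !![(1 : R), 0; 1, -1] * !![(1 : R), 0; 1, -1] = 1 := by
    ext i j
    fin_cases i <;> fin_cases j <;> simp [Matrix.mul_apply, Fin.sum_univ_two]
  rw [det_cycMat _ _ hn, cyclicVal]
  congr 1
  · have h := key 0 (n + 3)
    simp only [zero_add] at h
    rw [List.map_ofFn]
    simp only [Function.comp_def]
    generalize (List.ofFn fun i : Fin (n + 3) => transfer y (p i) (q i)).prod = P at h ⊢
    generalize contProd (fun i => p i + 2 * (y * q i)) (fun i => y * q i) 0 (n + 3) = C at h ⊢
    rw [← mul_one C, ← hinv, ← mul_assoc, ← h, Matrix.trace_mul_comm, ← mul_assoc, hinv, one_mul]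
  · rw [List.map_ofFn, List.prod_ofFn]
    rfl

end CyclicDet

end SignlessLaplacian

/-! ### Unicyclic graphs as a cycle with trees; elimination of one vertex. -/

namespace SignlessLaplacian

open Polynomial Matrix

/-- A cycle `c` together with trees attached to it: `nxt` is the successor on the cycle and the
parent elsewhere, `ht` is the distance to the cycle. -/
structure UnicyclicData {V : Type*} (G : SimpleGraph V) (k : ℕ) where
  /-- the vertices of the cycle -/
  c : Fin (k + 3) → V
  /-- the successor or the parent of a vertex -/
  nxt : V → V
  /-- the distance to the cycle -/
  ht : V → ℕ
  c_inj : Function.Injective c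
  nxt_c : ∀ i, nxt (c i) = c (i + 1)
  ht_eq_zero : ∀ v, ht v = 0 ↔ ∃ i, c i = v
  ht_nxt : ∀ v, ht v ≠ 0 → ht (nxt v) + 1 = ht v
  adj_iff : ∀ x y, G.Adj x y ↔ nxt x = y ∨ nxt y = x

namespace UnicyclicData

variable {V : Type*} {G : SimpleGraph V} {k : ℕ} (D : UnicyclicData G k)

include D in
theorem ht_c (i : Fin (k + 3)) : D.ht (D.c i) = 0 := (D.ht_eq_zero _).2 ⟨i, rfl⟩

theorem ht_nxt_eq_zero {v : V} (h : D.ht v = 0) : D.ht (D.nxt v) = 0 := by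
  obtain ⟨i, rfl⟩ := (D.ht_eq_zero v).1 h
  rw [D.nxt_c, D.ht_c]

theorem nxt_ne (v : V) : D.nxt v ≠ v := fun h => G.irrefl ((D.adj_iff v v).2 (Or.inl h))

theorem fin_add_one_add_one_ne (i : Fin (k + 3)) : i + 1 + 1 ≠ i := by
  intro h
  have h2 : (1 + 1 : Fin (k + 3)) = 0 := by
    have := congrArg (· - i) h
    simpa [add_assoc, add_sub_cancel_left, sub_self] using this
  have := congrArg Fin.val h2
  simp [Fin.val_add, Nat.mod_eq_of_lt (show 2 < k + 3 by omega)] at this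

/-- No edge is met from both of its ends by `nxt`; on the cycle this uses that its length is at
least three. -/
theorem nxt_nxt_ne (v : V) : D.nxt (D.nxt v) ≠ v := by
  intro h
  by_cases hv : D.ht v = 0
  · obtain ⟨i, rfl⟩ := (D.ht_eq_zero v).1 hv
    rw [D.nxt_c, D.nxt_c] at h
    exact fin_add_one_add_one_ne i (D.c_inj h)
  · have h1 := D.ht_nxt v hv
    by_cases h2 : D.ht (D.nxt v) = 0
    · have := D.ht_nxt_eq_zero h2
      rw [h] at this
      exact hv this
    · have := D.ht_nxt _ h2
      rw [h] at this
      omega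

variable [Fintype V]

open Classical in
/-- The children of a vertex. -/
noncomputable def ch (v : V) : Finset V := Finset.univ.filter fun x => D.ht x ≠ 0 ∧ D.nxt x = v

theorem mem_ch {x v : V} : x ∈ D.ch v ↔ D.ht x ≠ 0 ∧ D.nxt x = v := by simp [ch]

theorem ht_of_mem_ch {x v : V} (h : x ∈ D.ch v) : D.ht x = D.ht v + 1 := by
  obtain ⟨h1, rfl⟩ := D.mem_ch.1 h
  exact (D.ht_nxt x h1).symm

theorem child_induction {P : V → Prop} (h : ∀ v, (∀ x ∈ D.ch v, P x) → P v) (v : V) : P v := by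
  obtain ⟨N, hN⟩ : ∃ N, ∀ v, D.ht v ≤ N := ⟨Finset.univ.sup D.ht, fun v =>
    Finset.le_sup (f := D.ht) (Finset.mem_univ v)⟩
  have : ∀ m v, N ≤ D.ht v + m → P v := by
    intro m
    induction m with
    | zero =>
      intro v hv
      refine h v fun x hx => ?_
      have := D.ht_of_mem_ch hx
      have := hN x
      omega
    | succ m ih =>
      intro v hv
      refine h v fun x hx => ih x ?_
      have := D.ht_of_mem_ch hx
      omega
  exact this N v (by omega)

/-- Definition by recursion on the children. -/
theorem exists_rec {β : Type*} (b : β) (step : V → (V → β) → β)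
    (hstep : ∀ v f g, (∀ x ∈ D.ch v, f x = g x) → step v f = step v g) :
    ∃ f : V → β, ∀ v, f v = step v f := by
  obtain ⟨N, hN⟩ : ∃ N, ∀ v, D.ht v ≤ N := ⟨Finset.univ.sup D.ht, fun v =>
    Finset.le_sup (f := D.ht) (Finset.mem_univ v)⟩
  -- Iterating the step more often than the greatest height makes the value at every vertex
  -- stationary.
  let F : ℕ → V → β := fun n => (fun f v => step v f)^[n] fun _ => b
  have hF : ∀ n v, F (n + 1) v = step v (F n) := by
    intro n v
    simp only [F, Function.iterate_succ_apply']
  have key : ∀ m v, N < D.ht v + m → F m v = F (m + 1) v := by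
    intro m
    induction m with
    | zero => intro v hv; have := hN v; omega
    | succ m ih =>
      intro v hv
      rw [hF, hF]
      refine hstep _ _ _ fun x hx => ih x ?_
      have := D.ht_of_mem_ch hx
      omega
  exact ⟨F (N + 1), fun v => (key _ v (by omega)).trans (hF _ v)⟩

theorem neighborFinset_of_ne [DecidableEq V] [DecidableRel G.Adj] {v : V} (hv : D.ht v ≠ 0) :
    G.neighborFinset v = insert (D.nxt v) (D.ch v) := by
  ext x
  rw [SimpleGraph.mem_neighborFinset, D.adj_iff, Finset.mem_insert, D.mem_ch, eq_comm (a := x)]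
  refine or_congr_right ⟨fun h => ⟨fun h0 => hv ?_, h⟩, fun h => h.2⟩
  rw [← h]
  exact D.ht_nxt_eq_zero h0

theorem neighborFinset_c [DecidableEq V] [DecidableRel G.Adj] (i : Fin (k + 3)) :
    G.neighborFinset (D.c i) = insert (D.c (i + 1)) (insert (D.c (i - 1)) (D.ch (D.c i))) := by
  ext x
  rw [SimpleGraph.mem_neighborFinset, D.adj_iff, Finset.mem_insert, Finset.mem_insert, D.mem_ch,
    eq_comm (a := x), D.nxt_c]
  refine or_congr_right ⟨fun h => ?_, fun h => ?_⟩
  · by_cases h0 : D.ht x = 0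
    · obtain ⟨j, rfl⟩ := (D.ht_eq_zero x).1 h0
      rw [D.nxt_c] at h
      rw [← D.c_inj h]
      simp
    · exact Or.inr ⟨h0, h⟩
  · rcases h with rfl | h
    · rw [D.nxt_c, sub_add_cancel]
    · exact h.2

theorem degree_of_ne [DecidableRel G.Adj] {v : V} (hv : D.ht v ≠ 0) :
    G.degree v = (D.ch v).card + 1 := by
  classical
  rw [← SimpleGraph.card_neighborFinset_eq_degree, D.neighborFinset_of_ne hv,
    Finset.card_insert_of_notMem]
  intro h
  exact D.nxt_nxt_ne v (D.mem_ch.1 h).2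

theorem degree_c [DecidableRel G.Adj] (i : Fin (k + 3)) :
    G.degree (D.c i) = (D.ch (D.c i)).card + 2 := by
  classical
  rw [← SimpleGraph.card_neighborFinset_eq_degree, D.neighborFinset_c,
    Finset.card_insert_of_notMem, Finset.card_insert_of_notMem]
  · intro h
    exact (D.mem_ch.1 h).1 (D.ht_c _)
  · rw [Finset.mem_insert]
    rintro (h | h)
    · have h1 := D.c_inj h
      apply fin_add_one_add_one_ne (i - 1)
      rw [sub_add_cancel, h1]
    · exact (D.mem_ch.1 h).1 (D.ht_c _)

variable [DecidableEq V]

/-- The pairs of all hanging trees. -/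
structure IsPair (p q : V → ℤ[X]) : Prop where
  hq : ∀ v, q v = ∏ x ∈ D.ch v, (p x + X * q x)
  hp : ∀ v, p v = q v + X * ∑ x ∈ D.ch v, p x * ∏ z ∈ (D.ch v).erase x, (p z + X * q z)

/-- The constant term is 1. This allows the pivots to be cancelled without passing to fractions. -/
theorem IsPair.ne_zero {p q : V → ℤ[X]} (h : D.IsPair p q) (v : V) : p v + X * q v ≠ 0 := by
  suffices H : (p v + X * q v).eval 0 = 1 by
    intro h0
    rw [h0] at H
    simp at H
  induction v using D.child_induction with
  | h v ih =>
    rw [h.hp, h.hq, eval_add, eval_add, eval_mul, eval_mul, eval_X, eval_prod,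
      Finset.prod_congr rfl ih]
    simp

variable [DecidableRel G.Adj]

/-- The matrix `1 + X Q` after eliminating the vertices outside `S`. -/
noncomputable def elimMat (D : UnicyclicData G k) (p q : V → ℤ[X]) (S : Finset V) : Matrix V V ℤ[X] :=
  fun x z => if x ∈ S then
    (if x = z then (∏ t ∈ D.ch x \ S, (p t + X * q t)) * (1 + X * (G.degree x : ℤ[X])) -
        X ^ 2 * ∑ t ∈ D.ch x \ S, q t * ∏ w ∈ (D.ch x \ S).erase t, (p w + X * q w)
      else if z ∈ S ∧ G.Adj x z then X * ∏ t ∈ D.ch x \ S, (p t + X * q t) else 0)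
    else if x = z then 1 else 0

variable {D}

theorem elimMat_off {p q : V → ℤ[X]} {S : Finset V} {x : V} (hx : x ∉ S) (z : V) :
    elimMat D p q S x z = if x = z then 1 else 0 := by
  rw [elimMat, if_neg hx]

theorem elimMat_off_col {p q : V → ℤ[X]} {S : Finset V} {x z : V} (hz : z ∉ S) (hx : x ≠ z) :
    elimMat D p q S x z = 0 := by
  rw [elimMat]
  split_ifs <;> first | rfl | (exfalso; tauto)

-- The diagonal entry at `v` after its children have been eliminated, with denominators cleared. The
-- part of the degree that comes from the children combines with the Schur correction and is
-- absorbed in `p`; only the `d` further edges remain.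
omit [DecidableRel G.Adj] in
theorem IsPair.diag {p q : V → ℤ[X]} (h : D.IsPair p q) (v : V) (d : ℤ[X]) :
    (∏ t ∈ D.ch v, (p t + X * q t)) * (1 + X * (((D.ch v).card : ℤ[X]) + d)) -
      X ^ 2 * ∑ t ∈ D.ch v, q t * ∏ w ∈ (D.ch v).erase t, (p w + X * q w) = p v + X * d * q v := by
  have key : ∑ t ∈ D.ch v, (p t + X * q t) * ∏ w ∈ (D.ch v).erase t, (p w + X * q w) =
      ((D.ch v).card : ℤ[X]) * ∏ t ∈ D.ch v, (p t + X * q t) := by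
    rw [Finset.sum_congr rfl fun t ht => Finset.mul_prod_erase (D.ch v) (fun w => p w + X * q w) ht]
    rw [Finset.sum_const, nsmul_eq_mul]
  have hp := h.hp v
  have hq := h.hq v
  have key2 : ∑ t ∈ D.ch v, (p t + X * q t) * ∏ w ∈ (D.ch v).erase t, (p w + X * q w) =
      ∑ t ∈ D.ch v, p t * ∏ w ∈ (D.ch v).erase t, (p w + X * q w) +
      X * ∑ t ∈ D.ch v, q t * ∏ w ∈ (D.ch v).erase t, (p w + X * q w) := by
    rw [Finset.mul_sum, ← Finset.sum_add_distrib]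
    exact Finset.sum_congr rfl fun t _ => by ring
  rw [hp, ← hq]
  rw [← hq, key2] at key
  linear_combination (-X) * key

/-- One step of fraction-free Gaussian elimination at a vertex `x` all of whose children are gone.
Its pivot is `f = p x + X * q x`; the row of the parent is multiplied by `f` and cleared in column
`x`. -/
theorem IsPair.det_elim {p q : V → ℤ[X]} (h : D.IsPair p q) {S : Finset V} {x : V}
    (hx : x ∈ S) (hx0 : D.ht x ≠ 0) (hch : ∀ z ∈ D.ch x, z ∉ S) (hv : D.nxt x ∈ S) :
    (elimMat D p q S).det = (elimMat D p q (S.erase x)).det := by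
  obtain ⟨v, hvx⟩ : ∃ v, v = D.nxt x := ⟨_, rfl⟩
  have hxv : x ≠ v := hvx ▸ (D.nxt_ne x).symm
  obtain ⟨W, hW⟩ : ∃ W, W = ∏ t ∈ D.ch v \ S, (p t + X * q t) := ⟨_, rfl⟩
  obtain ⟨f, hf⟩ : ∃ f, f = p x + X * q x := ⟨_, rfl⟩
  have hvS : v ∈ S := hvx ▸ hv
  have hvS' : v ∈ S.erase x := Finset.mem_erase.2 ⟨hxv.symm, hvS⟩
  have hU : D.ch v \ S.erase x = insert x (D.ch v \ S) := by
    ext z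
    simp only [Finset.mem_sdiff, Finset.mem_erase, Finset.mem_insert, D.mem_ch]
    by_cases hz : z = x
    · subst hz; simp [hx0, hvx]
    · simp [hz]
  have hxU : x ∉ D.ch v \ S := by simp [hx]
  have hU' : ∀ w ∈ S, w ≠ v → D.ch w \ S.erase x = D.ch w \ S := by
    intro w _ hwv
    ext z
    simp only [Finset.mem_sdiff, Finset.mem_erase, D.mem_ch]
    by_cases hz : z = x
    · subst hz
      have : D.nxt z ≠ w := fun h => hwv (h ▸ hvx.symm)
      simp [this]
    · simp [hz]
  have hUx : D.ch x \ S = D.ch x := Finset.sdiff_eq_self_iff_disjoint.2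
    (Finset.disjoint_left.2 hch)
  have adjx : ∀ w ∈ S, G.Adj x w → w = v := by
    intro w hw hadj
    rcases (D.adj_iff x w).1 hadj with h1 | h1
    · rw [hvx, h1]
    · exfalso
      refine hch w (D.mem_ch.2 ⟨fun h0 => hx0 ?_, h1⟩) hw
      rw [← h1]; exact D.ht_nxt_eq_zero h0
  have adjv : G.Adj v x := (D.adj_iff v x).2 (Or.inr hvx.symm)
  -- rows of the matrix
  have rowx : ∀ z, elimMat D p q S x z = if z = x then f else if z = v then X * q x else 0 := by
    intro z
    rw [elimMat, if_pos hx, hUx]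
    by_cases hz : z = x
    · rw [if_pos hz.symm, if_pos hz, D.degree_of_ne hx0, Nat.cast_add, Nat.cast_one, h.diag, hf,
        mul_one]
    · rw [if_neg (Ne.symm hz), if_neg hz]
      by_cases hzv : z = v
      · rw [if_pos ⟨hzv ▸ hvS, hzv ▸ adjv.symm⟩, if_pos hzv, h.hq]
      · rw [if_neg fun h' => hzv (adjx z h'.1 h'.2), if_neg hzv]
  have colx : ∀ w, w ≠ x → w ≠ v → elimMat D p q S w x = 0 := by
    intro w hwx hwv
    rw [elimMat]
    by_cases hw : w ∈ S
    · rw [if_pos hw, if_neg hwx, if_neg fun h' => hwv (adjx w hw h'.2.symm)]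
    · rw [if_neg hw, if_neg hwx]
  have ent : ∀ w, w ≠ x → w ≠ v → ∀ z, elimMat D p q S w z = elimMat D p q (S.erase x) w z := by
    intro w hwx hwv z
    by_cases hzx : z = x
    · subst hzx
      rw [colx w hwx hwv, elimMat_off_col (by simp) hwx]
    · by_cases hw : w ∈ S
      · rw [elimMat, elimMat, if_pos hw, if_pos (Finset.mem_erase.2 ⟨hwx, hw⟩), hU' w hw hwv]
        simp [hzx]
      · rw [elimMat_off hw, elimMat_off (by simp [hw])]
  have rowv : ∀ z, elimMat D p q (S.erase x) v z =
      f * elimMat D p q S v z - X * W * elimMat D p q S x z := by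
    intro z
    rw [rowx]
    by_cases hzx : z = x
    · rw [hzx, elimMat_off_col (by simp) hxv.symm, if_pos rfl, elimMat, if_pos hvS,
        if_neg hxv.symm, if_pos ⟨hx, adjv⟩, ← hW]
      ring
    · rw [if_neg hzx, elimMat, elimMat, if_pos hvS', if_pos hvS, hU, Finset.prod_insert hxU, ← hW,
        ← hf]
      by_cases hzv : z = v
      · rw [if_pos hzv.symm, if_pos hzv.symm, if_pos hzv, Finset.sum_insert hxU,
          Finset.erase_insert hxU, ← hW]
        have : ∑ t ∈ D.ch v \ S, q t * ∏ w ∈ (insert x (D.ch v \ S)).erase t, (p w + X * q w) =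
            f * ∑ t ∈ D.ch v \ S, q t * ∏ w ∈ (D.ch v \ S).erase t, (p w + X * q w) := by
          rw [Finset.mul_sum]
          refine Finset.sum_congr rfl fun t ht => ?_
          rw [Finset.erase_insert_of_ne (by rintro rfl; exact hxU ht), Finset.prod_insert, ← hf]
          · ring
          · simp [hx]
        rw [this]
        ring
      · rw [if_neg (Ne.symm hzv), if_neg (Ne.symm hzv), if_neg hzv]
        simp only [Finset.mem_erase, ne_eq, hzx, not_false_eq_true, true_and]
        split_ifs <;> ring
  obtain ⟨A, hA⟩ : ∃ A, A = elimMat D p q S := ⟨_, rfl⟩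
  obtain ⟨B, hB⟩ : ∃ B, B = elimMat D p q (S.erase x) := ⟨_, rfl⟩
  rw [← hA, ← hB]
  simp only [← hA, ← hB] at rowx rowv ent colx
  -- The mixed matrix, with row `x` of the old matrix and all other rows of the new one, has
  -- determinant `f` times the old one by row operations, and `f` times the new one because its
  -- column `x` vanishes off the diagonal.
  have h1 : (B.updateRow x (A x)).det = f * A.det := by
    have e1 : B.updateRow x (A x) =
        (A.updateRow v (f • A v)).updateRow v ((A.updateRow v (f • A v)) v +
          (-(X * W)) • (A.updateRow v (f • A v)) x) := by
      ext w z : 2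
      by_cases hwv : w = v
      · subst hwv
        rw [Matrix.updateRow_ne hxv.symm, Matrix.updateRow_self]
        simp only [Matrix.updateRow_self, Matrix.updateRow_ne hxv, Pi.add_apply, Pi.smul_apply,
          smul_eq_mul]
        rw [rowv, neg_mul, ← sub_eq_add_neg]
      · rw [Matrix.updateRow_ne hwv, Matrix.updateRow_ne hwv]
        by_cases hwx : w = x
        · subst hwx; rw [Matrix.updateRow_self]
        · rw [Matrix.updateRow_ne hwx, ent w hwx hwv]
    rw [e1, Matrix.det_updateRow_add_smul_self _ hxv.symm, Matrix.det_updateRow_smul,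
      Matrix.updateRow_eq_self]
  have h2 : (B.updateRow x (A x)).det = f * B.det := by
    have e1 : A x = f • B x + (X * q x) • Pi.single v 1 := by
      ext z : 1
      rw [rowx, Pi.add_apply, Pi.smul_apply, Pi.smul_apply, hB, elimMat_off (by simp),
        Pi.single_apply]
      by_cases hzx : z = x
      · subst hzx; simp [hxv]
      · simp [hzx, Ne.symm hzx]
    have e2 : (B.updateRow x (Pi.single v 1)).det = 0 := by
      refine Matrix.det_eq_zero_of_column_eq_zero x fun w => ?_
      by_cases hwx : w = x
      · subst hwx
        rw [Matrix.updateRow_self, Pi.single_apply, if_neg hxv]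
      · rw [Matrix.updateRow_ne hwx, hB, elimMat_off_col (by simp) hwx]
    rw [e1, Matrix.det_updateRow_add, Matrix.det_updateRow_smul, Matrix.det_updateRow_smul, e2,
      Matrix.updateRow_eq_self, mul_zero, add_zero]
  exact mul_left_cancel₀ (hf ▸ h.ne_zero D x) (h1.symm.trans h2)

end UnicyclicData

end SignlessLaplacian

/-! ### Reduction of the determinant to the cycle. -/

namespace SignlessLaplacian

open Polynomial Matrix

namespace UnicyclicData

variable {V : Type*} {G : SimpleGraph V} {k : ℕ} {D : UnicyclicData G k} [Fintype V]
  [DecidableEq V]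

omit [Fintype V] in
theorem nxt_notMem_of_child {S : Finset V} (hS : ∀ x ∈ S, D.nxt x ∈ S) {x : V} (hx0 : D.ht x ≠ 0)
    (hch : ∀ z, D.ht z ≠ 0 → D.nxt z = x → z ∉ S) : ∀ z ∈ S.erase x, D.nxt z ∈ S.erase x := by
  intro z hz
  obtain ⟨hzx, hz⟩ := Finset.mem_erase.1 hz
  refine Finset.mem_erase.2 ⟨fun h => ?_, hS z hz⟩
  by_cases h0 : D.ht z = 0
  · apply hx0
    rw [← h]
    exact D.ht_nxt_eq_zero h0
  · exact hch z h0 h hz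

/-- Eliminating all trees. -/
theorem IsPair.det_elim_trees [DecidableRel G.Adj] {p q : V → ℤ[X]} (h : D.IsPair p q) (S : Finset V)
    (hS : ∀ x ∈ S, D.nxt x ∈ S) (hc : ∀ i, D.c i ∈ S) :
    (elimMat D p q S).det = (elimMat D p q (Finset.univ.image D.c)).det := by
  induction hn : S.card using Nat.strong_induction_on generalizing S with
  | _ n ih =>
    by_cases h0 : ∃ x ∈ S, D.ht x ≠ 0
    · obtain ⟨x, hx, hmax⟩ := Finset.exists_max_image (S.filter fun x => D.ht x ≠ 0) D.ht
        (h0.imp fun x hx => Finset.mem_filter.2 hx)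
      obtain ⟨hxS, hx0⟩ := Finset.mem_filter.1 hx
      have hch : ∀ z ∈ D.ch x, z ∉ S := by
        intro z hz hzS
        have h1 := D.ht_of_mem_ch hz
        have := hmax z (Finset.mem_filter.2 ⟨hzS, by omega⟩)
        omega
      rw [h.det_elim hxS hx0 hch (hS x hxS)]
      refine ih (S.erase x).card ?_ _ ?_ ?_ rfl
      · rw [← hn]; exact Finset.card_erase_lt_of_mem hxS
      · exact nxt_notMem_of_child hS hx0 fun z h1 h2 => hch z (D.mem_ch.2 ⟨h1, h2⟩)
      · intro i
        refine Finset.mem_erase.2 ⟨fun h => hx0 (h ▸ D.ht_c i), hc i⟩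
    · congr 2
      ext x
      simp only [Finset.mem_image, Finset.mem_univ, true_and]
      rw [← D.ht_eq_zero]
      push Not at h0
      refine ⟨h0 x, fun hx => ?_⟩
      obtain ⟨i, rfl⟩ := (D.ht_eq_zero x).1 hx
      exact hc i

omit [Fintype V] [DecidableEq V] in
theorem c_adj_iff (i j : Fin (k + 3)) : G.Adj (D.c i) (D.c j) ↔ j = i + 1 ∨ i = j + 1 := by
  rw [D.adj_iff, D.nxt_c, D.nxt_c, D.c_inj.eq_iff, D.c_inj.eq_iff, eq_comm, eq_comm (a := j + 1)]

theorem fin_eq_add_one_iff (i j : Fin (k + 3)) :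
    j = i + 1 ↔ (i : ℕ) + 1 = j ∨ ((j : ℕ) = 0 ∧ (i : ℕ) + 1 = k + 3) := by
  have := i.2
  have := j.2
  rw [Fin.ext_iff, Fin.val_add_eq_ite]
  simp only [Fin.coe_ofNat_eq_mod, Nat.mod_eq_of_lt (show 1 < k + 3 by omega)]
  split_ifs <;> omega

/-- The generating polynomial of a unicyclic graph of odd girth. -/
theorem IsPair.phiPoly_eq {p q : V → ℤ[X]} (h : D.IsPair p q) (hk : Even k) :
    phiPoly G = cyclicVal X (List.ofFn fun i => (p (D.c i), q (D.c i))) := by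
  classical
  have h1 : phiPoly G = (elimMat D p q Finset.univ).det := by
    have hU : ∀ x, D.ch x \ Finset.univ = ∅ := fun x => Finset.sdiff_eq_empty_iff_subset.2 (by simp)
    unfold phiPoly
    convert rfl using 2
    ext x z : 1
    by_cases hxz : x = z
    · subst hxz
      simp [elimMat, hU, signlessLaplacian, SimpleGraph.degMatrix]
    · simp [elimMat, hU, signlessLaplacian, SimpleGraph.degMatrix, hxz,
        SimpleGraph.adjMatrix_apply]
  rw [h1, h.det_elim_trees _ (by simp) (by simp)]
  -- Rows outside the cycle are rows of the identity, so only the block of the cycle vertices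
  -- matters.
  have h2 : elimMat D p q (Finset.univ.image D.c) = Matrix.of
      ((Finset.univ.image D.c).piecewise (elimMat D p q (Finset.univ.image D.c)).row
        (1 : Matrix V V ℤ[X]).row) := by
    ext x z : 1
    by_cases hx : x ∈ Finset.univ.image D.c
    · simp [Finset.piecewise, hx, Matrix.row]
    · rw [elimMat_off hx]
      simp only [Matrix.of_apply, Finset.piecewise, hx, if_false, Matrix.row, Matrix.one_apply]
  rw [h2, det_piecewise_one_eq_submatrix_det]
  let e : Fin (k + 3) ≃ {x // x ∈ Finset.univ.image D.c} :=
    Equiv.ofBijective (fun i => ⟨D.c i, Finset.mem_image_of_mem _ (Finset.mem_univ i)⟩)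
      ⟨fun i j hij => D.c_inj (congrArg Subtype.val hij), by
        rintro ⟨x, hx⟩
        obtain ⟨i, -, rfl⟩ := Finset.mem_image.1 hx
        exact ⟨i, rfl⟩⟩
  rw [← Matrix.det_submatrix_equiv_self e]
  have h3 := det_cycMat_eq_cyclicVal (X : ℤ[X]) (fun n => p (D.c (Fin.ofNat (k + 3) n)))
    (fun n => q (D.c (Fin.ofNat (k + 3) n))) hk
  have hv : ∀ i : Fin (k + 3), Fin.ofNat (k + 3) (i : ℕ) = i := fun i => by
    ext; simp
  simp only [hv] at h3
  rw [← h3]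
  congr 1
  ext i j : 1
  have hU : ∀ i, D.ch (D.c i) \ Finset.univ.image D.c = D.ch (D.c i) := by
    intro i
    refine Finset.sdiff_eq_self_iff_disjoint.2 (Finset.disjoint_left.2 fun z hz hz' => ?_)
    obtain ⟨j, -, rfl⟩ := Finset.mem_image.1 hz'
    exact (D.mem_ch.1 hz).1 (D.ht_c j)
  show elimMat D p q (Finset.univ.image D.c) (D.c i) (D.c j) = _
  rw [elimMat, if_pos (Finset.mem_image_of_mem _ (Finset.mem_univ i)), hU]
  by_cases hij : i = j
  · subst hij
    rw [if_pos rfl, D.degree_c, Nat.cast_add, Nat.cast_ofNat, h.diag]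
    have := i.2
    rw [cycMat, if_neg (by omega), triEntry, if_pos rfl, hv]
    ring
  · have hij' : (i : ℕ) ≠ j := fun h => hij (Fin.ext h)
    rw [if_neg fun h => hij (D.c_inj h), c_adj_iff, fin_eq_add_one_iff, fin_eq_add_one_iff,
      ← h.hq, cycMat, triEntry, if_neg hij', hv]
    have hm : D.c j ∈ Finset.univ.image D.c := Finset.mem_image_of_mem _ (Finset.mem_univ j)
    simp only [hm, true_and]
    split_ifs <;> first | rfl | (exfalso; omega)

end UnicyclicData

end SignlessLaplacian

namespace SignlessLaplacian

open Polynomial Matrix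

namespace UnicyclicData

/-! ### Existence of the decomposition into a cycle and trees. -/

section Construct

variable {V : Type*} {G : SimpleGraph V} {k : ℕ}

theorem sym2_nxt_injective {c : Fin (k + 3) → V} {nxt : V → V} {ht : V → ℕ}
    (c_inj : Function.Injective c) (nxt_c : ∀ i, nxt (c i) = c (i + 1))
    (ht_eq_zero : ∀ v, ht v = 0 ↔ ∃ i, c i = v) (ht_nxt : ∀ v, ht v ≠ 0 → ht (nxt v) + 1 = ht v) :
    Function.Injective fun v => s(v, nxt v) := by
  intro v w h
  rcases Sym2.eq_iff.1 h with ⟨h, -⟩ | ⟨h1, h2⟩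
  · exact h
  exfalso
  have h0 : ∀ v, ht v = 0 → ht (nxt v) = 0 := by
    intro v hv
    obtain ⟨i, rfl⟩ := (ht_eq_zero v).1 hv
    exact (ht_eq_zero _).2 ⟨i + 1, (nxt_c i).symm⟩
  by_cases hv : ht v = 0
  · obtain ⟨i, rfl⟩ := (ht_eq_zero v).1 hv
    rw [nxt_c] at h2
    rw [← h2, nxt_c] at h1
    exact fin_add_one_add_one_ne i (c_inj h1).symm
  · have e1 := ht_nxt v hv
    rw [h2] at e1
    by_cases hw : ht w = 0
    · have := h0 w hw
      rw [← h1] at this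
      exact hv this
    · have e2 := ht_nxt w hw
      rw [← h1] at e2
      omega

/-- In a connected graph with as many edges as vertices, every cycle gives rise to a decomposition
into the cycle and trees attached to it. -/
theorem exists_of_cycle [Fintype V] (hG : G.Connected) (hE : G.edgeSet.ncard = Fintype.card V)
    (c : Fin (k + 3) → V) (c_inj : Function.Injective c) (hc : ∀ i, G.Adj (c i) (c (i + 1))) :
    Nonempty (UnicyclicData G k) := by
  classical
  obtain ⟨ht, hht⟩ : ∃ ht : V → ℕ, ∀ v, ht v = ⨅ i, G.dist v (c i) := ⟨_, fun _ => rfl⟩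
  have hex : ∀ v, ∃ i, ht v = G.dist v (c i) := fun v => by
    obtain ⟨i, hi⟩ := exists_eq_ciInf_of_finite (f := fun i => G.dist v (c i))
    exact ⟨i, by rw [hht]; exact hi.symm⟩
  have hle : ∀ v i, ht v ≤ G.dist v (c i) := fun v i => by
    rw [hht]; exact ciInf_le' _ i
  have h0 : ∀ v, ht v = 0 ↔ ∃ i, c i = v := by
    intro v
    constructor
    · intro hv
      obtain ⟨i, hi⟩ := hex v
      exact ⟨i, ((hG.dist_eq_zero_iff).1 (hi.symm.trans hv)).symm⟩
    · rintro ⟨i, rfl⟩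
      have := hle (c i) i
      rw [SimpleGraph.dist_self] at this
      omega
  have hpred : ∀ v, ht v ≠ 0 → ∃ u, G.Adj v u ∧ ht u + 1 = ht v := by
    intro v hv
    obtain ⟨i, hi⟩ := hex v
    obtain ⟨p, hp⟩ := hG.exists_walk_length_eq_dist v (c i)
    cases p with
    | nil => exact absurd ((h0 _).2 ⟨i, rfl⟩) hv
    | @cons _ u _ h p =>
      refine ⟨u, h, ?_⟩
      rw [SimpleGraph.Walk.length_cons] at hp
      have h1 := SimpleGraph.dist_le p
      have h2 := hle u i
      obtain ⟨j, hj⟩ := hex u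
      have h3 := hle v j
      have h4 := hG.dist_triangle (u := v) (v := u) (w := c j)
      rw [SimpleGraph.dist_eq_one_iff_adj.2 h] at h4
      omega
  choose! pred hpred using hpred
  obtain ⟨ic, hic⟩ : ∃ ic : V → Fin (k + 3), ∀ i, ic (c i) = i :=
    ⟨Function.invFun c, Function.leftInverse_invFun c_inj⟩
  obtain ⟨nxt, hnxt⟩ : ∃ nxt : V → V, ∀ v, nxt v = if ht v = 0 then c (ic v + 1) else pred v :=
    ⟨_, fun _ => rfl⟩
  have nxt_c : ∀ i, nxt (c i) = c (i + 1) := by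
    intro i
    rw [hnxt, if_pos ((h0 _).2 ⟨i, rfl⟩), hic]
  have ht_nxt : ∀ v, ht v ≠ 0 → ht (nxt v) + 1 = ht v := by
    intro v hv
    rw [hnxt, if_neg hv]
    exact (hpred v hv).2
  have hadj : ∀ v, G.Adj v (nxt v) := by
    intro v
    by_cases hv : ht v = 0
    · obtain ⟨i, rfl⟩ := (h0 v).1 hv
      rw [nxt_c]
      exact hc i
    · rw [hnxt, if_neg hv]
      exact (hpred v hv).1
  have hinj := sym2_nxt_injective c_inj nxt_c h0 ht_nxt
  refine ⟨⟨c, nxt, ht, c_inj, nxt_c, h0, ht_nxt, fun x y => ⟨fun h => ?_, fun h => ?_⟩⟩⟩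
  -- The edges `s(v, nxt v)` are pairwise distinct, one for each vertex. As there are no more edges
  -- than vertices, they exhaust the graph.
  · have hsub : Set.range (fun v => s(v, nxt v)) ⊆ G.edgeSet := by
      rintro _ ⟨v, rfl⟩
      exact hadj v
    have heq : Set.range (fun v => s(v, nxt v)) = G.edgeSet := by
      refine Set.eq_of_subset_of_ncard_le hsub ?_ (Set.toFinite _)
      rw [hE, ← Set.image_univ, Set.ncard_image_of_injective _ hinj, Set.ncard_univ,
        Nat.card_eq_fintype_card]
    have : s(x, y) ∈ Set.range (fun v => s(v, nxt v)) := heq ▸ h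
    obtain ⟨v, hv⟩ := this
    rcases Sym2.eq_iff.1 hv with ⟨rfl, h'⟩ | ⟨rfl, h'⟩
    · exact Or.inl h'
    · exact Or.inr h'
  · rcases h with rfl | rfl
    · exact hadj x
    · exact (hadj y).symm

/-- Unicyclic graphs of odd girth. -/
theorem exists_of_isUnicyclic [Fintype V] (hG : IsUnicyclic G) (hodd : Odd G.girth) :
    ∃ k, Even k ∧ Nonempty (UnicyclicData G k) := by
  have hac : ¬ G.IsAcyclic := by
    intro h
    rw [SimpleGraph.girth_eq_zero.2 h] at hodd
    exact absurd hodd (by decide)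
  obtain ⟨a, w, hw, hlen⟩ := SimpleGraph.exists_girth_eq_length.2 hac
  have h3 := hw.three_le_length
  obtain ⟨k, hk⟩ : ∃ k, w.length = k + 3 := ⟨w.length - 3, by omega⟩
  refine ⟨k, ?_, ?_⟩
  · rw [hlen, hk] at hodd
    rw [Nat.odd_iff] at hodd
    rw [Nat.even_iff]
    omega
  · refine exists_of_cycle hG.1 hG.2 (fun i => w.getVert i) ?_ ?_
    · intro i j hij
      have := hw.getVert_injOn' (x₁ := (i : ℕ)) (x₂ := (j : ℕ)) (by have := i.2; simp; omega)
        (by have := j.2; simp; omega) hij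
      exact Fin.ext this
    · intro i
      have h1 := w.adj_getVert_succ (i := i) (by have := i.2; omega)
      rcases (fin_eq_add_one_iff i (i + 1)).1 rfl with h | ⟨h, h'⟩
      · rw [h] at h1; exact h1
      · have h2 : w.getVert ((i : ℕ) + 1) = w.getVert ((i + 1 : Fin (k + 3)) : ℕ) := by
          rw [h'.trans hk.symm, w.getVert_length, h, w.getVert_zero]
        rw [h2] at h1
        exact h1

variable (D : UnicyclicData G k)

include D in
theorem connected : G.Connected := by
  have hc : ∀ i : Fin (k + 3), G.Reachable (D.c 0) (D.c i) := by
    intro i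
    have : ∀ n : ℕ, G.Reachable (D.c 0) (D.c (Fin.ofNat (k + 3) n)) := by
      intro n
      induction n with
      | zero => exact SimpleGraph.Reachable.refl _
      | succ n ih =>
        refine ih.trans (SimpleGraph.Adj.reachable ?_)
        rw [c_adj_iff]
        left
        ext
        simp [Fin.val_add]
    have := this i
    rwa [show Fin.ofNat (k + 3) (i : ℕ) = i by ext; simp] at this
  have h : ∀ n v, D.ht v = n → G.Reachable (D.c 0) v := by
    intro n
    induction n with
    | zero =>
      intro v hv
      obtain ⟨i, rfl⟩ := (D.ht_eq_zero v).1 hv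
      exact hc i
    | succ n ih =>
      intro v hv
      have h1 := D.ht_nxt v (by omega)
      exact (ih (D.nxt v) (by omega)).trans
        ((D.adj_iff _ _).2 (Or.inr rfl) : G.Adj (D.nxt v) v).reachable
  have : Nonempty V := ⟨D.c 0⟩
  exact ⟨fun u v => (h _ u rfl).symm.trans (h _ v rfl)⟩

theorem nxt_injective : Function.Injective fun v => s(v, D.nxt v) :=
  sym2_nxt_injective D.c_inj D.nxt_c D.ht_eq_zero D.ht_nxt

theorem edgeSet_eq : G.edgeSet = Set.range fun v => s(v, D.nxt v) := by
  ext e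
  induction e with
  | _ x y =>
    rw [SimpleGraph.mem_edgeSet, D.adj_iff]
    constructor
    · rintro (rfl | rfl)
      · exact ⟨x, rfl⟩
      · exact ⟨y, Sym2.eq_swap⟩
    · rintro ⟨v, hv⟩
      rcases Sym2.eq_iff.1 hv with ⟨rfl, h⟩ | ⟨rfl, h⟩
      · exact Or.inl h
      · exact Or.inr h

include D in
theorem isUnicyclic [Fintype V] : IsUnicyclic G := by
  refine ⟨D.connected, ?_⟩
  rw [D.edgeSet_eq, ← Set.image_univ, Set.ncard_image_of_injective _ D.nxt_injective, Set.ncard_univ,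
    Nat.card_eq_fintype_card]

end Construct

end UnicyclicData

end SignlessLaplacian

namespace SignlessLaplacian

open Polynomial Matrix

/-! ### Bounds for a root with several branches. -/

section Joins

variable {R : Type*} [CommRing R] [PartialOrder R] [IsOrderedRing R] [Nontrivial R]

/-- A bound for a rooted tree by `t` pendent edges and `s` pendent paths of length two; if the
root is covered, then one more pendent edge is available. -/
def TreeBound (y p q : R) (M : Prop) (t s : ℕ) : Prop :=
  (M → Covered y p q (al y t s) (sg y t s)) ∧ (¬ M → Exposed y p q (al y t s) (sg y t s))

variable {ι : Type*} [DecidableEq ι]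

/-- The first entry of the pair of a root with the branches `U`. -/
def rootP (y : R) (p q : ι → R) (U : Finset ι) : R :=
  ∏ x ∈ U, (p x + y * q x) + y * ∑ x ∈ U, p x * ∏ z ∈ U.erase x, (p z + y * q z)

/-- The second entry of the pair of a root with the branches `U`. -/
def rootQ (y : R) (p q : ι → R) (U : Finset ι) : R := ∏ x ∈ U, (p x + y * q x)

omit [PartialOrder R] [IsOrderedRing R] [Nontrivial R] in
theorem rootP_insert (y : R) (p q : ι → R) {U : Finset ι} {x : ι} (hx : x ∉ U) :
    rootP y p q (insert x U) = (p x + y * q x) * rootP y p q U + y * p x * rootQ y p q U := by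
  have : ∑ z ∈ U, p z * ∏ w ∈ (insert x U).erase z, (p w + y * q w) =
      (p x + y * q x) * ∑ z ∈ U, p z * ∏ w ∈ U.erase z, (p w + y * q w) := by
    rw [Finset.mul_sum]
    refine Finset.sum_congr rfl fun z hz => ?_
    rw [Finset.erase_insert_of_ne (by rintro rfl; exact hx hz), Finset.prod_insert]
    · ring
    · simp [hx]
  rw [rootP, rootP, rootQ, Finset.prod_insert hx, Finset.sum_insert hx, Finset.erase_insert hx, this]
  ring

omit [PartialOrder R] [IsOrderedRing R] [Nontrivial R] in
theorem rootQ_insert (y : R) (p q : ι → R) {U : Finset ι} {x : ι} (hx : x ∉ U) :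
    rootQ y p q (insert x U) = (p x + y * q x) * rootQ y p q U := by
  rw [rootQ, rootQ, Finset.prod_insert hx]

/-- Each covered child, with its reserved pendent edge, becomes a pendent path of length two, and
the rest of its load moves up to the root. -/
theorem exposed_root {y : R} (hy : 0 ≤ y) {p q : ι → R} {t s : ι → ℕ} {U : Finset ι}
    (h : ∀ x ∈ U, Covered y (p x) (q x) (al y (t x) (s x)) (sg y (t x) (s x))) :
    Exposed y (rootP y p q U) (rootQ y p q U) (al y (∑ x ∈ U, t x) (∑ x ∈ U, (s x + 1)))
      (sg y (∑ x ∈ U, t x) (∑ x ∈ U, (s x + 1))) := by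
  induction U using Finset.induction_on with
  | empty => simpa [rootP, rootQ] using exposed_single y
  | insert x U hx ih =>
    have h1 := (ih fun z hz => h z (Finset.mem_insert_of_mem hz)).join_covered hy
      (h x (Finset.mem_insert_self x U))
    rw [rootP_insert y p q hx, rootQ_insert y p q hx, Finset.sum_insert hx, Finset.sum_insert hx]
    convert h1 using 1
    · rw [show t x + ∑ x ∈ U, t x = (∑ x ∈ U, t x + t x) + 0 by ring,
        show s x + 1 + ∑ x ∈ U, (s x + 1) = (∑ x ∈ U, (s x + 1) + s x) + 1 by ring,
        al_add, al_add, al_zero_one]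
      ring
    · rw [show t x + ∑ x ∈ U, t x = (∑ x ∈ U, t x + t x) + 0 by ring,
        show s x + 1 + ∑ x ∈ U, (s x + 1) = (∑ x ∈ U, (s x + 1) + s x) + 1 by ring,
        sg_add, sg_add, al_add, al_zero_one, sg_zero_one]
      ring

/-- One of the resulting paths is taken apart into two pendent edges. One becomes the reserved edge
of the root, the other is counted in the first parameter. -/
theorem covered_of_exposed_root {y : R} (hy : 0 ≤ y) {p q : ι → R} {t s : ι → ℕ} {U : Finset ι}
    (h : ∀ x ∈ U, Covered y (p x) (q x) (al y (t x) (s x)) (sg y (t x) (s x)))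
    (hU : U.Nonempty) {s' : ℕ} (hs' : ∑ x ∈ U, (s x + 1) = s' + 1) :
    Covered y (rootP y p q U) (rootQ y p q U) (al y (∑ x ∈ U, t x + 1) s')
      (sg y (∑ x ∈ U, t x + 1) s') := by
  obtain ⟨x, hx⟩ := hU
  have hx' : x ∉ U.erase x := Finset.notMem_erase x U
  have h1 := (exposed_root hy fun z hz => h z (Finset.mem_of_mem_erase hz) :
    Exposed y (rootP y p q (U.erase x)) _ _ _).match_covered hy (h x hx)
  rw [← Finset.insert_erase hx, rootP_insert y p q hx', rootQ_insert y p q hx']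
  rw [← Finset.insert_erase hx, Finset.sum_insert hx'] at hs'
  rw [Finset.sum_insert hx']
  generalize U.erase x = W at *
  obtain rfl : s' = s x + ∑ x ∈ W, (s x + 1) := by omega
  convert h1 using 1
  · rw [show t x + ∑ x ∈ W, t x + 1 = (∑ x ∈ W, t x + t x) + 1 by ring,
      show s x + ∑ x ∈ W, (s x + 1) = (∑ x ∈ W, (s x + 1) + s x) + 0 by ring,
      al_add, al_add, al_one_zero]
    ring
  · rw [show t x + ∑ x ∈ W, t x + 1 = (∑ x ∈ W, t x + t x) + 1 by ring,
      show s x + ∑ x ∈ W, (s x + 1) = (∑ x ∈ W, (s x + 1) + s x) + 0 by ring,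
      sg_add, sg_add, al_add, al_one_zero, sg_one_zero]
    ring

-- One unmarked child is matched to the root and serves as the reserved pendent edge, hence the
-- subtraction in `t'`. The other unmarked children become pendent edges, the marked ones pendent
-- paths.
open Classical in
theorem covered_root {y : R} (hy : 0 ≤ y) {p q : ι → R} {M : ι → Prop} {t s : ι → ℕ} {U : Finset ι}
    (h : ∀ x ∈ U, TreeBound y (p x) (q x) (M x) (t x) (s x)) (hU : ∃ x ∈ U, ¬ M x) {t' : ℕ}
    (ht' : ∑ x ∈ U, (t x + if M x then 0 else 1) = t' + 1) :
    Covered y (rootP y p q U) (rootQ y p q U) (al y t' (∑ x ∈ U, (s x + if M x then 1 else 0)))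
      (sg y t' (∑ x ∈ U, (s x + if M x then 1 else 0))) := by
  obtain ⟨x, hx, hM⟩ := hU
  suffices H : ∀ W : Finset ι, x ∉ W → (∀ z ∈ W, TreeBound y (p z) (q z) (M z) (t z) (s z)) →
      Covered y (rootP y p q (insert x W)) (rootQ y p q (insert x W))
        (al y (t x + ∑ x ∈ W, (t x + if M x then 0 else 1))
          (s x + ∑ x ∈ W, (s x + if M x then 1 else 0)))
        (sg y (t x + ∑ x ∈ W, (t x + if M x then 0 else 1))
          (s x + ∑ x ∈ W, (s x + if M x then 1 else 0))) by
    have hx' : x ∉ U.erase x := Finset.notMem_erase x U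
    have := H (U.erase x) hx' fun z hz => h z (Finset.mem_of_mem_erase hz)
    rw [Finset.insert_erase hx] at this
    rw [← Finset.insert_erase hx, Finset.sum_insert hx', if_neg hM] at ht'
    have h2 : ∑ x ∈ U, (s x + if M x then 1 else 0) =
        s x + ∑ x ∈ U.erase x, (s x + if M x then 1 else 0) := by
      conv_lhs => rw [← Finset.insert_erase hx, Finset.sum_insert hx', if_neg hM]
      ring
    rw [h2]
    convert this using 2 <;> omega
  intro W hxW hW
  induction W using Finset.induction_on with
  | empty =>
    rw [rootP_insert y p q hxW, rootQ_insert y p q hxW]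
    simpa [rootP, rootQ] using ((h x hx).2 hM).match_single hy
  | insert z W hz ih =>
    have hxW' : x ∉ W := fun h => hxW (Finset.mem_insert_of_mem h)
    have hzx : z ∉ insert x W := by
      rw [Finset.mem_insert, not_or]
      exact ⟨fun h => hxW (h ▸ Finset.mem_insert_self z W), hz⟩
    have h1 := ih hxW' fun w hw => hW w (Finset.mem_insert_of_mem hw)
    rw [Finset.insert_comm, rootP_insert y p q hzx, rootQ_insert y p q hzx, Finset.sum_insert hz,
      Finset.sum_insert hz]
    generalize ∑ x ∈ W, (t x + if M x then 0 else 1) = t₁ at h1 ⊢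
    generalize ∑ x ∈ W, (s x + if M x then 1 else 0) = s₁ at h1 ⊢
    have hz' := hW z (Finset.mem_insert_self z W)
    by_cases hMz : M z
    · convert h1.join_covered hy (hz'.1 hMz) using 1
      · rw [if_pos hMz, if_pos hMz, show t x + (t z + 0 + t₁) = (t x + t₁ + t z) + 0 by ring,
          show s x + (s z + 1 + s₁) = (s x + s₁ + s z) + 1 by ring, al_add, al_add, al_zero_one]
        ring
      · rw [if_pos hMz, if_pos hMz, show t x + (t z + 0 + t₁) = (t x + t₁ + t z) + 0 by ring,
          show s x + (s z + 1 + s₁) = (s x + s₁ + s z) + 1 by ring, sg_add, sg_add, al_add,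
          al_zero_one, sg_zero_one]
        ring
    · convert h1.join_exposed hy (hz'.2 hMz) using 1
      · rw [if_neg hMz, if_neg hMz, show t x + (t z + 1 + t₁) = (t x + t₁ + t z) + 1 by ring,
          show s x + (s z + 0 + s₁) = (s x + s₁ + s z) + 0 by ring, al_add, al_add, al_one_zero]
        ring
      · rw [if_neg hMz, if_neg hMz, show t x + (t z + 1 + t₁) = (t x + t₁ + t z) + 1 by ring,
          show s x + (s z + 0 + s₁) = (s x + s₁ + s z) + 0 by ring, sg_add, sg_add, al_add,
          al_one_zero, sg_one_zero]
        ring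

end Joins

/-! ### The greedy labelling. -/

namespace UnicyclicData

variable {V : Type*} {G : SimpleGraph V} {k : ℕ} (D : UnicyclicData G k) [Fintype V]

open Classical in
/-- The greedy labelling of the vertices: a vertex is marked if it has an unmarked child. -/
structure Labelling where
  /-- marked vertices -/
  M : V → Prop
  /-- number of pendent edges in the bound -/
  t : V → ℕ
  /-- number of pendent paths of length two in the bound -/
  s : V → ℕ
  hM : ∀ v, M v ↔ ∃ x ∈ D.ch v, ¬ M x
  hs : ∀ v, s v = ∑ x ∈ D.ch v, (s x + if M x then 1 else 0)
  ht : ∀ v, t v + (if M v then 1 else 0) = ∑ x ∈ D.ch v, (t x + if M x then 0 else 1)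

theorem exists_labelling : Nonempty D.Labelling := by
  classical
  obtain ⟨M, hM⟩ := D.exists_rec False (fun v M => ∃ x ∈ D.ch v, ¬ M x) (by
    intro v f g h
    rw [eq_iff_iff]
    exact exists_congr fun x => and_congr_right fun hx => by rw [h x hx])
  obtain ⟨s, hs⟩ := D.exists_rec 0 (fun v s => ∑ x ∈ D.ch v, (s x + if M x then 1 else 0)) (by
    intro v f g h
    exact Finset.sum_congr rfl fun x hx => by rw [h x hx])
  -- The truncated subtraction never truncates: a marked vertex has an unmarked child, which
  -- contributes at least 1 to the sum.
  obtain ⟨t, ht⟩ := D.exists_rec 0 (fun v t => ∑ x ∈ D.ch v, (t x + if M x then 0 else 1) -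
      if M v then 1 else 0) (by
    intro v f g h
    exact congrArg (· - _) (Finset.sum_congr rfl fun x hx => by rw [h x hx]))
  refine ⟨⟨M, t, s, fun v => (hM v).to_iff, hs, fun v => ?_⟩⟩
  rw [ht v]
  by_cases h : M v
  · rw [if_pos h]
    obtain ⟨x, hx, hMx⟩ := (hM v).to_iff.1 h
    have := Finset.single_le_sum (f := fun x => t x + if M x then 0 else 1)
      (fun _ _ => Nat.zero_le _) hx
    rw [if_neg hMx] at this
    omega
  · rw [if_neg h]; omega

theorem exists_isPair [DecidableEq V] : ∃ p q : V → ℤ[X], D.IsPair p q := by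
  obtain ⟨f, hf⟩ := D.exists_rec ((0 : ℤ[X]), (0 : ℤ[X])) (fun v f =>
    (rootP X (fun x => (f x).1) (fun x => (f x).2) (D.ch v),
      rootQ X (fun x => (f x).1) (fun x => (f x).2) (D.ch v))) (by
    intro v f g h
    have h1 : ∀ U : Finset V, U ⊆ D.ch v → ∏ x ∈ U, ((f x).1 + X * (f x).2) =
        ∏ x ∈ U, ((g x).1 + X * (g x).2) := fun U hU =>
      Finset.prod_congr rfl fun x hx => by rw [h x (hU hx)]
    have h2 : ∑ x ∈ D.ch v, (f x).1 * ∏ z ∈ (D.ch v).erase x, ((f z).1 + X * (f z).2) =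
        ∑ x ∈ D.ch v, (g x).1 * ∏ z ∈ (D.ch v).erase x, ((g z).1 + X * (g z).2) :=
      Finset.sum_congr rfl fun x hx => by rw [h x hx, h1 _ (Finset.erase_subset _ _)]
    simp only [rootP, rootQ]
    rw [h1 _ subset_rfl, h2])
  refine ⟨fun v => (f v).1, fun v => (f v).2, ⟨fun v => ?_, fun v => ?_⟩⟩
  · have := congrArg Prod.snd (hf v)
    exact this
  · have h1 := congrArg Prod.fst (hf v)
    have h2 := congrArg Prod.snd (hf v)
    simp only [rootP, rootQ] at h1 h2
    rw [h1, h2]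

variable {D}

theorem Labelling.treeBound [DecidableEq V] (L : D.Labelling) {p q : V → ℤ[X]} (h : D.IsPair p q)
    (v : V) : TreeBound X (p v) (q v) (L.M v) (L.t v) (L.s v) := by
  classical
  induction v using D.child_induction with
  | h v ih =>
    have hp : p v = rootP X p q (D.ch v) := by rw [h.hp, h.hq]; rfl
    have hq : q v = rootQ X p q (D.ch v) := h.hq v
    rw [hp, hq]
    refine ⟨fun hM => ?_, fun hM => ?_⟩
    · have ht := L.ht v
      rw [if_pos hM] at ht
      rw [L.hs]
      exact covered_root X_nonneg ih ((L.hM v).1 hM) ht.symm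
    · have hall : ∀ x ∈ D.ch v, L.M x := by
        intro x hx
        by_contra hx'
        exact hM ((L.hM v).2 ⟨x, hx, hx'⟩)
      have := exposed_root X_nonneg fun x hx => (ih x hx).1 (hall x hx)
      convert this using 2
      · have ht := L.ht v
        rw [if_neg hM, add_zero] at ht
        rw [ht]
        exact Finset.sum_congr rfl fun x hx => by rw [if_pos (hall x hx), add_zero]
      · rw [L.hs]
        exact Finset.sum_congr rfl fun x hx => by rw [if_pos (hall x hx)]
      · have ht := L.ht v
        rw [if_neg hM, add_zero] at ht
        rw [ht]
        exact Finset.sum_congr rfl fun x hx => by rw [if_pos (hall x hx), add_zero]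
      · rw [L.hs]
        exact Finset.sum_congr rfl fun x hx => by rw [if_pos (hall x hx)]

/-- An unmarked vertex with children. -/
theorem Labelling.covered_of_nonempty [DecidableEq V] (L : D.Labelling) {p q : V → ℤ[X]}
    (h : D.IsPair p q) {v : V} (hM : ¬ L.M v) (hv : (D.ch v).Nonempty) :
    ∃ s', L.s v = s' + 1 ∧
      Covered X (p v) (q v) (al X (L.t v + 1) s') (sg X (L.t v + 1) s') := by
  classical
  have hp : p v = rootP X p q (D.ch v) := by rw [h.hp, h.hq]; rfl
  have hq : q v = rootQ X p q (D.ch v) := h.hq v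
  have hall : ∀ x ∈ D.ch v, L.M x := by
    intro x hx
    by_contra hx'
    exact hM ((L.hM v).2 ⟨x, hx, hx'⟩)
  have ht := L.ht v
  rw [if_neg hM, add_zero, Finset.sum_congr rfl (fun x hx => by rw [if_pos (hall x hx), add_zero])]
    at ht
  have hs := L.hs v
  rw [Finset.sum_congr rfl (fun x hx => by rw [if_pos (hall x hx)])] at hs
  obtain ⟨x, hx⟩ := hv
  have := Finset.single_le_sum (f := fun x => L.s x + 1) (fun _ _ => Nat.zero_le _) hx
  obtain ⟨s', hs'⟩ : ∃ s', L.s v = s' + 1 := ⟨L.s v - 1, by omega⟩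
  refine ⟨s', hs', ?_⟩
  rw [hp, hq, ht]
  exact covered_of_exposed_root X_nonneg (fun x hx => (L.treeBound h x).1 (hall x hx)) ⟨x, hx⟩
    (hs.symm.trans hs')

/-- Summation over the trees. -/
theorem sum_c_eq {g w : V → ℕ} (h : ∀ v, g v = w v + ∑ x ∈ D.ch v, g x) :
    ∑ i, g (D.c i) = ∑ v, w v := by
  classical
  have h1 : ∑ v, ∑ x ∈ D.ch v, g x = ∑ x ∈ Finset.univ.filter (fun x => D.ht x ≠ 0), g x := by
    rw [← Finset.sum_fiberwise (Finset.univ.filter fun x => D.ht x ≠ 0) D.nxt g]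
    refine Finset.sum_congr rfl fun v _ => Finset.sum_congr ?_ fun _ _ => rfl
    ext x
    simp [D.mem_ch]
  have h2 : ∑ i, g (D.c i) = ∑ x ∈ Finset.univ.filter (fun x => ¬ D.ht x ≠ 0), g x := by
    refine (Finset.sum_image (f := g) (s := Finset.univ) (g := D.c)
      fun i _ j _ hij => D.c_inj hij).symm.trans (Finset.sum_congr ?_ fun _ _ => rfl)
    ext x
    simp [D.ht_eq_zero]
  have h3 := Finset.sum_filter_add_sum_filter_not Finset.univ (fun x => D.ht x ≠ 0) g
  have h4 : ∑ v, g v = ∑ v, w v + ∑ v, ∑ x ∈ D.ch v, g x := by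
    rw [← Finset.sum_add_distrib]
    exact Finset.sum_congr rfl fun v _ => h v
  omega

-- The summand counts the vertices of the tree at a cycle vertex: the root, the pendent edges, the
-- reserved edge of a marked root, and two for each path.
open Classical in
theorem Labelling.sum_size (L : D.Labelling) :
    ∑ i, (1 + L.t (D.c i) + (if L.M (D.c i) then 1 else 0) + 2 * L.s (D.c i)) =
      Fintype.card V := by
  rw [sum_c_eq (D := D) (g := fun v => 1 + L.t v + (if L.M v then 1 else 0) + 2 * L.s v)
    (w := fun _ => 1)]
  · simp
  · intro v
    have h1 := L.ht v
    have h2 := L.hs v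
    have h3 : ∑ x ∈ D.ch v, (1 + L.t x + (if L.M x then 1 else 0) + 2 * L.s x) =
        ∑ x ∈ D.ch v, (L.t x + if L.M x then 0 else 1) +
        2 * ∑ x ∈ D.ch v, (L.s x + if L.M x then 1 else 0) := by
      rw [Finset.mul_sum, ← Finset.sum_add_distrib]
      refine Finset.sum_congr rfl fun x _ => ?_
      split_ifs <;> ring
    omega

-- The tree at `v` has `s v` marked vertices below the root. Thus the broom that bounds a tree
-- remembers its number of greedy matching edges.
open Classical in
theorem Labelling.sum_marked (L : D.Labelling) :
    ∑ i, (L.s (D.c i) + if L.M (D.c i) then 1 else 0) =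
      (Finset.univ.filter L.M).card := by
  rw [sum_c_eq (D := D) (g := fun v => L.s v + if L.M v then 1 else 0)
    (w := fun v => if L.M v then 1 else 0)]
  · simp
  · intro v
    rw [L.hs v]
    ring

end UnicyclicData

end SignlessLaplacian

namespace SignlessLaplacian

open Polynomial Matrix

/-! ### Matchings -/

namespace UnicyclicData

variable {V : Type*} {G : SimpleGraph V} {k : ℕ} (D : UnicyclicData G k)

/-- A set of vertices whose edges to the next vertices form a matching. -/
def IsMatchingSet (A : Finset V) : Prop :=
  ∀ v ∈ A, D.nxt v ∉ A ∧ ∀ w ∈ A, D.nxt v = D.nxt w → v = w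

variable [Fintype V]

/-- Every edge is `s(v, nxt v)` for a unique `v`, so a matching is recorded by these `v`. -/
theorem exists_matchingSet_of_isMatching {M : G.Subgraph} (hM : M.IsMatching) :
    ∃ A : Finset V, D.IsMatchingSet A ∧ A.card = M.edgeSet.ncard := by
  classical
  refine ⟨Finset.univ.filter fun v => M.Adj v (D.nxt v), ?_, ?_⟩
  · intro v hv
    have hv := (Finset.mem_filter.1 hv).2
    refine ⟨fun h => ?_, fun w hw h => ?_⟩
    · have h := (Finset.mem_filter.1 h).2
      exact D.nxt_nxt_ne v (hM.eq_of_adj_left h hv.symm)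
    · have hw := (Finset.mem_filter.1 hw).2
      rw [← h] at hw
      exact hM.eq_of_adj_right hv hw
  · have : M.edgeSet = (fun v => s(v, D.nxt v)) '' (Finset.univ.filter fun v => M.Adj v (D.nxt v) :
        Finset V) := by
      ext e
      induction e with
      | _ x y =>
        simp only [SimpleGraph.Subgraph.mem_edgeSet, Set.mem_image, Finset.coe_filter,
          Finset.mem_univ, true_and, Set.mem_ofPred_eq]
        constructor
        · intro h
          rcases (D.adj_iff x y).1 h.adj_sub with rfl | rfl
          · exact ⟨x, h, rfl⟩
          · exact ⟨y, h.symm, Sym2.eq_swap⟩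
        · rintro ⟨v, hv, h⟩
          rcases Sym2.eq_iff.1 h with ⟨rfl, rfl⟩ | ⟨rfl, rfl⟩
          · exact hv
          · exact hv.symm
    rw [this, Set.ncard_image_of_injective _ D.nxt_injective, Set.ncard_coe_finset]

variable {D}

theorem IsMatchingSet.exists_isMatching {A : Finset V} (hA : D.IsMatchingSet A) :
    ∃ M : G.Subgraph, M.IsMatching ∧ M.edgeSet.ncard = A.card := by
  let M : G.Subgraph :=
    { verts := {v | v ∈ A ∨ ∃ w ∈ A, D.nxt w = v}
      Adj := fun x y => (x ∈ A ∧ D.nxt x = y) ∨ (y ∈ A ∧ D.nxt y = x)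
      adj_sub := fun {x y} h => (D.adj_iff x y).2 (h.imp And.right And.right)
      edge_vert := fun {x y} h => h.imp And.left fun h => ⟨y, h⟩
      symm := ⟨fun _ _ h => Or.symm h⟩ }
  refine ⟨M, ?_, ?_⟩
  · intro v hv
    rcases hv with hv | ⟨w, hw, rfl⟩
    · refine ⟨D.nxt v, Or.inl ⟨hv, rfl⟩, ?_⟩
      rintro y (⟨-, h⟩ | ⟨h, rfl⟩)
      · exact h.symm
      · exact absurd hv (hA y h).1
    · refine ⟨w, Or.inr ⟨hw, rfl⟩, ?_⟩
      rintro y (⟨h, -⟩ | ⟨h, h'⟩)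
      · exact absurd h (hA w hw).1
      · exact (hA y h).2 w hw h'
  · have : M.edgeSet = (fun v => s(v, D.nxt v)) '' (A : Set V) := by
      ext e
      induction e with
      | _ x y =>
        rw [SimpleGraph.Subgraph.mem_edgeSet]
        constructor
        · rintro (⟨h, rfl⟩ | ⟨h, rfl⟩)
          · exact ⟨x, h, rfl⟩
          · exact ⟨y, h, Sym2.eq_swap⟩
        · rintro ⟨v, hv, h⟩
          rcases Sym2.eq_iff.1 h with ⟨rfl, rfl⟩ | ⟨rfl, rfl⟩
          · exact Or.inl ⟨hv, rfl⟩
          · exact Or.inr ⟨hv, rfl⟩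
    rw [this, Set.ncard_image_of_injective _ D.nxt_injective, Set.ncard_coe_finset]

theorem isGreatest_matchingNumber : IsGreatest {j | ∃ A : Finset V, D.IsMatchingSet A ∧ A.card = j}
    (matchingNumber G) := by
  have h : {j | ∃ A : Finset V, D.IsMatchingSet A ∧ A.card = j} =
      {j : ℕ | ∃ M : G.Subgraph, M.IsMatching ∧ M.edgeSet.ncard = j} := by
    ext j
    constructor
    · rintro ⟨A, hA, rfl⟩
      exact hA.exists_isMatching
    · rintro ⟨M, hM, rfl⟩
      exact D.exists_matchingSet_of_isMatching hM
  have hb : BddAbove {j | ∃ A : Finset V, D.IsMatchingSet A ∧ A.card = j} := by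
    refine ⟨Fintype.card V, ?_⟩
    rintro _ ⟨A, -, rfl⟩
    exact Finset.card_le_univ A
  have hne : {j | ∃ A : Finset V, D.IsMatchingSet A ∧ A.card = j}.Nonempty :=
    ⟨0, ∅, by simp [IsMatchingSet], rfl⟩
  rw [matchingNumber, ← h]
  exact ⟨Nat.sSup_mem hne hb, fun j hj => le_csSup hb hj⟩

open Classical in
/-- Every edge which is not an edge of the cycle has a marked end. -/
theorem IsMatchingSet.card_le (L : D.Labelling) {A : Finset V} (hA : D.IsMatchingSet A) :
    A.card ≤ (Finset.univ.filter L.M).card +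
      ∑ i, if D.c i ∈ A ∧ ¬ L.M (D.c i) ∧ ¬ L.M (D.c (i + 1)) then 1 else 0 := by
  obtain ⟨E, hE⟩ : ∃ E, E = fun v => ¬ L.M v ∧ ¬ L.M (D.nxt v) := ⟨_, rfl⟩
  have h1 : (A.filter fun v => ¬ E v).card ≤ (Finset.univ.filter L.M).card := by
    -- Each matching edge is charged to a marked end; disjointness of the edges makes this
    -- injective.
    refine Finset.card_le_card_of_injOn (fun v => if L.M v then v else D.nxt v) ?_ ?_
    · intro v hv
      have hv := (Finset.mem_filter.1 hv).2
      rw [hE] at hv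
      by_cases hM : L.M v
      · simp [hM]
      · have : L.M (D.nxt v) := by tauto
        simp [hM, this]
    · intro v hv w hw h
      have hv := (Finset.mem_filter.1 hv).1
      have hw := (Finset.mem_filter.1 hw).1
      simp only at h
      split_ifs at h
      · exact h
      · exact absurd (h ▸ hv) (hA w hw).1
      · exact absurd (h ▸ hw) (hA v hv).1
      · exact (hA v hv).2 w hw h
  have h2 : (A.filter E).card ≤
      ∑ i, if D.c i ∈ A ∧ ¬ L.M (D.c i) ∧ ¬ L.M (D.c (i + 1)) then 1 else 0 := by
    rw [Finset.sum_boole, Nat.cast_id, ← Finset.card_image_of_injective _ D.c_inj]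
    refine Finset.card_le_card fun v hv => ?_
    obtain ⟨hvA, hvE⟩ := Finset.mem_filter.1 hv
    rw [hE] at hvE
    -- Off the cycle, an unmarked vertex marks its parent, so an edge with two unmarked ends lies on
    -- the cycle.
    have h0 : D.ht v = 0 := by
      by_contra h0
      exact hvE.2 ((L.hM _).2 ⟨v, D.mem_ch.2 ⟨h0, rfl⟩, hvE.1⟩)
    obtain ⟨i, rfl⟩ := (D.ht_eq_zero v).1 h0
    rw [D.nxt_c] at hvE
    exact Finset.mem_image.2 ⟨i, by simp [hvA, hvE], rfl⟩
  have h3 := Finset.card_filter_add_card_filter_not (s := A) E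
  omega

open Classical in
/-- If all cycle vertices are marked, then a matching as large as the set of marked vertices
avoids the cycle. -/
theorem IsMatchingSet.notMem_of_card_eq (L : D.Labelling) {A : Finset V} (hA : D.IsMatchingSet A)
    (hM : ∀ i, L.M (D.c i)) (hcard : A.card = (Finset.univ.filter L.M).card) (i : Fin (k + 3)) :
    D.c i ∉ A := by
  intro hi
  have hmark : ∀ v, ¬ L.M v → L.M (D.nxt v) := by
    intro v hv
    by_cases h0 : D.ht v = 0
    · obtain ⟨j, rfl⟩ := (D.ht_eq_zero v).1 h0
      exact absurd (hM j) hv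
    · exact (L.hM _).2 ⟨v, D.mem_ch.2 ⟨h0, rfl⟩, hv⟩
  have hinj : Set.InjOn (fun v => if L.M v then v else D.nxt v) A := by
    intro v hv w hw h
    have hv : v ∈ A := hv
    have hw : w ∈ A := hw
    simp only at h
    split_ifs at h
    · exact h
    · exact absurd (h ▸ hv) (hA w hw).1
    · exact absurd (h ▸ hw) (hA v hv).1
    · exact (hA v hv).2 w hw h
  -- A cycle edge in the matching has two marked ends and is charged to only one of them; the other,
  -- `D.c (i + 1)`, then receives no charge, and one marked vertex is wasted.
  have himg : A.image (fun v => if L.M v then v else D.nxt v) ⊆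
      (Finset.univ.filter L.M).erase (D.c (i + 1)) := by
    intro x hx
    obtain ⟨v, hv, rfl⟩ := Finset.mem_image.1 hx
    by_cases hMv : L.M v
    · simp only [hMv, if_true, Finset.mem_erase, Finset.mem_filter, Finset.mem_univ, and_self,
        and_true]
      rintro rfl
      exact (hA _ hi).1 (D.nxt_c i ▸ hv)
    · simp only [hMv, if_false, Finset.mem_erase, Finset.mem_filter, Finset.mem_univ, true_and,
        hmark v hMv, and_true]
      intro h
      have := (hA _ hi).2 v hv (by rw [D.nxt_c, h])
      exact hMv (this ▸ hM i)
  have h1 := Finset.card_le_card himg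
  rw [Finset.card_image_of_injOn hinj, Finset.card_erase_of_mem (by simp [hM]), hcard] at h1
  have : 0 < (Finset.univ.filter L.M).card := Finset.card_pos.2 ⟨D.c i, by simp [hM]⟩
  omega

/-- A matching contains less than half of the edges of an odd cycle. -/
theorem IsMatchingSet.card_cycle_le [DecidableEq V] {A : Finset V} (hA : D.IsMatchingSet A) :
    2 * (∑ i, if D.c i ∈ A then 1 else 0) ≤ k + 3 := by
  rw [Finset.sum_boole, Nat.cast_id, two_mul]
  have h1 : (Finset.univ.filter fun i => D.c i ∈ A).card =
      (Finset.univ.filter fun i => D.c (i - 1) ∈ A).card := by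
    refine Finset.card_bij (fun i _ => i + 1) ?_ ?_ ?_
    · intro i hi; simpa using hi
    · intro i _ j _ h; simpa using h
    · intro i hi
      exact ⟨i - 1, by simpa using hi, by simp⟩
  have h2 : Disjoint (Finset.univ.filter fun i => D.c i ∈ A)
      (Finset.univ.filter fun i => D.c (i - 1) ∈ A) := by
    refine Finset.disjoint_left.2 fun i hi hi' => ?_
    have hi := (Finset.mem_filter.1 hi).2
    have hi' := (Finset.mem_filter.1 hi').2
    have := (hA _ hi').1
    rw [D.nxt_c, sub_add_cancel] at this
    exact this hi
  have h3 := Finset.card_union_of_disjoint h2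
  have h4 := Finset.card_le_univ ((Finset.univ.filter fun i => D.c i ∈ A) ∪
      (Finset.univ.filter fun i => D.c (i - 1) ∈ A))
  rw [Fintype.card_fin] at h4
  omega

end UnicyclicData

end SignlessLaplacian

namespace SignlessLaplacian

open Polynomial Matrix

/-! ### Parsing the labelled cycle into a word. -/

section Items

variable {R : Type*}

/-- A cycle vertex with the pair of its tree, its label, the parameters of its bound, and a flag
telling whether the edge to the next cycle vertex is a matching edge with unmarked ends. -/
structure Item (R : Type*) where
  /-- the first entry of the pair -/
  p : R
  /-- the second entry of the pair -/
  q : R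
  /-- whether the vertex is marked -/
  marked : Bool
  /-- whether the next edge is a matching edge with unmarked ends -/
  flag : Bool
  /-- number of pendent edges -/
  t : ℕ
  /-- number of pendent paths of length two -/
  s : ℕ

/-- The pair of an item. -/
def Item.pair (I : Item R) : R × R := (I.p, I.q)

/-- The number of vertices of an item. -/
def Item.size (I : Item R) : ℕ := 1 + I.t + I.marked.toNat + 2 * I.s

/-- The possible flags of consecutive items. -/
def Item.Follows (I J : Item R) : Prop :=
  I.flag = true → I.marked = false ∧ J.marked = false ∧ J.flag = false

variable [CommRing R] [PartialOrder R] [IsOrderedRing R]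

/-- The item has a valid bound. -/
def Item.Valid (y : R) (I : Item R) : Prop := TreeBound y I.p I.q (I.marked = true) I.t I.s

variable [Nontrivial R]

theorem Item.Valid.exposed {y : R} (hy : 0 ≤ y) {I : Item R} (h : I.Valid y) :
    Exposed y I.p I.q (al y (I.t + I.marked.toNat) I.s) (sg y (I.t + I.marked.toNat) I.s) := by
  cases hM : I.marked with
  | false => simpa using h.2 (by simp [hM])
  | true =>
    convert (h.1 hM).exposed hy using 1
    · rw [show Bool.toNat true = 1 from rfl, ← add_zero I.s, al_add, al_one_zero, add_zero]
      ring
    · rw [show Bool.toNat true = 1 from rfl, ← add_zero I.s, sg_add, al_one_zero, sg_one_zero,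
        add_zero]
      ring

theorem WordBound.single' {y p q : R} {t s T S : ℕ} (h : Covered y p q (al y t s) (sg y t s))
    {w : List (Letter R)} (hw : WordBound y w (al y T S) (sg y T S)) :
    WordBound y (.single p q :: w) (al y (t + T) (s + S)) (sg y (t + T) (s + S)) := by
  rw [al_add, sg_add]
  exact .single h hw

theorem WordBound.pair' {y p q p' q' : R} {t s t' s' T S : ℕ}
    (h : Exposed y p q (al y t s) (sg y t s)) (h' : Exposed y p' q' (al y t' s') (sg y t' s'))
    {w : List (Letter R)} (hw : WordBound y w (al y T S) (sg y T S)) :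
    WordBound y (.pair p q p' q' :: w) (al y (t + t' + T) (s + s' + S))
      (sg y (t + t' + T) (s + s' + S)) := by
  rw [al_add, al_add, sg_add, sg_add, al_add]
  exact .pair h h' hw

omit [IsOrderedRing R] [Nontrivial R] in
theorem WordBound.nil' {y : R} : WordBound y ([] : List (Letter R)) (al y 0 0) (sg y 0 0) := by
  rw [al_zero, sg_zero]
  exact .nil

omit [CommRing R] [PartialOrder R] [IsOrderedRing R] [Nontrivial R] in
theorem wordVerts_cons [CommRing R] (a : Letter R) (w : List (Letter R)) :
    wordVerts (a :: w) = a.verts ++ wordVerts w := rfl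

/-- Greedy parsing of a list of items into letters, with at most one unmarked item left. -/
theorem exists_parse {y : R} (hy : 0 ≤ y) : ∀ (l : List (Item R)), (∀ I ∈ l, I.Valid y) →
    l.IsChain Item.Follows → (∀ I ∈ l.getLast?, I.flag = false) →
    ∃ (w : List (Letter R)) (T S : ℕ) (r : List (Item R)), WordBound y w (al y T S) (sg y T S) ∧
      l.map Item.pair = wordVerts w ++ r.map Item.pair ∧
      (r = [] ∨ ∃ e, e.Valid y ∧ e.marked = false ∧ r = [e]) ∧
      (l.map Item.size).sum = 2 * w.length + T + 2 * S + (r.map Item.size).sum ∧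
      (l.map Item.s).sum = S + (r.map Item.s).sum ∧
      (l.map fun I => I.marked.toNat + I.flag.toNat).sum ≤ w.length ∧
      w.length + r.length ≤ l.length ∧ (r = [] → (∃ I ∈ l, I.marked = false) → w.length < l.length)
  | [], _, _, _ => ⟨[], 0, 0, [], .nil', rfl, Or.inl rfl, by simp, by simp, by simp, by simp, by simp⟩
  | [I], hv, _, hl => by
    have hI := hv I (by simp)
    have hf : I.flag = false := hl I (by simp)
    cases hM : I.marked with
    | true =>
      refine ⟨[.single I.p I.q], I.t + 0, I.s + 0, [], .single' (hI.1 hM) .nil', rfl, Or.inl rfl,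
        ?_, ?_, ?_, ?_, ?_⟩ <;> simp [Item.size, hM, hf]
      ring
    | false =>
      refine ⟨[], 0, 0, [I], .nil', rfl, Or.inr ⟨I, hI, hM, rfl⟩, ?_, ?_, ?_, ?_, ?_⟩ <;>
        simp [hM, hf]
  | I :: J :: l, hv, hc, hl => by
    have hI := hv I (by simp)
    have hJ := hv J (by simp)
    obtain ⟨hIJ, hc'⟩ := List.isChain_cons_cons.1 hc
    have hl' : ∀ I ∈ (J :: l).getLast?, I.flag = false := fun K hK => hl K (by simpa using hK)
    cases hM : I.marked with
    | true =>
      obtain ⟨w, T, S, r, hw, hp, hr, h1, h2, h3, h4, h5⟩ := exists_parse hy (J :: l)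
        (fun K hK => hv K (List.mem_cons_of_mem _ hK)) hc' hl'
      have hf : I.flag = false := by
        by_contra hf
        have := (hIJ (by simpa using hf)).1
        rw [hM] at this
        exact absurd this (by simp)
      refine ⟨.single I.p I.q :: w, I.t + T, I.s + S, r, .single' (hI.1 hM) hw, ?_, hr, ?_, ?_, ?_,
        ?_, ?_⟩
      · rw [List.map_cons, hp]; rfl
      · rw [List.map_cons, List.sum_cons, h1, Item.size, hM, List.length_cons]
        simp; ring
      · rw [List.map_cons, List.sum_cons, h2]; ring
      · rw [List.map_cons, List.sum_cons, hM, hf, List.length_cons]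
        simp at h3 ⊢; omega
      · simp at h4 ⊢; omega
      · rintro hr ⟨K, hK, hKM⟩
        rcases List.mem_cons.1 hK with rfl | hK
        · rw [hM] at hKM; exact absurd hKM (by simp)
        · have := h5 hr ⟨K, hK, hKM⟩
          simp at this ⊢; omega
    | false =>
      have hlt : ∀ K ∈ l.getLast?, K.flag = false := by
        intro K hK
        refine hl K ?_
        cases l with
        | nil => simp at hK
        | cons a l => simpa using hK
      obtain ⟨w, T, S, r, hw, hp, hr, h1, h2, h3, h4, h5⟩ := exists_parse hy l
        (fun K hK => hv K (List.mem_cons_of_mem _ (List.mem_cons_of_mem _ hK))) hc'.tail hlt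
      have e1 : Exposed y I.p I.q (al y I.t I.s) (sg y I.t I.s) := hI.2 (by simp [hM])
      -- A pair letter has to account for at most one among the matching edge `I J`, the mark of
      -- `J`, and the matching edge leaving `J`.
      have hcnt : I.flag.toNat + (J.marked.toNat + J.flag.toNat) ≤ 1 := by
        have hJf : J.flag = true → J.marked = false := by
          intro hf
          cases l with
          | nil =>
            have := hl J (by simp)
            rw [hf] at this
            exact absurd this (by simp)
          | cons a l => exact ((List.isChain_cons_cons.1 hc').1 hf).1
        cases hIf : I.flag with
        | true =>
          obtain ⟨-, h1, h2⟩ := hIJ hIf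
          simp [h1, h2]
        | false =>
          cases hJf' : J.flag with
          | true => simp [hJf hJf']
          | false => simpa using Bool.toNat_le J.marked
      refine ⟨.pair I.p I.q J.p J.q :: w, I.t + (J.t + J.marked.toNat) + T, I.s + J.s + S, r,
        .pair' e1 (hJ.exposed hy) hw, ?_, hr, ?_, ?_, ?_, ?_, ?_⟩
      · rw [List.map_cons, List.map_cons, hp]; rfl
      · rw [List.map_cons, List.sum_cons, List.map_cons, List.sum_cons, h1, Item.size, Item.size, hM,
          List.length_cons]
        simp; ring
      · rw [List.map_cons, List.sum_cons, List.map_cons, List.sum_cons, h2]; ring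
      · rw [List.map_cons, List.sum_cons, List.map_cons, List.sum_cons, hM, List.length_cons]
        simp at h3 ⊢; omega
      · simp at h4 ⊢; omega
      · intro _ _
        simp at h4 ⊢; omega

/-- A cyclic list of items starting with a marked one. -/
theorem exists_word {y : R} (hy : 0 ≤ y) (I : Item R) (l : List (Item R)) (hI : I.Valid y)
    (hM : I.marked = true) (hf : I.flag = false) (hv : ∀ I ∈ l, I.Valid y)
    (hc : l.IsChain Item.Follows) (hl : ∀ I ∈ l.getLast?, I.flag = false) :
    ∃ (w : List (Letter R)) (T S : ℕ), WordBound y w (al y T S) (sg y T S) ∧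
      cyclicVal y ((I :: l).map Item.pair) = wordVal y w ∧ (wordVerts w).length = l.length + 1 ∧
      ((I :: l).map Item.size).sum = 2 * w.length + T + 2 * S ∧
      ((I :: l).map fun I => I.s + (I.marked.toNat + I.flag.toNat)).sum ≤ S + w.length ∧
      ((I :: l).map Item.s).sum = S ∧
      ((∃ J ∈ l, J.marked = false) → w.length < l.length + 1) := by
  obtain ⟨w, T, S, r, hw, hp, hr, h1, h2, h3, h4, h5⟩ := exists_parse hy l hv hc hl
  have hadd : ∀ l : List (Item R), (l.map fun I => I.s + (I.marked.toNat + I.flag.toNat)).sum =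
      (l.map Item.s).sum + (l.map fun I => I.marked.toNat + I.flag.toNat).sum := fun l =>
    List.sum_map_add
  have hlen := congrArg List.length hp
  rw [List.length_map, List.length_append, List.length_map] at hlen
  rcases hr with rfl | ⟨e, he, heM, rfl⟩
  · simp only [List.map_nil, List.append_nil, List.sum_nil, add_zero, List.length_nil] at hp h1 h2 h4 hlen
    refine ⟨.single I.p I.q :: w, I.t + T, I.s + S, .single' (hI.1 hM) hw, ?_, ?_, ?_, ?_, ?_, ?_⟩
    · rw [← cyclicVal_wordVerts, wordVerts_cons, ← hp]; rfl
    · rw [wordVerts_cons, List.length_append, ← hlen]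
      simp [Letter.verts]; ring
    · rw [List.map_cons, List.sum_cons, h1, Item.size, hM, List.length_cons]
      simp; ring
    · rw [List.map_cons, List.sum_cons, hadd, hM, hf, h2, List.length_cons]
      simp only [Bool.toNat_true, Bool.toNat_false]; omega
    · rw [List.map_cons, List.sum_cons, h2]
    · intro hJ
      have := h5 rfl hJ
      rw [List.length_cons]; omega
  · simp only [List.map_cons, List.map_nil, List.sum_cons, List.sum_nil, add_zero, List.length_cons,
      List.length_nil] at hp h1 h2 h4 hlen
    have e1 : Exposed y e.p e.q (al y e.t e.s) (sg y e.t e.s) := he.2 (by simp [heM])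
    -- An unmarked vertex left over at the end is paired cyclically with the first vertex, which
    -- then gives up its status as covered; its reserved edge is counted as an ordinary one.
    refine ⟨.pair e.p e.q I.p I.q :: w, e.t + (I.t + I.marked.toNat) + T, e.s + I.s + S,
      .pair' e1 (hI.exposed hy) hw, ?_, ?_, ?_, ?_, ?_, ?_⟩
    · have h6 := cyclicVal_append_comm y (I.pair :: wordVerts w) [e.pair]
      rw [List.map_cons, hp, ← cyclicVal_wordVerts, wordVerts_cons]
      exact h6
    · rw [wordVerts_cons, List.length_append]
      simp [Letter.verts]; omega
    · rw [List.map_cons, List.sum_cons, h1, Item.size, Item.size, hM, heM, List.length_cons]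
      simp; ring
    · rw [List.map_cons, List.sum_cons, hadd, hM, hf, h2, List.length_cons]
      simp only [Bool.toNat_true, Bool.toNat_false]; omega
    · rw [List.map_cons, List.sum_cons, h2]; ring
    · intro _
      rw [List.length_cons]; omega

theorem oneTree_mono_iterate {y : R} (hy : 0 ≤ y) (t s d : ℕ) :
    oneTree y (al y (t + 2 * d) s) (sg y (t + 2 * d) s) ≤
      oneTree y (al y t (s + d)) (sg y t (s + d)) := by
  induction d generalizing s with
  | zero => exact le_rfl
  | succ d ih =>
    have h1 := oneTree_mono hy (t + 2 * d) s
    have h2 := ih (s + 1)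
    rw [show t + 2 * (d + 1) = t + 2 * d + 2 by ring, show s + (d + 1) = s + 1 + d by ring]
    exact h1.trans h2

/-- A word with `S + w.length = m + d` has the target of matching number `m + d`; each of the `d`
excess paths is traded for two pendent edges, which lowers the target. -/
theorem WordBound.target_le {y : R} (hy : 0 ≤ y) {w : List (Letter R)} {T S n m : ℕ}
    (hw : WordBound y w (al y T S) (sg y T S)) (hk : 2 ≤ w.length)
    (hodd : Odd (wordVerts w).length) (h3 : (wordVerts w).length = 3 → w.length = 2)
    (hn : n = 2 * w.length + T + 2 * S) (hm : m ≤ S + w.length) (hm2 : 2 ≤ m) :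
    oneTree y (al y (n - 2 * m + 1) (m - 2)) (sg y (n - 2 * m + 1) (m - 2)) ≤ wordVal y w := by
  refine le_trans ?_ (hw.oneTree_le hy hk hodd h3)
  rw [← al_add, ← sg_add]
  obtain ⟨d, hd⟩ : ∃ d, S + w.length = m + d := ⟨S + w.length - m, by omega⟩
  rw [show n - 2 * m + 1 = T + 1 + 2 * d by omega,
    show S + (w.length - 2) = m - 2 + d by omega]
  exact oneTree_mono_iterate hy _ _ _

end Items

end SignlessLaplacian

namespace SignlessLaplacian

open Polynomial Matrix

/-! ### The lower bound, according to the labels on the cycle. -/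

namespace UnicyclicData

variable {V : Type*} {G : SimpleGraph V} {k : ℕ}

/-- Renumbering of the cycle. -/
def rotate (D : UnicyclicData G k) (j : Fin (k + 3)) : UnicyclicData G k where
  c i := D.c (i + j)
  nxt := D.nxt
  ht := D.ht
  c_inj _ _ h := add_right_cancel (D.c_inj h)
  nxt_c i := by rw [D.nxt_c, add_right_comm]
  ht_eq_zero v := by
    rw [D.ht_eq_zero]
    exact ⟨fun ⟨i, h⟩ => ⟨i - j, by rw [sub_add_cancel, h]⟩, fun ⟨i, h⟩ => ⟨i + j, h⟩⟩
  ht_nxt := D.ht_nxt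
  adj_iff := D.adj_iff

variable [Fintype V]

/-- The labelling after renumbering the cycle. -/
def Labelling.rotate {D : UnicyclicData G k} (L : D.Labelling) (j : Fin (k + 3)) :
    (D.rotate j).Labelling :=
  ⟨L.M, L.t, L.s, L.hM, L.hs, L.ht⟩

variable {D : UnicyclicData G k} [DecidableEq V]

theorem IsPair.rotate {p q : V → ℤ[X]} (h : D.IsPair p q) (j : Fin (k + 3)) :
    (D.rotate j).IsPair p q := ⟨h.hq, h.hp⟩

theorem sum_ofFn_items (f : Fin (k + 3) → Item ℤ[X]) (g : Item ℤ[X] → ℕ) :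
    ((List.ofFn f).map g).sum = ∑ i, g (f i) := by
  rw [List.map_ofFn, List.sum_ofFn]
  rfl

theorem exists_word_of_items (hk : Even k) {p q : V → ℤ[X]} (h : D.IsPair p q)
    (f : Fin (k + 3) → Item ℤ[X]) (hpair : ∀ i, (f i).pair = (p (D.c i), q (D.c i)))
    (hval : ∀ i, (f i).Valid X) (hM : (f 0).marked = true)
    (hchain : ∀ i, (f i).Follows (f (i + 1)))
    (hsize : ∑ i, (f i).size = Fintype.card V) :
    ∃ (w : List (Letter ℤ[X])) (T S : ℕ), WordBound X w (al X T S) (sg X T S) ∧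
      phiPoly G = wordVal X w ∧ (wordVerts w).length = k + 3 ∧
      Fintype.card V = 2 * w.length + T + 2 * S ∧
      ∑ i, ((f i).s + ((f i).marked.toNat + (f i).flag.toNat)) ≤ S + w.length ∧
      ∑ i, (f i).s = S ∧ ((∃ i, (f i).marked = false) → w.length < k + 3) ∧
      k + 3 ≤ 2 * w.length := by
  have hchain' : (List.ofFn f).IsChain Item.Follows := by
    rw [List.isChain_ofFn]
    intro i hi
    have e : (⟨i, by omega⟩ + 1 : Fin (k + 3)) = ⟨i + 1, hi⟩ :=
      ((fin_eq_add_one_iff (⟨i, by omega⟩ : Fin (k + 3)) ⟨i + 1, hi⟩).2 (Or.inl rfl)).symm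
    rw [← e]
    exact hchain _
  have hlast : (f (Fin.last (k + 2))).flag = false := by
    by_contra hf
    have := (hchain (Fin.last (k + 2)) (by simpa using hf)).2.1
    rw [Fin.last_add_one, hM] at this
    exact absurd this (by simp)
  have hf0 : (f 0).flag = false := by
    by_contra hf
    have := (hchain 0 (by simpa using hf)).1
    rw [hM] at this
    exact absurd this (by simp)
  have hcons : List.ofFn f = f 0 :: List.ofFn fun i => f i.succ := List.ofFn_succ
  rw [hcons] at hchain'
  obtain ⟨w, T, S, hw, hval', hlen, hsize', hcnt, hS, hlt⟩ := exists_word (X_nonneg) (f 0)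
    (List.ofFn fun i => f i.succ) (hval 0) hM hf0
    (by
      intro I hI
      obtain ⟨i, rfl⟩ := (List.mem_ofFn' _ _).1 hI
      exact hval _) hchain'.tail
    (by
      intro I hI
      have : (List.ofFn fun i => f i.succ).getLast? = some (f (Fin.last (k + 2))) := by
        rw [List.getLast?_eq_getElem?, List.length_ofFn, List.getElem?_eq_getElem (by simp),
          List.getElem_ofFn]
        rfl
      rw [this] at hI
      obtain rfl := Option.mem_some_iff.1 hI
      exact hlast)
  rw [← hcons] at hval' hsize' hcnt hS
  rw [sum_ofFn_items] at hsize' hcnt hS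
  rw [List.length_ofFn] at hlen hlt
  refine ⟨w, T, S, hw, ?_, hlen, hsize.symm.trans hsize', hcnt, hS, ?_, ?_⟩
  · rw [h.phiPoly_eq hk, ← hval', List.map_ofFn]
    congr 2
    funext i
    exact (hpair i).symm
  · rintro ⟨i, hi⟩
    have hi0 : i ≠ 0 := by
      rintro rfl
      rw [hM] at hi
      exact absurd hi (by simp)
    obtain ⟨j, rfl⟩ := Fin.exists_succ_eq.2 hi0
    exact hlt ⟨f j.succ, (List.mem_ofFn' _ _).2 ⟨j, rfl⟩, hi⟩
  · rw [← show (wordVerts w).length = k + 3 from hlen]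
    clear hval' hlen hsize hsize' hcnt hlt hw hS
    induction w with
    | nil => simp [wordVerts]
    | cons a w ih =>
      rw [wordVerts_cons, List.length_append, List.length_cons]
      have : a.verts.length ≤ 2 := by cases a <;> simp [Letter.verts]
      omega

/-- The lower bound, if the first cycle vertex is marked and some cycle vertex is unmarked. -/
theorem target_le_of_marked (hk : Even k) (L : D.Labelling) {p q : V → ℤ[X]} (h : D.IsPair p q)
    {A : Finset V} (hA : D.IsMatchingSet A) (hA2 : 2 ≤ A.card) (hM : L.M (D.c 0))
    (hk' : k = 0 → ∃ i, ¬ L.M (D.c i)) :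
    oneTree X (al X (Fintype.card V - 2 * A.card + 1) (A.card - 2))
      (sg X (Fintype.card V - 2 * A.card + 1) (A.card - 2)) ≤ phiPoly G := by
  classical
  obtain ⟨f, hf⟩ : ∃ f : Fin (k + 3) → Item ℤ[X], f = fun i => ⟨p (D.c i), q (D.c i),
    decide (L.M (D.c i)), decide (D.c i ∈ A ∧ ¬ L.M (D.c i) ∧ ¬ L.M (D.c (i + 1))), L.t (D.c i),
    L.s (D.c i)⟩ := ⟨_, rfl⟩
  obtain ⟨w, T, S, hw, hphi, hlen, hn, hcnt, -, hlt, hle⟩ := exists_word_of_items hk h f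
    (fun i => by rw [hf]; rfl)
    (fun i => by simpa [Item.Valid, hf] using L.treeBound h (D.c i))
    (by simp [hf, hM])
    (by
      intro i hfl
      have hfl' : D.c i ∈ A ∧ ¬ L.M (D.c i) ∧ ¬ L.M (D.c (i + 1)) := by simpa [hf] using hfl
      obtain ⟨h1, h2, h3⟩ := hfl'
      have h4 := (hA _ h1).1
      rw [D.nxt_c] at h4
      simp [hf, h2, h3, h4])
    (by
      rw [← L.sum_size]
      refine Finset.sum_congr rfl fun i _ => ?_
      by_cases hMi : L.M (D.c i) <;> simp [Item.size, hf, hMi])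
  -- The matching is at most the marked vertices plus the flagged cycle edges, and the parse
  -- provides a letter for every mark or flag on the cycle.
  have hm : A.card ≤ S + w.length := by
    refine (hA.card_le L).trans ((le_of_eq ?_).trans hcnt)
    rw [← L.sum_marked, ← Finset.sum_add_distrib]
    refine Finset.sum_congr rfl fun i _ => ?_
    by_cases hMi : L.M (D.c i) <;>
    by_cases hMj : D.c i ∈ A ∧ ¬ L.M (D.c (i + 1)) <;> (simp [hf, hMi, hMj]; try tauto)
  rw [hphi]
  refine hw.target_le X_nonneg (by omega) ?_ ?_ hn hm hA2
  · rw [hlen]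
    exact (hk.add_odd (by decide : Odd 3))
  · intro h3
    obtain ⟨i, hi⟩ := hk' (by omega)
    have := hlt ⟨i, by simp [hf, hi]⟩
    omega

/-- The lower bound, if no cycle vertex is marked, but the first one has a child. -/
theorem target_le_of_unmarked (hk : Even k) (L : D.Labelling) {p q : V → ℤ[X]} (h : D.IsPair p q)
    {A : Finset V} (hA : D.IsMatchingSet A) (hA2 : 2 ≤ A.card) (hM : ∀ i, ¬ L.M (D.c i))
    (hch : (D.ch (D.c 0)).Nonempty) :
    oneTree X (al X (Fintype.card V - 2 * A.card + 1) (A.card - 2))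
      (sg X (Fintype.card V - 2 * A.card + 1) (A.card - 2)) ≤ phiPoly G := by
  classical
  obtain ⟨s₀, hs₀, hcov⟩ := L.covered_of_nonempty h (hM 0) hch
  -- The first vertex is treated as marked: by `covered_of_nonempty` one of its paths becomes a
  -- counted pendent edge and a reserved one.
  obtain ⟨f, hf⟩ : ∃ f : Fin (k + 3) → Item ℤ[X], f = fun i => ⟨p (D.c i), q (D.c i),
    decide (i = 0), false, L.t (D.c i) + if i = 0 then 1 else 0,
    L.s (D.c i) - if i = 0 then 1 else 0⟩ := ⟨_, rfl⟩
  obtain ⟨w, T, S, hw, hphi, hlen, hn, -, hS, hlt, hle⟩ := exists_word_of_items hk h f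
    (fun i => by rw [hf]; rfl)
    (fun i => by
      by_cases hi : i = 0
      · subst hi
        refine ⟨fun _ => ?_, fun hc => absurd (by simp [hf]) hc⟩
        simpa [hf, hs₀] using hcov
      · refine ⟨fun hc => absurd hc (by simp [hf, hi]), fun _ => ?_⟩
        simpa [hf, hi] using (L.treeBound h (D.c i)).2 (hM i))
    (by simp [hf])
    (fun i hfl => absurd hfl (by simp [hf]))
    (by
      rw [← L.sum_size]
      refine Finset.sum_congr rfl fun i _ => ?_
      by_cases hi : i = 0
      · subst hi
        simp [Item.size, hf, hM, hs₀]
        ring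
      · simp [Item.size, hf, hM, hi])
  have hS' : ∑ i, (L.s (D.c i) + if L.M (D.c i) then 1 else 0) = S + 1 := by
    have h1 : ∑ i : Fin (k + 3), (if i = 0 then 1 else 0) = 1 := by simp
    rw [← hS, ← h1, ← Finset.sum_add_distrib]
    refine Finset.sum_congr rfl fun i _ => ?_
    by_cases hi : i = 0
    · subst hi
      simp [hf, hs₀, hM]
    · simp [hf, hM, hi]
  -- The path that was given up is recovered from parity: an odd cycle of length `k + 3` has at most
  -- `(k + 2) / 2` matching edges but needs at least `(k + 4) / 2` letters.
  have hm : A.card ≤ S + w.length := by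
    have h1 := hA.card_le L
    have h2 := hA.card_cycle_le
    rw [← L.sum_marked, hS'] at h1
    simp only [hM, not_false_eq_true, and_true] at h1
    rw [Nat.even_iff] at hk
    omega
  rw [hphi]
  refine hw.target_le X_nonneg (by omega) ?_ ?_ hn hm hA2
  · rw [hlen]
    exact (hk.add_odd (by decide : Odd 3))
  · intro h3
    have := hlt ⟨1, by simp [hf]⟩
    omega

/-- The lower bound for an odd cycle. -/
theorem target_le_of_cycle (hk : Even k) {p q : V → ℤ[X]} (h : D.IsPair p q)
    {A : Finset V} (hA : D.IsMatchingSet A) (hA2 : 2 ≤ A.card) (hch : ∀ i, D.ch (D.c i) = ∅) :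
    oneTree X (al X (Fintype.card V - 2 * A.card + 1) (A.card - 2))
      (sg X (Fintype.card V - 2 * A.card + 1) (A.card - 2)) ≤ phiPoly G := by
  classical
  have hc : ∀ v, ∃ i, D.c i = v := by
    intro v
    rw [← D.ht_eq_zero]
    induction hv : D.ht v using Nat.strong_induction_on generalizing v with
    | _ n ih =>
      by_contra h0
      have h1 := D.ht_nxt v (by omega)
      have h2 := ih (D.ht (D.nxt v)) (by omega) (D.nxt v) rfl
      obtain ⟨i, hi⟩ := (D.ht_eq_zero _).1 h2
      have : v ∈ D.ch (D.c i) := D.mem_ch.2 ⟨by omega, hi.symm⟩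
      rw [hch] at this
      exact absurd this (by simp)
  have hcard : Fintype.card V = k + 3 := by
    rw [← Fintype.card_fin (k + 3)]
    exact (Fintype.card_of_bijective ⟨D.c_inj, hc⟩).symm
  have hA' : 2 * A.card ≤ k + 3 := by
    refine le_trans (Nat.mul_le_mul_left 2 ?_) hA.card_cycle_le
    rw [Finset.sum_boole, Nat.cast_id, ← Finset.card_image_of_injective _ D.c_inj]
    refine Finset.card_le_card fun v hv => ?_
    obtain ⟨i, rfl⟩ := hc v
    exact Finset.mem_image_of_mem _ (by simpa using hv)
  -- Two matching edges do not fit on a triangle, so the cycle has at least five vertices.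
  obtain ⟨j, hj⟩ : ∃ j, k = 2 * j + 2 := by
    obtain ⟨r, hr⟩ := hk
    exact ⟨r - 1, by omega⟩
  have hq : ∀ i, q (D.c i) = 1 := fun i => by rw [h.hq, hch]; simp
  have hp : ∀ i, p (D.c i) = 1 := fun i => by rw [h.hp, hch, hq]; simp
  rw [h.phiPoly_eq hk]
  simp only [hp, hq]
  rw [List.ofFn_const, hcard]
  obtain ⟨d, hd⟩ : ∃ d, j + 2 = A.card + d := ⟨j + 2 - A.card, by omega⟩
  have h1 := cyclicVal_bare_ge (X_nonneg) j
  rw [show 2 * j + 5 = k + 3 by omega] at h1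
  refine le_trans ?_ h1
  rw [show k + 3 - 2 * A.card + 1 = 2 + 2 * d by omega, show j = A.card - 2 + d by omega]
  exact oneTree_mono_iterate X_nonneg _ _ _

/-- The lower bound for a triangle with marked vertices. -/
theorem target_le_of_triangle {D : UnicyclicData G 0} (L : D.Labelling) {p q : V → ℤ[X]}
    (h : D.IsPair p q) {A : Finset V} (hA : D.IsMatchingSet A) (hA2 : 2 ≤ A.card)
    (hM : ∀ i, L.M (D.c i)) :
    oneTree X (al X (Fintype.card V - 2 * A.card + 1) (A.card - 2))
      (sg X (Fintype.card V - 2 * A.card + 1) (A.card - 2)) ≤ phiPoly G ∨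
    (3 ≤ A.card ∧ threeTrees X (al X (Fintype.card V - 2 * A.card + 1) (A.card - 3))
      (sg X (Fintype.card V - 2 * A.card + 1) (A.card - 3)) ≤ phiPoly G ∧ ∀ i, D.c i ∉ A) := by
  classical
  have h1 := hA.card_le L
  simp only [hM, not_true, and_false, if_false, Finset.sum_const_zero, add_zero] at h1
  have hs := L.sum_marked
  have hsize := L.sum_size
  have hphi := h.phiPoly_eq (by decide : Even 0)
  have hb : ∀ i, Covered X (p (D.c i)) (q (D.c i)) (al X (L.t (D.c i)) (L.s (D.c i)))
      (sg X (L.t (D.c i)) (L.s (D.c i))) := fun i => (L.treeBound h (D.c i)).1 (hM i)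
  have hverts : (List.ofFn fun i => (p (D.c i), q (D.c i))) =
      [(p (D.c 0), q (D.c 0)), (p (D.c 1), q (D.c 1)), (p (D.c 2), q (D.c 2))] := by
    simp [List.ofFn_succ]
  rw [hverts] at hphi
  simp only [hM, if_true] at hs hsize
  rw [Fin.sum_univ_three] at hs hsize
  have b0 := hb 0
  have b1 := hb 1
  have b2 := hb 2
  generalize L.t (D.c 0) = t₀ at *
  generalize L.t (D.c 1) = t₁ at *
  generalize L.t (D.c 2) = t₂ at *
  generalize L.s (D.c 0) = s₀ at *
  generalize L.s (D.c 1) = s₁ at *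
  generalize L.s (D.c 2) = s₂ at *
  -- If the matching is smaller than the number of marked vertices, one unit may be wasted: two
  -- covered vertices are merged into a pair, and the word has two letters only.
  by_cases hm : A.card = (Finset.univ.filter L.M).card
  · right
    refine ⟨by omega, ?_, hA.notMem_of_card_eq L hM hm⟩
    have hval : phiPoly G = wordVal X [.single (p (D.c 0)) (q (D.c 0)),
        .single (p (D.c 1)) (q (D.c 1)), .single (p (D.c 2)) (q (D.c 2))] := by
      rw [hphi, ← cyclicVal_wordVerts]; rfl
    rw [hval]
    refine le_trans (le_of_eq ?_) (wordVal_three_singles_ge X_nonneg b0 b1 b2)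
    rw [show Fintype.card V - 2 * A.card + 1 = 1 + (t₀ + (t₁ + t₂)) by omega,
      show A.card - 3 = 0 + (s₀ + (s₁ + s₂)) by omega]
    simp only [al_add, sg_add, al_one_zero, sg_one_zero]
  · left
    have hval : phiPoly G = wordVal X [.single (p (D.c 0)) (q (D.c 0)),
        .pair (p (D.c 1)) (q (D.c 1)) (p (D.c 2)) (q (D.c 2))] := by
      rw [hphi, ← cyclicVal_wordVerts]; rfl
    have hexp : ∀ {p q : ℤ[X]} {t s : ℕ}, Covered X p q (al X t s) (sg X t s) →
        Exposed X p q (al X (t + 1) s) (sg X (t + 1) s) := by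
      intro p q t s hc
      exact Item.Valid.exposed X_nonneg (I := ⟨p, q, true, false, t, s⟩)
        ⟨fun _ => hc, fun hc => absurd rfl hc⟩
    have hw := WordBound.single' b0 (WordBound.pair' (hexp b1) (hexp b2) WordBound.nil')
    rw [hval]
    refine hw.target_le X_nonneg (by simp) (by simp [wordVerts, Letter.verts]; decide)
      (fun _ => rfl) ?_ ?_ hA2
    · simp; omega
    · simp; omega

/-- The main inequality. -/
theorem main_bound (D : UnicyclicData G k) (hk : Even k) {A : Finset V} (hA : D.IsMatchingSet A)
    (hA2 : 2 ≤ A.card) :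
    oneTree X (al X (Fintype.card V - 2 * A.card + 1) (A.card - 2))
      (sg X (Fintype.card V - 2 * A.card + 1) (A.card - 2)) ≤ phiPoly G ∨
    (3 ≤ A.card ∧ threeTrees X (al X (Fintype.card V - 2 * A.card + 1) (A.card - 3))
      (sg X (Fintype.card V - 2 * A.card + 1) (A.card - 3)) ≤ phiPoly G ∧ k = 0 ∧
      ∀ i, D.c i ∉ A) := by
  obtain ⟨L⟩ := D.exists_labelling
  obtain ⟨p, q, h⟩ := D.exists_isPair
  by_cases hM : ∃ i, L.M (D.c i)
  · obtain ⟨j, hj⟩ := hM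
    by_cases hk' : k = 0 ∧ ∀ i, L.M (D.c i)
    · obtain ⟨rfl, hall⟩ := hk'
      rcases target_le_of_triangle L h hA hA2 hall with h1 | ⟨h1, h2, h3⟩
      · exact Or.inl h1
      · exact Or.inr ⟨h1, h2, rfl, h3⟩
    · left
      refine target_le_of_marked hk (L.rotate j) (h.rotate j) (A := A) hA hA2 ?_ ?_
      · show L.M (D.c (0 + j))
        rwa [zero_add]
      · intro hk0
        by_contra hall
        push Not at hall
        refine hk' ⟨hk0, fun i => ?_⟩
        have : L.M (D.c (i - j + j)) := hall (i - j)
        rwa [sub_add_cancel] at this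
  · left
    push Not at hM
    by_cases hch : ∃ i, (D.ch (D.c i)).Nonempty
    · obtain ⟨j, hj⟩ := hch
      refine target_le_of_unmarked hk (L.rotate j) (h.rotate j) (A := A) hA hA2
        (fun i => hM _) ?_
      show (D.ch (D.c (0 + j))).Nonempty
      rwa [zero_add]
    · push Not at hch
      exact target_le_of_cycle hk h hA hA2 hch

end UnicyclicData

end SignlessLaplacian

namespace SignlessLaplacian

open Polynomial Matrix

/-! ### The polynomial of $G_3^1$ is not below that of $G_3^2$. -/

section Incomparable

/-- The ratio `sg / al` is the logarithmic derivative of the dual number, namely `t` times `y / (1 +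
y)` plus `s` times `y (1 + 2 y) / (1 + 3 y + y ^ 2)`; the fractions are at most 1 and 2. -/
theorem sg_le_mul_al {y : ℤ} (hy : 0 ≤ y) (t s : ℕ) : sg y t s ≤ (t + 2 * s) * al y t s := by
  have h1 : t * y * (1 + y) ^ (t - 1) ≤ t * (1 + y) ^ t := by
    rcases t with _ | t
    · simp
    · rw [Nat.add_sub_cancel, pow_succ, mul_assoc]
      refine mul_le_mul_of_nonneg_left ?_ (by positivity)
      nlinarith [pow_nonneg (by omega : 0 ≤ 1 + y) t]
  have h2 : s * (y * (1 + 2 * y)) * (1 + 3 * y + y ^ 2) ^ (s - 1) ≤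
      2 * s * (1 + 3 * y + y ^ 2) ^ s := by
    rcases s with _ | s
    · simp
    · rw [Nat.add_sub_cancel, pow_succ (1 + 3 * y + y ^ 2) s]
      have hs : (0 : ℤ) ≤ ((s + 1 : ℕ) : ℤ) := by positivity
      have h0 : (0 : ℤ) ≤ (1 + 3 * y + y ^ 2) ^ s := by positivity
      have := mul_nonneg hs (mul_nonneg h0 (by positivity : 0 ≤ 2 + 5 * y))
      linarith
  have h3 := mul_le_mul_of_nonneg_right h1 (by positivity : 0 ≤ (1 + 3 * y + y ^ 2) ^ s)
  have h4 := mul_le_mul_of_nonneg_right h2 (by positivity : 0 ≤ (1 + y) ^ t)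
  unfold sg al
  linarith

theorem eval_al (y : ℤ) (t s : ℕ) : (al (X : ℤ[X]) t s).eval y = al y t s := by
  simp [al]

theorem eval_sg (y : ℤ) (t s : ℕ) : (sg (X : ℤ[X]) t s).eval y = sg y t s := by
  simp [sg]

theorem eval_le_eval {f g : ℤ[X]} (h : f ≤ g) {y : ℤ} (hy : 0 ≤ y) : f.eval y ≤ g.eval y := by
  rw [← sub_nonneg, ← eval_sub, eval_eq_sum]
  refine Finset.sum_nonneg fun i _ => mul_nonneg ?_ (pow_nonneg hy i)
  rw [coeff_sub]
  exact sub_nonneg.2 (h i)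

/-- Apart from the common leading coefficient, the part proportional to `al` favours `oneTree` by a
quartic in `y`, while the part proportional to `sg` favours `threeTrees` by only `y (1 + 3 y + y ^
2)`. As `sg ≤ (t + 2 s) al`, the quartic wins for `y` large compared with `t + 2 s`. -/
theorem not_oneTree_le_threeTrees (t s : ℕ) :
    ¬ oneTree X (al X t (s + 1)) (sg X t (s + 1)) ≤
      threeTrees (X : ℤ[X]) (al X t s) (sg X t s) := by
  intro h
  obtain ⟨y, hy⟩ : ∃ y : ℤ, y = 20 + 20 * (t + 2 * s) := ⟨_, rfl⟩
  have hy0 : 0 ≤ y := by rw [hy]; positivity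
  have h1 := eval_le_eval h hy0
  rw [show al (X : ℤ[X]) t (s + 1) = al X (t + 0) (s + 1) from rfl,
    show sg (X : ℤ[X]) t (s + 1) = sg X (t + 0) (s + 1) from rfl, al_add, sg_add, al_zero_one,
    sg_zero_one] at h1
  have hs := sg_le_mul_al hy0 t s
  have ha : 0 < al y t s := by unfold al; positivity
  simp only [oneTree, threeTrees, cyclicVal, transfer, List.map_cons, List.map_nil, List.prod_cons,
    List.prod_nil, mul_one, Matrix.mul_fin_two, Matrix.trace_fin_two_of, eval_add, eval_mul,
    eval_al, eval_sg, eval_X, eval_one, eval_pow, eval_ofNat] at h1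
  generalize al y t s = A at *
  generalize sg y t s = S at *
  have h2 := mul_le_mul_of_nonneg_left hs (by positivity : 0 ≤ 20 * (y * (1 + 3 * y + y ^ 2)))
  have h3 : 20 * ((t : ℤ) + 2 * s) = y - 20 := by rw [hy]; ring
  have h4 : 20 * (y * (1 + 3 * y + y ^ 2)) * (((t : ℤ) + 2 * s) * A) =
    y * (1 + 3 * y + y ^ 2) * (y - 20) * A := by rw [← h3]; ring
  have h5 : 0 < A * (y * (20 + 80 * y ^ 3 + 79 * y ^ 3)) := by
    have : 0 < y := by rw [hy]; positivity
    positivity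
  have h6 : 0 ≤ A * (y ^ 2 * (80 * y)) := by positivity
  have h7 : 0 ≤ A * (y ^ 2 * (60 + 20 * y)) := by positivity
  nlinarith

end Incomparable

/-! ### The second coefficient in terms of degrees. -/

section SecondCoefficient

variable {V : Type*} [Fintype V] [DecidableEq V]

/-- With `P` the polynomial, `P(X) P(-X)` is the determinant of `1 - X ^ 2 M ^ 2`; compare the
coefficients of `X ^ 2`. -/
theorem two_mul_coeff_two_det (M : Matrix V V ℤ) :
    2 * (det (1 + (X : ℤ[X]) • M.map C)).coeff 2 = trace M ^ 2 - trace (M * M) := by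
  obtain ⟨P, hP⟩ : ∃ P, P = det (1 + (X : ℤ[X]) • M.map C) := ⟨_, rfl⟩
  have h1 : P.comp (C (-1) * X) = det (1 - (X : ℤ[X]) • M.map C) := by
    rw [hP, ← coe_compRingHom_apply, RingHom.map_det]
    congr 1
    ext i j : 2
    rcases eq_or_ne i j with rfl | hij <;> simp [sub_eq_add_neg, *]
  have h2 : (det (1 + (X : ℤ[X]) • (-(M * M)).map C)).comp (X ^ 2) =
      P * det (1 - (X : ℤ[X]) • M.map C) := by
    rw [hP, ← det_mul, ← coe_compRingHom_apply, RingHom.map_det]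
    congr 1
    rw [show (1 + (X : ℤ[X]) • M.map C) * (1 - (X : ℤ[X]) • M.map C) =
      1 - (X : ℤ[X]) ^ 2 • (M * M).map C by
        rw [Matrix.map_mul, add_mul, mul_sub, mul_sub, one_mul, mul_one, one_mul, smul_mul_smul_comm,
          pow_two]
        abel]
    ext i j : 2
    rcases eq_or_ne i j with rfl | hij <;> simp [← Matrix.map_mul, sub_eq_add_neg, *]
  have h7 : ∀ i, (P.comp (C (-1) * X)).coeff i = P.coeff i * (-1) ^ i := fun i =>
    comp_C_mul_X_coeff
  rw [← h1, ← expand_eq_comp_X_pow] at h2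
  have h3 := congrArg (fun f => f.coeff 2) h2
  have h4 : ∀ N : Matrix V V ℤ, (det (1 + (X : ℤ[X]) • N.map C)).coeff 0 = 1 := fun N => by
    rw [coeff_zero_eq_eval_zero, eval_det_add_X_smul, det_one, eval_one]
  have h5 : P.coeff 0 = 1 := by rw [hP]; exact h4 M
  have h6 : P.coeff 1 = trace M := by rw [hP]; exact coeff_det_one_add_X_smul_one M
  simp only [coeff_mul, Finset.Nat.antidiagonal_succ, Finset.Nat.antidiagonal_zero] at h3
  rw [show (2 : ℕ) = 1 * 2 from rfl, coeff_expand_mul (by norm_num),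
    coeff_det_one_add_X_smul_one, trace_neg] at h3
  simp only [h7, zero_add, Finset.map_singleton, Finset.sum_cons, Finset.sum_singleton, Finset.map_cons, h5, h6, Function.Embedding.prodMap, Function.Embedding.coeFn_mk, Prod.map] at h3
  norm_num [h5, h6] at h3
  rw [← hP]
  nlinarith

theorem two_mul_coeff_two_phiPoly (G : SimpleGraph V) [DecidableRel G.Adj] :
    2 * (phiPoly G).coeff 2 = (∑ v, (G.degree v : ℤ)) ^ 2 - ∑ v, (G.degree v : ℤ) ^ 2 -
      ∑ v, (G.degree v : ℤ) := by
  have hQ : signlessLaplacian G = G.degMatrix ℤ + G.adjMatrix ℤ := by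
    unfold signlessLaplacian; congr!
  have h1 : trace (signlessLaplacian G) = ∑ v, (G.degree v : ℤ) := by
    rw [hQ, trace_add, SimpleGraph.trace_adjMatrix, add_zero]
    simp [trace, SimpleGraph.degMatrix]
  have h2 : trace (signlessLaplacian G * signlessLaplacian G) =
      ∑ v, (G.degree v : ℤ) ^ 2 + ∑ v, (G.degree v : ℤ) := by
    rw [hQ, ← Finset.sum_add_distrib]
    refine Finset.sum_congr rfl fun v _ => ?_
    have hd : ∀ u ∈ G.neighborFinset v, G.degMatrix ℤ v u = 0 ∧ G.degMatrix ℤ u v = 0 := by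
      intro u hu
      have : v ≠ u := by rintro rfl; simp at hu
      exact ⟨diagonal_apply_ne _ this, diagonal_apply_ne _ this.symm⟩
    rw [diag_apply, add_mul, mul_add, mul_add, Matrix.add_apply, Matrix.add_apply, Matrix.add_apply,
      SimpleGraph.mul_adjMatrix_apply, SimpleGraph.adjMatrix_mul_apply,
      SimpleGraph.adjMatrix_mul_self_apply_self, Finset.sum_eq_zero fun u hu => (hd u hu).1,
      Finset.sum_eq_zero fun u hu => (hd u hu).2]
    simp [SimpleGraph.degMatrix, pow_two]
  have h3 : phiPoly G = det (1 + (X : ℤ[X]) • (signlessLaplacian G).map C) := by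
    unfold phiPoly; congr!
  rw [h3, two_mul_coeff_two_det, h1, h2]
  ring

end SecondCoefficient

end SignlessLaplacian

namespace SignlessLaplacian

open Polynomial Matrix

/-! ### Graphs with the largest sum of squares of degrees. -/

namespace UnicyclicData

variable {V : Type*} {G : SimpleGraph V} {k : ℕ} [DecidableEq V] (D : UnicyclicData G k)

/-- The number of edges `{u, nxt u}` with `u ∈ B` at the vertex `x`. -/
def val (B : Finset V) (x : V) : ℤ :=
  ∑ u ∈ B, ((if u = x then 1 else 0) + if D.nxt u = x then 1 else 0)

theorem val_nonneg (B : Finset V) (x : V) : 0 ≤ D.val B x :=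
  Finset.sum_nonneg fun u _ => by split_ifs <;> norm_num

theorem val_union {B C : Finset V} (h : Disjoint B C) (x : V) :
    D.val (B ∪ C) x = D.val B x + D.val C x := Finset.sum_union h

theorem one_le_val {B : Finset V} {x : V} (h : x ∈ B) : 1 ≤ D.val B x := by
  refine le_trans ?_ (Finset.single_le_sum (f := fun u => (if u = x then (1 : ℤ) else 0) +
    if D.nxt u = x then 1 else 0) (fun u _ => by split_ifs <;> norm_num) h)
  simp
  split_ifs <;> norm_num

theorem sum_mul_val [Fintype V] (B : Finset V) (g : V → ℤ) :
    ∑ x, g x * D.val B x = ∑ u ∈ B, (g u + g (D.nxt u)) := by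
  simp only [val, Finset.mul_sum]
  rw [Finset.sum_comm]
  refine Finset.sum_congr rfl fun u _ => ?_
  simp [mul_add, Finset.sum_add_distrib]

theorem sum_val [Fintype V] (B : Finset V) : ∑ x, D.val B x = 2 * B.card := by
  have := D.sum_mul_val B fun _ => 1
  simp only [one_mul, Finset.sum_const, nsmul_eq_mul] at this
  rw [this]
  norm_num [mul_comm]

theorem degree_eq_val [Fintype V] [DecidableRel G.Adj] (x : V) :
    (G.degree x : ℤ) = D.val Finset.univ x := by
  have h : G.neighborFinset x = insert (D.nxt x) (Finset.univ.filter fun u => D.nxt u = x) := by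
    ext u
    rw [SimpleGraph.mem_neighborFinset, D.adj_iff, Finset.mem_insert, Finset.mem_filter_univ,
      eq_comm (a := u)]
  rw [← SimpleGraph.card_neighborFinset_eq_degree, h, Finset.card_insert_of_notMem]
  · simp [val, Finset.sum_add_distrib, add_comm]
  · simp [D.nxt_nxt_ne]

/-- Two edges, given by their lower vertices, have a common vertex. -/
def Meet (u v : V) : Prop := u = v ∨ u = D.nxt v ∨ D.nxt u = v ∨ D.nxt u = D.nxt v

/-- Two distinct edges share at most one vertex; an edge shares two with itself. Summed over pairs,
this bounds the sum of squares of `val`. -/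
theorem val_pair_le (u v : V) :
    ((if u = v then (1 : ℤ) else 0) + if D.nxt u = v then 1 else 0) +
      ((if u = D.nxt v then 1 else 0) + if D.nxt u = D.nxt v then 1 else 0) ≤
      1 + if u = v then 1 else 0 := by
  have h1 := D.nxt_ne
  have h2 := D.nxt_nxt_ne
  split_ifs <;> simp_all

theorem sum_val_sq [Fintype V] (B : Finset V) : ∑ x, D.val B x ^ 2 = ∑ v ∈ B, ∑ u ∈ B,
    (((if u = v then (1 : ℤ) else 0) + if D.nxt u = v then 1 else 0) +
      ((if u = D.nxt v then 1 else 0) + if D.nxt u = D.nxt v then 1 else 0)) := by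
  simp only [pow_two, sum_mul_val]
  refine Finset.sum_congr rfl fun v _ => ?_
  simp only [val, Finset.sum_add_distrib]

theorem sum_pair_bound (B : Finset V) :
    ∑ v ∈ B, ∑ u ∈ B, ((1 : ℤ) + if u = v then 1 else 0) = B.card ^ 2 + B.card := by
  simp [Finset.sum_add_distrib, pow_two]

theorem sum_val_sq_le [Fintype V] (B : Finset V) :
    ∑ x, D.val B x ^ 2 ≤ B.card ^ 2 + B.card := by
  rw [sum_val_sq, ← sum_pair_bound]
  exact Finset.sum_le_sum fun v _ => Finset.sum_le_sum fun u _ => D.val_pair_le u v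

theorem meet_of_sum_val_sq [Fintype V] {B : Finset V}
    (h : (B.card : ℤ) ^ 2 + B.card ≤ ∑ x, D.val B x ^ 2) {u v : V} (hu : u ∈ B) (hv : v ∈ B) :
    D.Meet u v := by
  have h1 := le_antisymm (D.sum_val_sq_le B) h
  rw [sum_val_sq, ← sum_pair_bound, Finset.sum_eq_sum_iff_of_le fun v _ =>
    Finset.sum_le_sum fun u _ => D.val_pair_le u v] at h1
  have h2 := (Finset.sum_eq_sum_iff_of_le fun u _ => D.val_pair_le u v).1 (h1 v hv) u hu
  by_contra hm
  simp only [Meet, not_or] at hm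
  simp [hm] at h2

omit [DecidableEq V] in
theorem IsMatchingSet.not_meet {D : UnicyclicData G k} {A : Finset V} (hA : D.IsMatchingSet A)
    {u v : V} (hu : u ∈ A) (hv : v ∈ A) (h : D.Meet u v) : u = v := by
  rcases h with h | h | h | h
  · exact h
  · exact absurd (h ▸ hu) (hA v hv).1
  · exact absurd (h.symm ▸ hv) (hA u hu).1
  · exact (hA u hu).2 v hv h

theorem IsMatchingSet.val_eq {D : UnicyclicData G k} {A : Finset V} (hA : D.IsMatchingSet A)
    (x : V) : D.val A x = 0 ∨ D.val A x = 1 := by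
  by_cases h : ∃ u ∈ A, u = x ∨ D.nxt u = x
  · obtain ⟨u, hu, hx⟩ := h
    right
    rw [val, Finset.sum_eq_single u]
    · rcases hx with rfl | rfl
      · simp [D.nxt_ne]
      · simp [(D.nxt_ne u).symm]
    · intro v hv hvu
      have h1 := mt (hA.not_meet hv hu) hvu
      simp only [Meet, not_or] at h1
      rcases hx with rfl | rfl <;> simp [h1]
    · exact fun h => absurd hu h
  · left
    push Not at h
    exact Finset.sum_eq_zero fun u hu => by simp [h u hu]

theorem exists_of_val_eq_one {A : Finset V} {x : V} (h : D.val A x = 1) :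
    ∃ u ∈ A, u = x ∨ D.nxt u = x := by
  by_contra hc
  push Not at hc
  rw [val, Finset.sum_eq_zero fun u hu => by simp [hc u hu]] at h
  exact absurd h (by norm_num)

variable [Fintype V]

/-- A graph with the largest possible sum of the squares of the degrees. -/
theorem IsMatchingSet.meet_of_sum_sq {D : UnicyclicData G k} {A : Finset V}
    (hA : D.IsMatchingSet A)
    (h : (Aᶜ.card : ℤ) ^ 2 - Aᶜ.card + 4 * Fintype.card V ≤ ∑ x, D.val Finset.univ x ^ 2) :
    (∀ u ∉ A, ∀ v ∉ A, D.Meet u v) ∧ ∀ x, D.val A x = 0 → D.val Aᶜ x = 1 := by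
  have hd : ∀ x, D.val Finset.univ x = D.val A x + D.val Aᶜ x := fun x => by
    rw [← D.val_union disjoint_compl_right, Finset.union_compl]
  have hcard : (A.card : ℤ) + Aᶜ.card = Fintype.card V := by
    exact_mod_cast Finset.card_add_card_compl A
  -- A vertex missed by `A` lies on some edge outside `A`. Since `D.val A x` is 0 or 1, this is the
  -- only slack besides pairs of edges that do not meet, and equality makes both vanish.
  have hslack : ∀ x, 0 ≤ (1 - D.val A x) * (D.val Aᶜ x - 1) := by
    intro x
    rcases hA.val_eq x with h0 | h0 <;> rw [h0]
    · have hx : x ∈ Aᶜ := by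
        rw [Finset.mem_compl]
        intro hx
        have := D.one_le_val hx
        omega
      have := D.one_le_val hx
      linarith
    · simp
  have hsum : ∑ x, D.val Finset.univ x ^ 2 + 2 * ∑ x, (1 - D.val A x) * (D.val Aᶜ x - 1) =
      ∑ x, D.val Aᶜ x ^ 2 + 2 * ∑ x, D.val Aᶜ x + 3 * ∑ x, D.val A x - 2 * Fintype.card V := by
    have : (Fintype.card V : ℤ) = ∑ x : V, 1 := by simp
    rw [this]
    simp only [Finset.mul_sum, ← Finset.sum_add_distrib, ← Finset.sum_sub_distrib]
    refine Finset.sum_congr rfl fun x _ => ?_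
    rw [hd]
    rcases hA.val_eq x with h0 | h0 <;> rw [h0] <;> ring
  rw [sum_val, sum_val] at hsum
  have h1 := D.sum_val_sq_le Aᶜ
  have h2 : 0 ≤ ∑ x, (1 - D.val A x) * (D.val Aᶜ x - 1) := Finset.sum_nonneg fun x _ => hslack x
  refine ⟨fun u hu v hv => D.meet_of_sum_val_sq (B := Aᶜ) (by linarith) (by simpa) (by simpa),
    fun x hx => ?_⟩
  have h3 := (Finset.sum_eq_zero_iff_of_nonneg fun x _ => hslack x).1
    (le_antisymm (by linarith) h2) x (Finset.mem_univ x)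
  rw [hx] at h3
  linarith

/-- A graph with a triangle avoided by a maximum matching and with the largest possible sum of the
squares of the degrees. -/
theorem IsMatchingSet.meet_of_sum_sq_of_triangle {D : UnicyclicData G 0} {A : Finset V}
    (hA : D.IsMatchingSet A) (hc : ∀ i, D.c i ∉ A) {b : ℤ} (hb : b + A.card + 3 = Fintype.card V)
    (h : b ^ 2 + 9 * b - 2 * Fintype.card V + 6 * A.card + 24 ≤ ∑ x, D.val Finset.univ x ^ 2) :
    (∀ u ∉ A, D.ht u ≠ 0 → ∀ v ∉ A, D.ht v ≠ 0 → D.Meet u v) ∧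
    (∀ u ∉ A, D.ht u ≠ 0 → D.ht (D.nxt u) = 0) ∧ ∀ i, D.val A (D.c i) = 1 := by
  obtain ⟨T, hT⟩ : ∃ T, T = Finset.univ.image D.c := ⟨_, rfl⟩
  have hmemT : ∀ x, x ∈ T ↔ D.ht x = 0 := fun x => by
    rw [hT, D.ht_eq_zero]; simp
  have hTcard : T.card = 3 := by
    rw [hT, Finset.card_image_of_injective _ D.c_inj]; simp
  have hAT : Disjoint A T := by
    rw [Finset.disjoint_left]
    intro x hx hxT
    obtain ⟨i, rfl⟩ := (D.ht_eq_zero x).1 ((hmemT x).1 hxT)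
    exact hc i hx
  obtain ⟨B, hB⟩ : ∃ B, B = (A ∪ T)ᶜ := ⟨_, rfl⟩
  have hmemB : ∀ x, x ∈ B ↔ x ∉ A ∧ D.ht x ≠ 0 := fun x => by
    rw [hB, Finset.mem_compl, Finset.mem_union, not_or, hmemT]
  have hBb : (B.card : ℤ) = b := by
    have := Finset.card_add_card_compl (A ∪ T)
    rw [← hB, Finset.card_union_of_disjoint hAT, hTcard] at this
    omega
  obtain ⟨χ, hχ⟩ : ∃ χ : V → ℤ, χ = fun x => if D.ht x = 0 then 1 else 0 := ⟨_, rfl⟩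
  have hχ' : ∀ x, D.ht x = 0 ∧ χ x = 1 ∨ D.ht x ≠ 0 ∧ χ x = 0 := fun x => by
    rw [hχ]
    by_cases hx : D.ht x = 0 <;> simp [hx]
  have hχsum : ∑ x, χ x = 3 := by
    rw [hχ, Finset.sum_boole, show Finset.univ.filter (fun x => D.ht x = 0) = T by
      ext x; simp [hmemT], hTcard]
    rfl
  have hvalT : ∀ x, D.val T x = 2 * χ x := by
    intro x
    rw [val, hT, Finset.sum_image fun i _ j _ hij => D.c_inj hij]
    rcases hχ' x with ⟨h0, h1⟩ | ⟨h0, h1⟩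
    · obtain ⟨i, rfl⟩ := (D.ht_eq_zero x).1 h0
      rw [h1]
      simp only [D.nxt_c, D.c_inj.eq_iff]
      clear h0 h1
      revert i
      decide
    · rw [h1, Finset.sum_eq_zero]
      · rfl
      · intro i _
        have h2 : D.c i ≠ x := fun hi => h0 ((D.ht_eq_zero x).2 ⟨i, hi⟩)
        have h3 : D.nxt (D.c i) ≠ x := fun hi => h0 ((D.ht_eq_zero x).2 ⟨i + 1, by
          rw [← D.nxt_c, hi]⟩)
        simp [h2, h3]
  have hd : ∀ x, D.val Finset.univ x = D.val A x + D.val B x + 2 * χ x := fun x => by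
    rw [add_right_comm, ← hvalT, ← D.val_union hAT, ← D.val_union, hB, Finset.union_compl]
    rw [hB]
    exact disjoint_compl_right
  have hslack : ∀ x, 0 ≤ (1 - D.val A x) * (D.val B x - (1 - χ x)) := by
    intro x
    rcases hA.val_eq x with h0 | h0 <;> rw [h0]
    · rcases hχ' x with ⟨h1, h2⟩ | ⟨h1, h2⟩ <;> rw [h2]
      · have := D.val_nonneg B x
        linarith
      · have hx : x ∈ B := by
          rw [hmemB]
          refine ⟨fun hx => ?_, h1⟩
          have := D.one_le_val hx
          omega
        have := D.one_le_val hx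
        linarith
    · simp
  -- The degree is split into the matching, the remaining tree edges `B` and the triangle, which
  -- contributes `2 * χ`. The bound follows from four facts: edges of `B` meet at most once, the
  -- slack is nonnegative, `A` covers at most three triangle vertices, and an edge of `B` has at
  -- most one end on the triangle. The hypothesis forces equality in each.
  have hsum : ∑ x, D.val Finset.univ x ^ 2 +
      2 * ∑ x, (1 - D.val A x) * (D.val B x - (1 - χ x)) =
      ∑ x, D.val B x ^ 2 + 2 * ∑ x, D.val B x + 3 * ∑ x, D.val A x - 2 * Fintype.card V +
        6 * ∑ x, χ x + 2 * ∑ x, χ x * D.val A x + 4 * ∑ x, χ x * D.val B x := by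
    have : (Fintype.card V : ℤ) = ∑ x : V, 1 := by simp
    rw [this]
    simp only [Finset.mul_sum, ← Finset.sum_add_distrib, ← Finset.sum_sub_distrib]
    refine Finset.sum_congr rfl fun x _ => ?_
    rw [hd]
    rcases hA.val_eq x with h0 | h0 <;> rcases hχ' x with ⟨h1, h2⟩ | ⟨h1, h2⟩ <;>
      rw [h0, h2] <;> ring
  rw [sum_val, sum_val, hχsum, D.sum_mul_val B] at hsum
  have h1 := D.sum_val_sq_le B
  have h2 : 0 ≤ ∑ x, (1 - D.val A x) * (D.val B x - (1 - χ x)) :=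
    Finset.sum_nonneg fun x _ => hslack x
  have hterm : ∀ x, χ x * D.val A x ≤ χ x := by
    intro x
    rcases hA.val_eq x with h0 | h0 <;> rcases hχ' x with ⟨h1, h2⟩ | ⟨h1, h2⟩ <;> simp [h0, h2]
  have h3 : ∑ x, χ x * D.val A x ≤ 3 := by
    rw [← hχsum]
    exact Finset.sum_le_sum fun x _ => hterm x
  have hterm' : ∀ u ∈ B, χ u + χ (D.nxt u) ≤ 1 := by
    intro u hu
    have := ((hmemB u).1 hu).2
    rcases hχ' u with ⟨h1, h2⟩ | ⟨h1, h2⟩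
    · exact absurd h1 this
    · rcases hχ' (D.nxt u) with ⟨h3, h4⟩ | ⟨h3, h4⟩ <;> simp [h2, h4]
  have h4 : ∑ u ∈ B, (χ u + χ (D.nxt u)) ≤ ∑ u ∈ B, 1 := Finset.sum_le_sum hterm'
  have hone : ∑ u ∈ B, (1 : ℤ) = B.card := by simp
  rw [← hBb] at h
  rw [← hBb] at hb
  refine ⟨fun u hu hu' v hv hv' => D.meet_of_sum_val_sq (B := B) (by linarith)
    ((hmemB u).2 ⟨hu, hu'⟩) ((hmemB v).2 ⟨hv, hv'⟩), fun u hu hu' => ?_, fun i => ?_⟩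
  · have h5 := (Finset.sum_eq_sum_iff_of_le hterm').1 (le_antisymm h4 (by linarith)) u
      ((hmemB u).2 ⟨hu, hu'⟩)
    rcases hχ' u with ⟨h6, h7⟩ | ⟨h6, h7⟩
    · exact absurd h6 hu'
    · rcases hχ' (D.nxt u) with ⟨h8, h9⟩ | ⟨h8, h9⟩
      · exact h8
      · rw [h7, h9] at h5
        exact absurd h5 (by norm_num)
  · have h5 := (Finset.sum_eq_sum_iff_of_le fun x (_ : x ∈ Finset.univ) => hterm x).1
      (le_antisymm (by linarith) (by linarith)) (D.c i) (Finset.mem_univ _)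
    rcases hχ' (D.c i) with ⟨h6, h7⟩ | ⟨h6, h7⟩
    · rw [h7] at h5
      linarith
    · exact absurd (D.ht_c i) h6

end UnicyclicData

end SignlessLaplacian

/-! ### Triangles with pendent edges and paths: polynomial, girth and matching number. -/

namespace SignlessLaplacian

open Polynomial Matrix

/-- The cycle of a triangle with pendent paths. -/
def pendantData (s t : Fin 3 → ℕ) : UnicyclicData (cycleWithPendants 3 s t) 0 where
  c i := .inl i
  nxt
    | .inl i => .inl (i + 1)
    | .inr (.inl p) => .inl p.1
    | .inr (.inr (.inl p)) => .inr (.inl p)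
    | .inr (.inr (.inr p)) => .inl p.1
  ht
    | .inl _ => 0
    | .inr (.inl _) => 1
    | .inr (.inr (.inl _)) => 2
    | .inr (.inr (.inr _)) => 1
  c_inj _ _ h := Sum.inl_injective h
  nxt_c _ := rfl
  ht_eq_zero v := by rcases v with i | p | p | p <;> simp
  ht_nxt v := by rcases v with i | p | p | p <;> simp
  adj_iff x y := by
    have hc : ∀ i j : Fin 3, (SimpleGraph.cycleGraph 3).Adj i j ↔ i + 1 = j ∨ j + 1 = i := by
      decide
    have hne : ∀ i : Fin 3, i + 1 ≠ i := by decide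
    rcases x with i | p | p | p <;> rcases y with j | q | q | q <;>
      simp [cycleWithPendants, cycleRel, SimpleGraph.fromRel_adj, hc]
    · have := hne i
      have := hne j
      constructor
      · tauto
      · rintro (rfl | rfl) <;> simp [hne, (hne _).symm]
    · exact eq_comm
    · exact eq_comm

variable (s t : Fin 3 → ℕ)

theorem pendantData_sum_sq : ∑ x, (pendantData s t).val Finset.univ x ^ 2 =
    ∑ i, ((2 + s i + t i : ℤ) ^ 2 + 5 * s i + t i) := by
  have h0 : ∀ i, (pendantData s t).val Finset.univ (.inl i) = 2 + s i + t i := by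
    intro i
    have hi : ∀ i : Fin 3, ∑ x : Fin 3, ((if x = i then (1 : ℤ) else 0) +
        if x + 1 = i then 1 else 0) = 2 := by decide
    have hs : ∀ r : Fin 3 → ℕ, ∑ p : Σ i, Fin (r i), (if p.1 = i then (1 : ℤ) else 0) = r i := by
      intro r
      rw [Fintype.sum_sigma, Finset.sum_eq_single i]
      · simp
      · intro j _ hj
        simp [hj]
      · simp
    simp only [UnicyclicData.val, pendantData, Fintype.sum_sum_type, Sum.inl.injEq, reduceCtorEq,
      if_false, zero_add, Finset.sum_const_zero, hi, hs]
    ring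
  have h1 : ∀ p, (pendantData s t).val Finset.univ (.inr (.inl p)) = 2 := by
    intro i
    simp [UnicyclicData.val, pendantData]
  have h2 : ∀ p, (pendantData s t).val Finset.univ (.inr (.inr (.inl p))) = 1 := by
    intro i
    simp [UnicyclicData.val, pendantData]
  have h3 : ∀ p, (pendantData s t).val Finset.univ (.inr (.inr (.inr p))) = 1 := by
    intro i
    simp [UnicyclicData.val, pendantData]
  simp [h0, h1, h2, h3, Finset.sum_add_distrib, ← Finset.mul_sum]
  ring

theorem pendantData_ch_inl (i : Fin 3) : (pendantData s t).ch (.inl i) =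
    (Finset.univ.image fun j : Fin (s i) => .inr (.inl ⟨i, j⟩)) ∪
      Finset.univ.image fun j : Fin (t i) => .inr (.inr (.inr ⟨i, j⟩)) := by
  ext x
  rw [UnicyclicData.mem_ch]
  rcases x with j | ⟨j, p⟩ | p | ⟨j, p⟩ <;> simp [pendantData]
  all_goals
    constructor
    · rintro rfl
      exact ⟨rfl, p, HEq.rfl⟩
    · exact fun h => h.1.symm

theorem pendantData_ch_middle (p : Σ i, Fin (s i)) :
    (pendantData s t).ch (.inr (.inl p)) = {.inr (.inr (.inl p))} := by
  ext x
  rw [UnicyclicData.mem_ch]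
  rcases x with j | q | q | q <;> simp [pendantData]

theorem pendantData_ch_end (p : Σ i, Fin (s i)) :
    (pendantData s t).ch (.inr (.inr (.inl p))) = ∅ := by
  ext x
  rw [UnicyclicData.mem_ch]
  rcases x with j | q | q | q <;> simp [pendantData]

theorem pendantData_ch_leaf (p : Σ i, Fin (t i)) :
    (pendantData s t).ch (.inr (.inr (.inr p))) = ∅ := by
  ext x
  rw [UnicyclicData.mem_ch]
  rcases x with j | q | q | q <;> simp [pendantData]

/-- The brooms have exactly the pairs `(al + sg, al)`, so the target values are attained. -/
theorem phiPoly_pendants : phiPoly (cycleWithPendants 3 s t) =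
    cyclicVal X (List.ofFn fun i => (al X (t i) (s i) + sg X (t i) (s i), al X (t i) (s i))) := by
  obtain ⟨p, q, h⟩ := (pendantData s t).exists_isPair
  have he : ∀ x, (pendantData s t).ch x = ∅ → p x = 1 ∧ q x = 1 := by
    intro x hx
    have : q x = 1 := by rw [h.hq, hx, Finset.prod_empty]
    exact ⟨by rw [h.hp, hx, this]; simp, this⟩
  have h3 := fun x => he _ (pendantData_ch_leaf s t x)
  have h2 := fun x => he _ (pendantData_ch_end s t x)
  have h1 : ∀ x, p (.inr (.inl x)) = 1 + 2 * X ∧ q (.inr (.inl x)) = 1 + X := by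
    intro x
    have : q (.inr (.inl x)) = 1 + X := by
      rw [h.hq, pendantData_ch_middle, Finset.prod_singleton, (h2 x).1, (h2 x).2, mul_one]
    refine ⟨?_, this⟩
    rw [h.hp, pendantData_ch_middle, Finset.sum_singleton, this, (h2 x).1]
    simp
    ring
  have hdisj : ∀ i, Disjoint
      ((Finset.univ.image fun j : Fin (s i) => .inr (.inl ⟨i, j⟩) : Finset (CycleVertex 3 s t)))
      (Finset.univ.image fun j : Fin (t i) => .inr (.inr (.inr ⟨i, j⟩))) := by
    intro i
    simp [Finset.disjoint_left]
  have hb : ((1 : ℤ[X]) + 2 * X) + X * (1 + X) = 1 + 3 * X + X ^ 2 := by ring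
  have hprod : ∀ i, ∏ x ∈ (pendantData s t).ch (.inl i), (p x + X * q x) =
      (1 + X) ^ t i * (1 + 3 * X + X ^ 2) ^ s i := by
    intro i
    rw [pendantData_ch_inl, Finset.prod_union (hdisj i), Finset.prod_image (fun _ _ _ _ h => by simpa using h),
      Finset.prod_image (fun _ _ _ _ h => by simpa using h)]
    simp only [h1, h3, hb, mul_one, Finset.prod_const, Finset.card_univ, Fintype.card_fin]
    ring
  have hq : ∀ i, q (.inl i) = al X (t i) (s i) := by
    intro i
    rw [h.hq, hprod, al]
  have ha0 : (1 + X : ℤ[X]) ≠ 0 := by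
    intro h0
    have := congrArg (eval 0) h0
    simp at this
  have hb0 : (1 + 3 * X + X ^ 2 : ℤ[X]) ≠ 0 := by
    intro h0
    have := congrArg (eval 0) h0
    simp at this
  have hp : ∀ i, p (.inl i) = al X (t i) (s i) + sg X (t i) (s i) := by
    intro i
    have e1 : ∀ j : Fin (s i), ∏ z ∈ ((pendantData s t).ch (.inl i)).erase (.inr (.inl ⟨i, j⟩)),
        (p z + X * q z) = (1 + X) ^ t i * (1 + 3 * X + X ^ 2) ^ (s i - 1) := by
      intro j
      have := Finset.mul_prod_erase ((pendantData s t).ch (.inl i)) (fun z => p z + X * q z)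
        (a := .inr (.inl ⟨i, j⟩)) (by rw [pendantData_ch_inl]; simp)
      rw [hprod, (h1 _).1, (h1 _).2, hb] at this
      refine mul_left_cancel₀ hb0 (this.trans ?_)
      obtain ⟨r, hr⟩ : ∃ r, s i = r + 1 := ⟨s i - 1, by have := j.2; omega⟩
      rw [hr, Nat.add_sub_cancel, pow_succ]
      ring
    have e3 : ∀ j : Fin (t i),
        ∏ z ∈ ((pendantData s t).ch (.inl i)).erase (.inr (.inr (.inr ⟨i, j⟩))),
        (p z + X * q z) = (1 + X) ^ (t i - 1) * (1 + 3 * X + X ^ 2) ^ s i := by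
      intro j
      have := Finset.mul_prod_erase ((pendantData s t).ch (.inl i)) (fun z => p z + X * q z)
        (a := .inr (.inr (.inr ⟨i, j⟩))) (by rw [pendantData_ch_inl]; simp)
      rw [hprod, (h3 _).1, (h3 _).2, mul_one] at this
      refine mul_left_cancel₀ ha0 (this.trans ?_)
      obtain ⟨r, hr⟩ : ∃ r, t i = r + 1 := ⟨t i - 1, by have := j.2; omega⟩
      rw [hr, Nat.add_sub_cancel, pow_succ]
      ring
    have e4 : ∑ x ∈ (pendantData s t).ch (.inl i), p x *
        ∏ z ∈ ((pendantData s t).ch (.inl i)).erase x, (p z + X * q z) =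
        (s i : ℤ[X]) * ((1 + 2 * X) * ((1 + X) ^ t i * (1 + 3 * X + X ^ 2) ^ (s i - 1))) +
          (t i : ℤ[X]) * ((1 + X) ^ (t i - 1) * (1 + 3 * X + X ^ 2) ^ s i) := by
      conv_lhs => rw [pendantData_ch_inl]
      rw [Finset.sum_union (hdisj i), Finset.sum_image (fun _ _ _ _ h => by simpa using h), Finset.sum_image (fun _ _ _ _ h => by simpa using h),
        ← pendantData_ch_inl]
      simp only [h1, h3, e1, e3, one_mul, Finset.sum_const, Finset.card_univ, Fintype.card_fin,
        nsmul_eq_mul]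
    rw [h.hp, e4, hq, sg]
    ring
  rw [h.phiPoly_eq (by decide)]
  congr 2
  funext i
  exact Prod.ext (hp i) (hq i)

theorem UnicyclicData.girth_eq_three {V : Type*} {G : SimpleGraph V} (D : UnicyclicData G 0) :
    G.girth = 3 := by
  have h0 : G.Adj (D.c 0) (D.c 1) := (D.adj_iff _ _).2 (Or.inl (D.nxt_c 0))
  have h1 : G.Adj (D.c 1) (D.c 2) := (D.adj_iff _ _).2 (Or.inl (D.nxt_c 1))
  have h2 : G.Adj (D.c 2) (D.c 0) := (D.adj_iff _ _).2 (Or.inl (D.nxt_c 2))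
  obtain ⟨w, hw⟩ : ∃ w : G.Walk (D.c 0) (D.c 0), w = .cons h0 (.cons h1 (.cons h2 .nil)) := ⟨_, rfl⟩
  have hcyc : w.IsCycle := by
    have := h0.ne
    have := h1.ne
    have := h2.ne
    subst hw
    exact
      { edges_nodup := by aesop
        ne_nil := by aesop
        support_nodup := by aesop }
  refine le_antisymm ?_ (SimpleGraph.three_le_girth fun h => h w hcyc)
  refine (SimpleGraph.girth_le_length hcyc).trans (le_of_eq ?_)
  rw [hw]
  rfl

variable {s t}

/-- The upper bound counts the marks of the greedy labelling and one cycle edge if both of its ends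
are unmarked. It is attained by the outer edges of all paths, one pendent edge at each vertex that
has some, and the edge between the first two cycle vertices if neither has one. -/
theorem matchingNumber_pendants (ht : t 2 ≠ 0) : matchingNumber (cycleWithPendants 3 s t) =
    ∑ i, (s i + if t i = 0 then 0 else 1) + if t 0 = 0 ∧ t 1 = 0 then 1 else 0 := by
  classical
  refine le_antisymm ?_ ?_
  · obtain ⟨⟨A, hA, hcard⟩, -⟩ := (pendantData s t).isGreatest_matchingNumber
    obtain ⟨L⟩ := (pendantData s t).exists_labelling
    have h3 : ∀ x, ¬ L.M (.inr (.inr (.inr x))) ∧ L.s (.inr (.inr (.inr x))) = 0 := by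
      intro x
      rw [L.hM, L.hs, pendantData_ch_leaf]
      simp
    have h2 : ∀ x, ¬ L.M (.inr (.inr (.inl x))) ∧ L.s (.inr (.inr (.inl x))) = 0 := by
      intro x
      rw [L.hM, L.hs, pendantData_ch_end]
      simp
    have h1 : ∀ x, L.M (.inr (.inl x)) ∧ L.s (.inr (.inl x)) = 0 := by
      intro x
      rw [L.hM, L.hs, pendantData_ch_middle]
      simp [h2]
    have h0 : ∀ i, (L.M (.inl i) ↔ t i ≠ 0) ∧ L.s (.inl i) = s i := by
      intro i
      constructor
      · rw [L.hM, pendantData_ch_inl]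
        constructor
        · rintro ⟨x, hx, hMx⟩
          simp only [Finset.mem_union, Finset.mem_image, Finset.mem_univ, true_and] at hx
          rcases hx with ⟨j, rfl⟩ | ⟨j, rfl⟩
          · exact absurd (h1 _).1 hMx
          · have := j.2
            omega
        · intro hti
          exact ⟨.inr (.inr (.inr ⟨i, ⟨0, by omega⟩⟩)), by simp, (h3 _).1⟩
      · rw [L.hs, pendantData_ch_inl, Finset.sum_union (by simp [Finset.disjoint_left]),
          Finset.sum_image (fun _ _ _ _ h => by simpa using h),
          Finset.sum_image (fun _ _ _ _ h => by simpa using h)]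
        simp [h1, h3]
    rw [← hcard]
    refine (hA.card_le L).trans ?_
    rw [← L.sum_marked]
    refine add_le_add (le_of_eq (Finset.sum_congr rfl fun i _ => ?_)) ?_
    · have h := h0 i
      rw [show (pendantData s t).c i = .inl i from rfl, h.2]
      by_cases hi : t i = 0 <;> simp [h.1, hi]
    · have h : ∀ i, L.M ((pendantData s t).c i) ↔ t i ≠ 0 := fun i => (h0 i).1
      rw [Fin.sum_univ_three]
      simp only [h]
      simp [ht]
      split_ifs <;> simp_all
  · obtain ⟨P, h0, h1, h2, h3⟩ : ∃ P : CycleVertex 3 s t → Prop,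
        (∀ i, P (.inl i) ↔ i = 0 ∧ t 0 = 0 ∧ t 1 = 0) ∧ (∀ p, P (.inr (.inl p)) ↔ False) ∧
        (∀ p, P (.inr (.inr (.inl p))) ↔ True) ∧
        ∀ p, P (.inr (.inr (.inr p))) ↔ (p.2 : ℕ) = 0 :=
      ⟨fun
        | .inl i => i = 0 ∧ t 0 = 0 ∧ t 1 = 0
        | .inr (.inl _) => False
        | .inr (.inr (.inl _)) => True
        | .inr (.inr (.inr p)) => (p.2 : ℕ) = 0, fun _ => Iff.rfl, fun _ => Iff.rfl,
        fun _ => Iff.rfl, fun _ => Iff.rfl⟩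
    refine (pendantData s t).isGreatest_matchingNumber.2 ⟨Finset.univ.filter P, ?_, ?_⟩
    · intro v hv
      have hne : (0 : Fin 3) + 1 ≠ 0 := by decide
      have htop : ∀ x y : Σ i, Fin (t i), (x.2 : ℕ) = 0 → (y.2 : ℕ) = 0 → x.1 = y.1 → x = y := by
        rintro ⟨i, x⟩ ⟨j, y⟩ hx hy rfl
        simp only [Sigma.mk.injEq, heq_eq_eq, true_and]
        exact Fin.ext (hx.trans hy.symm)
      have hpos : ∀ x : Σ i, Fin (t i), t x.1 ≠ 0 := fun x => by have := x.2.2; omega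
      rw [Finset.mem_filter_univ] at hv
      refine ⟨?_, fun w hw h => ?_⟩
      · rw [Finset.mem_filter_univ]
        rcases v with i | p | p | p
        · simp [pendantData, h0] at hv ⊢
          simp [hv.1]
        · exact ((h1 p).1 hv).elim
        · simp [pendantData, h1]
        · simp only [pendantData, h0]
          rintro ⟨h4, h5, h6⟩
          exact hpos p (h4 ▸ h5)
      · rw [Finset.mem_filter_univ] at hw
        rcases v with i | p | p | p <;> rcases w with j | q | q | q <;> simp [pendantData, h0, h1, h2, h3] at hv hw h ⊢
        · exact h
        · exact hpos q (by rw [← h, hv.1]; exact hv.2.2)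
        · exact h
        · exact hpos p (by rw [h, hw.1]; exact hw.2.2)
        · exact htop p q hv hw h
    · rw [Finset.card_filter, Fintype.sum_sum_type, Fintype.sum_sum_type, Fintype.sum_sum_type,
        Fintype.sum_sigma, Fintype.sum_sigma, Fintype.sum_sigma]
      have hl : ∀ r, (∑ j : Fin r, if (j : ℕ) = 0 then 1 else 0) = if r = 0 then 0 else 1 := by
        intro r
        rcases r with _ | r <;> simp
      simp only [h0, h1, h2, h3, hl, Fin.sum_univ_three]
      simp
      ring

end SignlessLaplacian

namespace SignlessLaplacian

open Polynomial Matrix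

/-! ### Isomorphisms, and pairwise intersecting edges. -/

namespace UnicyclicData

variable {V : Type*} {G : SimpleGraph V}

theorem nonempty_iso {W : Type*} {H : SimpleGraph W} {k : ℕ} (D : UnicyclicData G k)
    (D' : UnicyclicData H k) {f : W → V} (hf : Function.Bijective f)
    (h : ∀ x, f (D'.nxt x) = D.nxt (f x)) : Nonempty (G ≃g H) := by
  refine ⟨SimpleGraph.Iso.symm ⟨Equiv.ofBijective f hf, fun {x y} => ?_⟩⟩
  rw [D.adj_iff, D'.adj_iff, Equiv.ofBijective_apply, Equiv.ofBijective_apply, ← h, ← h,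
    hf.1.eq_iff, hf.1.eq_iff]

variable [Fintype V]

-- The children of a cycle vertex are middles of paths or leaves, according to whether they have a
-- child; these children are enumerated and the ends of the paths are then determined.
open Classical in
theorem nonempty_iso_pendants (D : UnicyclicData G 0) {s t : Fin 3 → ℕ}
    (hs : ∀ i, ((D.ch (D.c i)).filter fun x => (D.ch x).Nonempty).card = s i)
    (ht : ∀ i, ((D.ch (D.c i)).filter fun x => ¬ (D.ch x).Nonempty).card = t i)
    (h1 : ∀ x, D.ht x = 1 → ∀ u ∈ D.ch x, ∀ v ∈ D.ch x, u = v) (h2 : ∀ x, D.ht x ≤ 2) :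
    Nonempty (G ≃g cycleWithPendants 3 s t) := by
  have es : ∀ i, ∃ e : Fin (s i) → V, Function.Injective e ∧
      ∀ x, (∃ j, e j = x) ↔ x ∈ D.ch (D.c i) ∧ (D.ch x).Nonempty := by
    intro i
    refine ⟨fun j => (Finset.equivFinOfCardEq (hs i)).symm j,
      Subtype.val_injective.comp (Equiv.injective _), fun x => ?_⟩
    refine Iff.trans ?_ (Finset.mem_filter (p := fun x => (D.ch x).Nonempty))
    refine ⟨fun ⟨j, hj⟩ => hj ▸ Subtype.prop _, fun hx =>
      ⟨Finset.equivFinOfCardEq (hs i) ⟨x, hx⟩, by simp⟩⟩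
  have et : ∀ i, ∃ e : Fin (t i) → V, Function.Injective e ∧
      ∀ x, (∃ j, e j = x) ↔ x ∈ D.ch (D.c i) ∧ ¬ (D.ch x).Nonempty := by
    intro i
    refine ⟨fun j => (Finset.equivFinOfCardEq (ht i)).symm j,
      Subtype.val_injective.comp (Equiv.injective _), fun x => ?_⟩
    refine Iff.trans ?_ (Finset.mem_filter (p := fun x => ¬ (D.ch x).Nonempty))
    refine ⟨fun ⟨j, hj⟩ => hj ▸ Subtype.prop _, fun hx =>
      ⟨Finset.equivFinOfCardEq (ht i) ⟨x, hx⟩, by simp⟩⟩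
  choose e he hes using es
  choose g hg hgt using et
  have hmem : ∀ i j, e i j ∈ D.ch (D.c i) ∧ (D.ch (e i j)).Nonempty := fun i j =>
    (hes i _).1 ⟨j, rfl⟩
  have hgmem : ∀ i j, g i j ∈ D.ch (D.c i) ∧ ¬ (D.ch (g i j)).Nonempty := fun i j =>
    (hgt i _).1 ⟨j, rfl⟩
  have hch : ∀ i j, ∃ y, y ∈ D.ch (e i j) := fun i j => (hmem i j).2
  choose d hd using hch
  have hte : ∀ i j, D.ht (e i j) = 1 := fun i j => by
    rw [D.ht_of_mem_ch (hmem i j).1, D.ht_c]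
  have htg : ∀ i j, D.ht (g i j) = 1 := fun i j => by
    rw [D.ht_of_mem_ch (hgmem i j).1, D.ht_c]
  have htd : ∀ i j, D.ht (d i j) = 2 := fun i j => by
    rw [D.ht_of_mem_ch (hd i j), hte]
  have ne : ∀ i j, D.nxt (e i j) = D.c i := fun i j => (D.mem_ch.1 (hmem i j).1).2
  have ng : ∀ i j, D.nxt (g i j) = D.c i := fun i j => (D.mem_ch.1 (hgmem i j).1).2
  have nd : ∀ i j, D.nxt (d i j) = e i j := fun i j => (D.mem_ch.1 (hd i j)).2
  have einj : ∀ i j i' j', e i j = e i' j' → (⟨i, j⟩ : Σ i, Fin (s i)) = ⟨i', j'⟩ := by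
    intro i j i' j' h
    have h' := congrArg D.nxt h
    rw [ne, ne] at h'
    obtain rfl := D.c_inj h'
    rw [he i h]
  have ginj : ∀ i j i' j', g i j = g i' j' → (⟨i, j⟩ : Σ i, Fin (t i)) = ⟨i', j'⟩ := by
    intro i j i' j' h
    have h' := congrArg D.nxt h
    rw [ng, ng] at h'
    obtain rfl := D.c_inj h'
    rw [hg i h]
  refine D.nonempty_iso (pendantData s t) (f := fun
    | .inl i => D.c i
    | .inr (.inl p) => e p.1 p.2
    | .inr (.inr (.inl p)) => d p.1 p.2
    | .inr (.inr (.inr p)) => g p.1 p.2) ⟨?_, ?_⟩ ?_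
  · have hc := D.ht_c
    intro x y hxy
    have hh := congrArg D.ht hxy
    rcases x with i | ⟨i, j⟩ | ⟨i, j⟩ | ⟨i, j⟩ <;>
      rcases y with i' | ⟨i', j'⟩ | ⟨i', j'⟩ | ⟨i', j'⟩ <;>
      simp only [hc, hte, htg, htd] at hh hxy <;> try omega
    · rw [D.c_inj hxy]
    · rw [einj _ _ _ _ hxy]
    · exact absurd (hxy ▸ (hmem i j).2) (hgmem i' j').2
    · have := congrArg D.nxt hxy
      rw [nd, nd] at this
      rw [einj _ _ _ _ this]
    · exact absurd (hxy ▸ (hmem i' j').2) (hgmem i j).2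
    · rw [ginj _ _ _ _ hxy]
  · have hone : ∀ v, D.ht v = 1 → ∃ i, v ∈ D.ch (D.c i) := by
      intro v hv
      have := D.ht_nxt v (by omega)
      obtain ⟨i, hi⟩ := (D.ht_eq_zero (D.nxt v)).1 (by omega)
      exact ⟨i, D.mem_ch.2 ⟨by omega, hi.symm⟩⟩
    intro v
    have hv := h2 v
    have hv' : D.ht v = 0 ∨ D.ht v = 1 ∨ D.ht v = 2 := by omega
    rcases hv' with h0 | h0 | h0
    · obtain ⟨i, hi⟩ := (D.ht_eq_zero v).1 h0
      exact ⟨.inl i, hi⟩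
    · obtain ⟨i, hi⟩ := hone v h0
      by_cases hn : (D.ch v).Nonempty
      · obtain ⟨j, hj⟩ := (hes i v).2 ⟨hi, hn⟩
        exact ⟨.inr (.inl ⟨i, j⟩), hj⟩
      · obtain ⟨j, hj⟩ := (hgt i v).2 ⟨hi, hn⟩
        exact ⟨.inr (.inr (.inr ⟨i, j⟩)), hj⟩
    · have h3 := D.ht_nxt v (by omega)
      have h4 : v ∈ D.ch (D.nxt v) := D.mem_ch.2 ⟨by omega, rfl⟩
      obtain ⟨i, hi⟩ := hone (D.nxt v) (by omega)
      obtain ⟨j, hj⟩ := (hes i _).2 ⟨hi, v, h4⟩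
      refine ⟨.inr (.inr (.inl ⟨i, j⟩)), ?_⟩
      exact h1 _ (hte i j) _ (hd i j) _ (hj ▸ h4)
  · intro x
    rcases x with i | ⟨i, j⟩ | ⟨i, j⟩ | ⟨i, j⟩
    · exact (D.nxt_c i).symm
    · exact (ne i j).symm
    · exact (nd i j).symm
    · exact (ng i j).symm

theorem card_eq_of_iso {W : Type*} [Fintype W] {H : SimpleGraph W} (h : Nonempty (G ≃g H)) :
    Fintype.card V = Fintype.card W := by
  obtain ⟨e⟩ := h
  exact Fintype.card_congr e.toEquiv

variable {k : ℕ} {D : UnicyclicData G k} [DecidableEq V] {A : Finset V}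

omit [Fintype V] [DecidableEq V] in
theorem eq_of_ends {u w x y : V} (hxy : x ≠ y) (h1 : u = x ∨ D.nxt u = x)
    (h2 : u = y ∨ D.nxt u = y) (h3 : w = x ∨ D.nxt w = x) (h4 : w = y ∨ D.nxt w = y) :
    u = w := by
  have := D.nxt_nxt_ne u
  have := D.nxt_nxt_ne w
  grind

omit [Fintype V] [DecidableEq V] in
theorem end_eq_or_eq {u x y r : V} (hxy : x ≠ y) (h1 : u = x ∨ D.nxt u = x)
    (h2 : u = y ∨ D.nxt u = y) (h3 : u = r ∨ D.nxt u = r) : r = x ∨ r = y := by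
  grind

omit [Fintype V] [DecidableEq V] in
theorem meet_iff {u v : V} :
    D.Meet u v ↔ ∃ x, (u = x ∨ D.nxt u = x) ∧ (v = x ∨ D.nxt v = x) := by
  unfold Meet
  constructor
  · rintro (h | h | h | h)
    exacts [⟨v, Or.inl h, Or.inl rfl⟩, ⟨_, Or.inl h, Or.inr rfl⟩, ⟨v, Or.inr h, Or.inl rfl⟩,
      ⟨_, Or.inr h, Or.inr rfl⟩]
  · rintro ⟨x, rfl | rfl, h | h⟩
    exacts [Or.inl h.symm, Or.inr (Or.inl h.symm), Or.inr (Or.inr (Or.inl h.symm)),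
      Or.inr (Or.inr (Or.inr h.symm))]

/-- Pairwise intersecting edges outside of a matching form a star, apart from one exception. -/
theorem exists_center (hA : D.IsMatchingSet A) (hm : ∀ u ∉ A, ∀ v ∉ A, D.Meet u v)
    (hv : ∀ x, D.val A x = 0 → D.val Aᶜ x = 1) (hne : Aᶜ.Nonempty)
    (hex : 3 < Aᶜ.card ∨ A.card < 3) : ∃ z, ∀ u ∉ A, u = z ∨ D.nxt u = z := by
  by_contra hc
  push Not at hc
  obtain ⟨v, hvA⟩ := hne
  rw [Finset.mem_compl] at hvA
  -- Without a common vertex, an edge `a` avoids one end of `v` and an edge `b` avoids the other.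
  -- The three edges then form a triangle on `v`, `nxt v` and `x`.
  obtain ⟨a, ha, ha1, ha2⟩ := hc v
  obtain ⟨b, hb, hb1, hb2⟩ := hc (D.nxt v)
  have hpq := (D.nxt_ne v).symm
  have haq : a = D.nxt v ∨ D.nxt a = D.nxt v := by
    have := hm a ha v hvA; unfold Meet at this; clear hm hc; tauto
  have hbp : b = v ∨ D.nxt b = v := by
    have := hm b hb v hvA; unfold Meet at this; clear hm hc; tauto
  obtain ⟨x, hax, hbx⟩ := meet_iff.1 (hm a ha b hb)
  have hxp : x ≠ v := by rintro rfl; exact hax.elim ha1 ha2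
  have hxq : x ≠ D.nxt v := by rintro rfl; exact hbx.elim hb1 hb2
  have hvp : v = v ∨ D.nxt v = v := Or.inl rfl
  have hvq : v = D.nxt v ∨ D.nxt v = D.nxt v := Or.inr rfl
  rcases hex with hex | hex
  -- An edge meeting all three sides of a triangle contains two of its vertices, hence is one of the
  -- sides.
  · have : Aᶜ ⊆ {v, a, b} := by
      intro d hd
      rw [Finset.mem_compl] at hd
      simp only [Finset.mem_insert, Finset.mem_singleton]
      have hcases : ∀ {u : V} {y z : V}, u ∉ A → y ≠ z → (u = y ∨ D.nxt u = y) →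
          (u = z ∨ D.nxt u = z) → (d = y ∨ D.nxt d = y) ∨ (d = z ∨ D.nxt d = z) := by
        intro u y z hu hyz h1 h2
        obtain ⟨r, hdr, hur⟩ := meet_iff.1 (hm d hd u hu)
        rcases end_eq_or_eq hyz h1 h2 hur with rfl | rfl
        · exact Or.inl hdr
        · exact Or.inr hdr
      have c1 := hcases hvA hpq hvp hvq
      have c2 := hcases ha hxq hax haq
      have c3 := hcases hb hxp hbx hbp
      by_cases e1 : d = v ∨ D.nxt d = v
      · by_cases e2 : d = D.nxt v ∨ D.nxt d = D.nxt v
        · exact Or.inl (eq_of_ends hpq e1 e2 hvp hvq)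
        · exact Or.inr (Or.inr (eq_of_ends hxp (c2.resolve_right e2) e1 hbx hbp))
      · exact Or.inr (Or.inl (eq_of_ends hxq (c3.resolve_right e1) (c1.resolve_left e1) hax haq))
    have := Finset.card_le_card this
    have := Finset.card_le_three (a := v) (b := a) (c := b)
    omega
  -- Each triangle vertex lies on two edges outside `A`, so by `hv` it is covered by `A`. The three
  -- covering edges are distinct, since an edge with two ends in the triangle is a side and not in
  -- `A`.
  · have hcov : ∀ {u w y : V}, u ∉ A → w ∉ A → u ≠ w → (u = y ∨ D.nxt u = y) →
        (w = y ∨ D.nxt w = y) → ∃ r ∈ A, r = y ∨ D.nxt r = y := by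
      intro u w y hu hw huw h1 h2
      refine D.exists_of_val_eq_one ((hA.val_eq y).resolve_left fun h0 => ?_)
      have h3 := hv y h0
      have h4 : ({u, w} : Finset V) ⊆ Aᶜ := by
        intro r hr
        simp only [Finset.mem_insert, Finset.mem_singleton] at hr
        rcases hr with rfl | rfl <;> simpa
      have h5 : D.val {u, w} y ≤ D.val Aᶜ y :=
        Finset.sum_le_sum_of_subset_of_nonneg h4 fun r _ _ => by split_ifs <;> norm_num
      rw [val, Finset.sum_pair huw] at h5
      have h6 : ∀ r, (r = y ∨ D.nxt r = y) →
          (1 : ℤ) ≤ (if r = y then 1 else 0) + if D.nxt r = y then 1 else 0 := by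
        rintro r (hr | hr) <;> simp [hr] <;> split_ifs <;> norm_num
      have h7 := h6 u h1
      have h8 := h6 w h2
      linarith
    have hva : v ≠ a := fun h => ha1 h.symm
    have hvb : v ≠ b := by rintro rfl; exact hb2 rfl
    have hab : a ≠ b := by rintro rfl; exact hbp.elim ha1 ha2
    obtain ⟨r1, hr1, e1⟩ := hcov hvA hb hvb hvp hbp
    obtain ⟨r2, hr2, e2⟩ := hcov hvA ha hva hvq haq
    obtain ⟨r3, hr3, e3⟩ := hcov ha hb hab hax hbx
    have h12 : r1 ≠ r2 := by
      rintro rfl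
      exact hvA (eq_of_ends hpq e1 e2 hvp hvq ▸ hr1)
    have h13 : r1 ≠ r3 := by
      rintro rfl
      exact hb (eq_of_ends hxp e3 e1 hbx hbp ▸ hr1)
    have h23 : r2 ≠ r3 := by
      rintro rfl
      exact ha (eq_of_ends hxq e3 e2 hax haq ▸ hr2)
    have : ({r1, r2, r3} : Finset V) ⊆ A := by
      intro r hr
      simp only [Finset.mem_insert, Finset.mem_singleton] at hr
      rcases hr with rfl | rfl | rfl <;> assumption
    have := Finset.card_le_card this
    rw [Finset.card_eq_three.2 ⟨r1, r2, r3, h12, h13, h23, rfl⟩] at this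
    omega

end UnicyclicData

end SignlessLaplacian

namespace SignlessLaplacian

open Polynomial Matrix

theorem card_cycleVertex (s t : Fin 3 → ℕ) :
    Fintype.card (CycleVertex 3 s t) = 3 + 2 * ∑ i, s i + ∑ i, t i := by
  simp
  ring

namespace UnicyclicData

variable {V : Type*} {G : SimpleGraph V} [Fintype V] [DecidableEq V] {A : Finset V}

theorem val_compl_eq_card {k : ℕ} {D : UnicyclicData G k} {z : V}
    (hz : ∀ u ∉ A, u = z ∨ D.nxt u = z) : D.val Aᶜ z = Aᶜ.card := by
  rw [val, Finset.card_eq_sum_ones, Nat.cast_sum]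
  refine Finset.sum_congr rfl fun u hu => ?_
  rcases hz u (by simpa using hu) with rfl | h
  · simp [D.nxt_ne]
  · rw [if_pos h, if_neg]
    · simp
    · rintro rfl
      exact D.nxt_ne _ h

/-- Edges avoiding the centre belong to `A` and so are pairwise disjoint. This leaves no trees at
the other two cycle vertices and only pieces of length at most two at the centre; their numbers
follow from the vertex count and the degree of the centre. -/
theorem IsMatchingSet.nonempty_iso_G31_of_triangle {D : UnicyclicData G 0}
    (hA : D.IsMatchingSet A) (hz : ∀ u ∉ A, u = D.c 2 ∨ D.nxt u = D.c 2)
    (hval : D.val A (D.c 2) = 1) (hmn : 2 * A.card ≤ Fintype.card V) :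
    Nonempty (G ≃g G31 (Fintype.card V) A.card) := by
  classical
  have hav : ∀ u v, D.Meet u v → u ≠ D.c 2 → D.nxt u ≠ D.c 2 → v ≠ D.c 2 → D.nxt v ≠ D.c 2 →
      u = v := by
    intro u v huv h1 h2 h3 h4
    exact hA.not_meet (by by_contra h; exact (hz u h).elim h1 h2)
      (by by_contra h; exact (hz v h).elim h3 h4) huv
  have hne : ∀ {v i}, D.ht v ≠ 0 → v ≠ D.c i := by
    rintro v i hv rfl
    exact hv (D.ht_c i)
  have c02 : D.c 0 ≠ D.c 2 := D.c_inj.ne (by decide)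
  have c12 : D.c 1 ≠ D.c 2 := D.c_inj.ne (by decide)
  have n0 : D.nxt (D.c 0) = D.c 1 := D.nxt_c 0
  have hch0 : D.ch (D.c 0) = ∅ := by
    refine Finset.eq_empty_of_forall_notMem fun x hx => ?_
    obtain ⟨h1, h2⟩ := D.mem_ch.1 hx
    refine hne h1 (hav x (D.c 0) (Or.inr (Or.inr (Or.inl h2))) (hne h1) ?_ c02 ?_)
    · rwa [h2]
    · rwa [n0]
  have hch1 : D.ch (D.c 1) = ∅ := by
    refine Finset.eq_empty_of_forall_notMem fun x hx => ?_
    obtain ⟨h1, h2⟩ := D.mem_ch.1 hx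
    refine hne h1 (hav x (D.c 0) (Or.inr (Or.inr (Or.inr (h2.trans n0.symm)))) (hne h1) ?_ c02 ?_)
    · rwa [h2]
    · rwa [n0]
  have h2 : ∀ x, D.ht x ≤ 2 := by
    intro v
    by_contra hv
    push Not at hv
    have h3 := D.ht_nxt v (by omega)
    have h4 := D.ht_nxt (D.nxt v) (by omega)
    exact D.nxt_ne v (hav _ _ (Or.inr (Or.inl rfl)) (hne (by omega)) (hne (by omega))
      (hne (by omega)) (hne (by omega)))
  have h1 : ∀ x, D.ht x = 1 → ∀ u ∈ D.ch x, ∀ v ∈ D.ch x, u = v := by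
    intro x hx u hu v hv
    obtain ⟨hu1, hu2⟩ := D.mem_ch.1 hu
    obtain ⟨hv1, hv2⟩ := D.mem_ch.1 hv
    exact hav u v (Or.inr (Or.inr (Or.inr (hu2.trans hv2.symm)))) (hne hu1)
      (hu2 ▸ hne (by omega)) (hne hv1) (hv2 ▸ hne (by omega))
  obtain ⟨a, ha⟩ : ∃ a, ((D.ch (D.c 2)).filter fun x => (D.ch x).Nonempty).card = a := ⟨_, rfl⟩
  obtain ⟨b, hb⟩ : ∃ b, ((D.ch (D.c 2)).filter fun x => ¬ (D.ch x).Nonempty).card = b := ⟨_, rfl⟩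
  have hiso : Nonempty (G ≃g cycleWithPendants 3 ![0, 0, a] ![0, 0, b]) := by
    refine D.nonempty_iso_pendants ?_ ?_ h1 h2 <;> intro i <;> fin_cases i
    · simp [hch0]
    · simp [hch1]
    · simpa using ha
    · simp [hch0]
    · simp [hch1]
    · simpa using hb
  have hab : (D.ch (D.c 2)).card = a + b := by
    rw [← ha, ← hb, Finset.card_filter_add_card_filter_not]
  have hn := card_eq_of_iso hiso
  rw [card_cycleVertex] at hn
  simp [Fin.sum_univ_three] at hn
  have hF := val_compl_eq_card hz
  have hdeg : ((a + b : ℕ) : ℤ) + 2 = 1 + Aᶜ.card := by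
    rw [← hab, ← hF, ← hval, ← D.val_union disjoint_compl_right, Finset.union_compl,
      ← D.degree_eq_val, D.degree_c]
    push_cast
    ring
  have hc := Finset.card_add_card_compl A
  obtain rfl : a = A.card - 2 := by omega
  obtain rfl : b = Fintype.card V - 2 * A.card + 1 := by omega
  exact hiso

/-- Two consecutive cycle edges meet, so they cannot both avoid the centre. Hence the centre is on
the cycle, and the cycle is a triangle. -/
theorem IsMatchingSet.nonempty_iso_G31 {k : ℕ} {D : UnicyclicData G k} (hk : Even k)
    (hA : D.IsMatchingSet A) {z : V} (hz : ∀ u ∉ A, u = z ∨ D.nxt u = z)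
    (hval : D.val A z = 1) (hmn : 2 * A.card ≤ Fintype.card V) :
    Nonempty (G ≃g G31 (Fintype.card V) A.card) := by
  have hav : ∀ u v, D.Meet u v → u ≠ z → D.nxt u ≠ z → v ≠ z → D.nxt v ≠ z → u = v := by
    intro u v huv h1 h2 h3 h4
    exact hA.not_meet (by by_contra h; exact (hz u h).elim h1 h2)
      (by by_contra h; exact (hz v h).elim h3 h4) huv
  obtain ⟨j, rfl⟩ : ∃ j, D.c j = z := by
    by_contra h
    push Not at h
    have h01 := hav (D.c 0) (D.c (0 + 1)) (Or.inr (Or.inr (Or.inl (D.nxt_c 0)))) (h 0)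
      (by rw [D.nxt_c]; exact h _) (h _) (by rw [D.nxt_c]; exact h _)
    rw [← D.nxt_c] at h01
    exact D.nxt_ne _ h01.symm
  have hk0 : k = 0 := by
    by_contra hk0
    have h1 : j + 1 ≠ j := by simp
    have h2 := fin_add_one_add_one_ne j
    have h3 : j + 1 + 1 + 1 ≠ j := by
      intro h
      rw [add_assoc, add_assoc] at h
      have h := congrArg Fin.val (add_eq_left.1 h)
      simp [Fin.val_add] at h
      rw [Nat.mod_eq_of_lt (by omega)] at h
      omega
    have h := hav (D.c (j + 1)) (D.c (j + 1 + 1)) (Or.inr (Or.inr (Or.inl (D.nxt_c _))))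
      (D.c_inj.ne h1) (by rw [D.nxt_c]; exact D.c_inj.ne h2) (D.c_inj.ne h2)
      (by rw [D.nxt_c]; exact D.c_inj.ne h3)
    rw [← D.nxt_c (j + 1)] at h
    exact D.nxt_ne _ h.symm
  subst hk0
  have e : (D.rotate (j - 2)).c 2 = D.c j := by
    show D.c (2 + (j - 2)) = D.c j
    rw [add_sub_cancel]
  refine IsMatchingSet.nonempty_iso_G31_of_triangle (D := D.rotate (j - 2)) hA ?_ ?_ hmn
  · rw [e]; exact hz
  · rw [e]; exact hval

/-- Every cycle vertex is matched to a child. A tree edge not attached to the centre is in `A`, so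
matched vertices are leaves, the other two cycle vertices have one child each, and no branch is
longer than two. -/
theorem IsMatchingSet.nonempty_iso_G32_of_center {D : UnicyclicData G 0}
    (hA : D.IsMatchingSet A) (hc : ∀ i, D.c i ∉ A)
    (hz : ∀ u ∉ A, D.ht u ≠ 0 → D.nxt u = D.c 2)
    (hval : ∀ i, D.val A (D.c i) = 1) (hmn : 2 * A.card ≤ Fintype.card V) :
    Nonempty (G ≃g G32 (Fintype.card V) A.card) := by
  classical
  have hne : ∀ {v i}, D.ht v ≠ 0 → v ≠ D.c i := by
    rintro v i hv rfl
    exact hv (D.ht_c i)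
  have c02 : D.c 0 ≠ D.c 2 := D.c_inj.ne (by decide)
  have c12 : D.c 1 ≠ D.c 2 := D.c_inj.ne (by decide)
  have hu : ∀ i, ∃ u ∈ A, u ∈ D.ch (D.c i) := by
    intro i
    obtain ⟨u, huA, h⟩ := D.exists_of_val_eq_one (hval i)
    have h0 : D.ht u ≠ 0 := by
      intro h0
      obtain ⟨j, rfl⟩ := (D.ht_eq_zero u).1 h0
      exact hc j huA
    exact ⟨u, huA, D.mem_ch.2 ⟨h0, h.resolve_left (hne h0)⟩⟩
  choose u huA huch using hu
  have hmem : ∀ v, D.ht v ≠ 0 → D.nxt v ≠ D.c 2 → v ∈ A := by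
    intro v h0 h
    by_contra hv
    exact h (hz v hv h0)
  have hleaf : ∀ v ∈ A, D.ch v = ∅ := by
    intro v hv
    refine Finset.eq_empty_of_forall_notMem fun x hx => ?_
    obtain ⟨h1, h2⟩ := D.mem_ch.1 hx
    have hv0 : D.ht v ≠ 0 := by
      intro h0
      obtain ⟨j, rfl⟩ := (D.ht_eq_zero v).1 h0
      exact hc j hv
    exact (hA x (hmem x h1 (h2 ▸ hne hv0))).1 (h2 ▸ hv)
  have hch : ∀ i, D.c i ≠ D.c 2 → D.ch (D.c i) = {u i} := by
    intro i hi
    refine Finset.eq_singleton_iff_unique_mem.2 ⟨huch i, fun x hx => ?_⟩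
    obtain ⟨h1, h2⟩ := D.mem_ch.1 hx
    exact (hA x (hmem x h1 (h2 ▸ hi))).2 _ (huA i) (h2.trans (D.mem_ch.1 (huch i)).2.symm)
  have h2 : ∀ x, D.ht x ≤ 2 := by
    intro v
    by_contra hv
    push Not at hv
    have h3 := D.ht_nxt v (by omega)
    have h4 := D.ht_nxt (D.nxt v) (by omega)
    exact (hA v (hmem v (by omega) (hne (by omega)))).1
      (hmem _ (by omega) (hne (by omega)))
  have h1 : ∀ x, D.ht x = 1 → ∀ u ∈ D.ch x, ∀ v ∈ D.ch x, u = v := by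
    intro x hx u hu v hv
    obtain ⟨hu1, hu2⟩ := D.mem_ch.1 hu
    obtain ⟨hv1, hv2⟩ := D.mem_ch.1 hv
    exact (hA u (hmem u hu1 (hu2 ▸ hne (by omega)))).2 v (hmem v hv1 (hv2 ▸ hne (by omega)))
      (hu2.trans hv2.symm)
  obtain ⟨a, ha⟩ : ∃ a, ((D.ch (D.c 2)).filter fun x => (D.ch x).Nonempty).card = a := ⟨_, rfl⟩
  obtain ⟨b, hb⟩ : ∃ b, ((D.ch (D.c 2)).filter fun x => ¬ (D.ch x).Nonempty).card = b := ⟨_, rfl⟩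
  have hiso : Nonempty (G ≃g cycleWithPendants 3 ![0, 0, a] ![1, 1, b]) := by
    refine D.nonempty_iso_pendants ?_ ?_ h1 h2 <;> intro i <;> fin_cases i
    · simp [hch 0 c02, Finset.filter_singleton, hleaf _ (huA _)]
    · simp [hch 1 c12, Finset.filter_singleton, hleaf _ (huA _)]
    · simpa using ha
    · simp [hch 0 c02, Finset.filter_singleton, hleaf _ (huA _)]
    · simp [hch 1 c12, Finset.filter_singleton, hleaf _ (huA _)]
    · simpa using hb
  have hab : (D.ch (D.c 2)).card = a + b := by
    rw [← ha, ← hb, Finset.card_filter_add_card_filter_not]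
  have hn := card_eq_of_iso hiso
  rw [card_cycleVertex] at hn
  simp [Fin.sum_univ_three] at hn
  have hF : Aᶜ = Finset.univ.image D.c ∪ (D.ch (D.c 2)).erase (u 2) := by
    ext v
    rw [Finset.mem_compl, Finset.mem_union, Finset.mem_erase]
    constructor
    · intro hv
      by_cases h0 : D.ht v = 0
      · left
        simpa using (D.ht_eq_zero v).1 h0
      · right
        exact ⟨fun h => hv (h ▸ huA 2), D.mem_ch.2 ⟨h0, hz v hv h0⟩⟩
    · rintro (h | ⟨h, h'⟩) hv
      · obtain ⟨i, -, rfl⟩ := Finset.mem_image.1 h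
        exact hc i hv
      · exact h ((hA v hv).2 _ (huA 2) ((D.mem_ch.1 h').2.trans (D.mem_ch.1 (huch 2)).2.symm))
  have hcard := congrArg Finset.card hF
  rw [Finset.card_union_of_disjoint, Finset.card_image_of_injective _ D.c_inj,
    Finset.card_erase_of_mem (huch 2), hab] at hcard
  · have hpos : 0 < a + b := hab ▸ Finset.card_pos.2 ⟨_, huch 2⟩
    simp at hcard
    have hcc := Finset.card_add_card_compl A
    obtain rfl : a = A.card - 3 := by omega
    obtain rfl : b = Fintype.card V - 2 * A.card + 1 := by omega
    exact hiso
  · rw [Finset.disjoint_left]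
    intro v hv hv'
    obtain ⟨i, -, rfl⟩ := Finset.mem_image.1 hv
    exact (D.mem_ch.1 (Finset.mem_of_mem_erase hv')).1 (D.ht_c i)

theorem IsMatchingSet.nonempty_iso_G32 {D : UnicyclicData G 0}
    (hA : D.IsMatchingSet A) (hc : ∀ i, D.c i ∉ A)
    (hm : ∀ u ∉ A, D.ht u ≠ 0 → ∀ v ∉ A, D.ht v ≠ 0 → D.Meet u v)
    (hz : ∀ u ∉ A, D.ht u ≠ 0 → D.ht (D.nxt u) = 0)
    (hval : ∀ i, D.val A (D.c i) = 1) (hmn : 2 * A.card ≤ Fintype.card V) :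
    Nonempty (G ≃g G32 (Fintype.card V) A.card) := by
  obtain ⟨j, hj⟩ : ∃ j, ∀ u ∉ A, D.ht u ≠ 0 → D.nxt u = D.c j := by
    by_cases h : ∃ v ∉ A, D.ht v ≠ 0
    · obtain ⟨v, hv, hv0⟩ := h
      obtain ⟨j, hj⟩ := (D.ht_eq_zero _).1 (hz v hv hv0)
      refine ⟨j, fun u hu hu0 => ?_⟩
      rw [hj]
      rcases hm u hu hu0 v hv hv0 with h | h | h | h
      · rw [h]
      · exact absurd (h ▸ hz v hv hv0) hu0
      · exact absurd (h ▸ hz u hu hu0) hv0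
      · exact h
    · push Not at h
      exact ⟨0, fun u hu hu0 => absurd (h u hu) hu0⟩
  have e : (D.rotate (j - 2)).c 2 = D.c j := by
    show D.c (2 + (j - 2)) = D.c j
    rw [add_sub_cancel]
  refine IsMatchingSet.nonempty_iso_G32_of_center (D := D.rotate (j - 2)) hA (fun i => hc _) ?_
    (fun i => hval _) hmn
  rw [e]
  exact hj

end UnicyclicData

end SignlessLaplacian

/-! ### Comparison of the class with the two extremal graphs. -/

namespace SignlessLaplacian

open Polynomial Matrix

theorem phiPoly_G31 (n m : ℕ) : phiPoly (G31 n m) =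
    oneTree X (al X (n - 2 * m + 1) (m - 2)) (sg X (n - 2 * m + 1) (m - 2)) := by
  rw [phiPoly_pendants, ← cyclicVal_oneTree]
  simp [List.ofFn_succ]

theorem phiPoly_G32 (n m : ℕ) : phiPoly (G32 n m) =
    threeTrees X (al X (n - 2 * m + 1) (m - 3)) (sg X (n - 2 * m + 1) (m - 3)) := by
  have h : (1 + X + X : ℤ[X]) = 1 + 2 * X := by ring
  rw [phiPoly_pendants, threeTrees]
  simp [List.ofFn_succ, al_one_zero, sg_one_zero, h]

theorem isOddUnicyclic_G31 {n m : ℕ} (hm : 2 ≤ m) (hnm : 2 * m ≤ n) :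
    IsOddUnicyclic n m (G31 n m) where
  card_eq := by
    rw [card_cycleVertex]
    simp [Fin.sum_univ_three]
    omega
  unicyclic := (pendantData _ _).isUnicyclic
  odd_girth := by
    rw [(pendantData _ _).girth_eq_three]
    decide
  matchingNumber_eq := by
    rw [matchingNumber_pendants (by simp)]
    simp [Fin.sum_univ_three]
    omega

theorem isOddUnicyclic_G32 {n m : ℕ} (hm : 3 ≤ m) (hnm : 2 * m ≤ n) :
    IsOddUnicyclic n m (G32 n m) where
  card_eq := by
    rw [card_cycleVertex]
    simp [Fin.sum_univ_three]
    omega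
  unicyclic := (pendantData _ _).isUnicyclic
  odd_girth := by
    rw [(pendantData _ _).girth_eq_three]
    decide
  matchingNumber_eq := by
    rw [matchingNumber_pendants (by simp)]
    simp [Fin.sum_univ_three]
    omega

/-- Both degree sums are twice the number of vertices, so the second coefficient decreases as the
sum of squares grows. -/
theorem UnicyclicData.sum_sq_le {V W : Type*} [Fintype V] [Fintype W] [DecidableEq V]
    [DecidableEq W] {G : SimpleGraph V}
    {H : SimpleGraph W} {k l : ℕ} (D : UnicyclicData G k) (D' : UnicyclicData H l)
    (hVW : Fintype.card V = Fintype.card W) (h : phiPoly G ≤ phiPoly H) :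
    ∑ x, D'.val Finset.univ x ^ 2 ≤ ∑ x, D.val Finset.univ x ^ 2 := by
  classical
  have h1 := two_mul_coeff_two_phiPoly G
  have h2 := two_mul_coeff_two_phiPoly H
  simp only [D.degree_eq_val, D'.degree_eq_val, sum_val, Finset.card_univ, hVW] at h1 h2
  have := h 2
  linarith

theorem sum_sq_G31 {n m : ℕ} (hm : 2 ≤ m) (hnm : 2 * m ≤ n) :
    ∑ x, (pendantData ![0, 0, m - 2] ![0, 0, n - 2 * m + 1]).val Finset.univ x ^ 2 =
      ((n : ℤ) - m) ^ 2 - (n - m) + 4 * n := by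
  have h := pendantData_sum_sq ![0, 0, m - 2] ![0, 0, n - 2 * m + 1]
  obtain ⟨a, rfl⟩ := Nat.exists_eq_add_of_le hm
  obtain ⟨b, rfl⟩ := Nat.exists_eq_add_of_le hnm
  convert h using 1
  simp [Fin.sum_univ_three]
  ring

theorem sum_sq_G32 {n m : ℕ} (hm : 3 ≤ m) (hnm : 2 * m ≤ n) :
    ∑ x, (pendantData ![0, 0, m - 3] ![1, 1, n - 2 * m + 1]).val Finset.univ x ^ 2 =
      ((n : ℤ) - m) ^ 2 + (n - m) + 4 * m + 6 := by
  have h := pendantData_sum_sq ![0, 0, m - 3] ![1, 1, n - 2 * m + 1]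
  obtain ⟨a, rfl⟩ := Nat.exists_eq_add_of_le hm
  obtain ⟨b, rfl⟩ := Nat.exists_eq_add_of_le hnm
  convert h using 1
  simp [Fin.sum_univ_three]
  ring

theorem not_G31_le_G32 {n m : ℕ} (hm : 3 ≤ m) : ¬ phiPoly (G31 n m) ≤ phiPoly (G32 n m) := by
  rw [phiPoly_G31, phiPoly_G32]
  obtain ⟨a, rfl⟩ := Nat.exists_eq_add_of_le hm
  rw [show 3 + a - 2 = a + 1 by omega, show 3 + a - 3 = a by omega]
  exact not_oneTree_le_threeTrees _ _

/-- The two sums of squares of degrees differ by `2 * (n - m - 3)`. -/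
theorem not_G32_le_G31 {n m : ℕ} (hm : 3 ≤ m) (hnm : 2 * m ≤ n) (h : 3 < n - m) :
    ¬ phiPoly (G32 n m) ≤ phiPoly (G31 n m) := by
  intro hle
  have h1 := UnicyclicData.sum_sq_le (pendantData _ _) (pendantData _ _)
    ((isOddUnicyclic_G32 hm hnm).card_eq.trans (isOddUnicyclic_G31 (by omega) hnm).card_eq.symm) hle
  have h2 := sum_sq_G31 (by omega) hnm
  have h3 := sum_sq_G32 hm hnm
  have h4 : (3 : ℤ) < n - m := by omega
  linarith

section Class

variable {V : Type*} [Fintype V] {G : SimpleGraph V} {n m : ℕ}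

theorem IsOddUnicyclic.exists_data (hG : IsOddUnicyclic n m G) :
    ∃ (k : ℕ) (D : UnicyclicData G k) (A : Finset V), Even k ∧ D.IsMatchingSet A ∧ A.card = m := by
  obtain ⟨k, hk, ⟨D⟩⟩ := UnicyclicData.exists_of_isUnicyclic hG.unicyclic hG.odd_girth
  obtain ⟨⟨A, hA, hcard⟩, -⟩ := D.isGreatest_matchingNumber
  exact ⟨k, D, A, hk, hA, hcard.trans hG.matchingNumber_eq⟩

theorem IsOddUnicyclic.le_or_le (hG : IsOddUnicyclic n m G) (hm : 2 ≤ m) :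
    phiPoly (G31 n m) ≤ phiPoly G ∨ 3 ≤ m ∧ phiPoly (G32 n m) ≤ phiPoly G := by
  classical
  obtain ⟨k, D, A, hk, hA, rfl⟩ := hG.exists_data
  rw [phiPoly_G31, phiPoly_G32, ← hG.card_eq]
  exact (D.main_bound hk hA hm).imp_right fun h => ⟨h.1, h.2.1⟩

theorem IsOddUnicyclic.iso_G31 (hG : IsOddUnicyclic n m G) (hm : 2 ≤ m) (hnm : 2 * m ≤ n)
    (hex : 3 < n - m ∨ m < 3) (h : phiPoly G ≤ phiPoly (G31 n m)) :
    Nonempty (G ≃g G31 n m) := by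
  classical
  obtain ⟨k, D, A, hk, hA, rfl⟩ := hG.exists_data
  have h1 := D.sum_sq_le (pendantData _ _)
    (hG.card_eq.trans (isOddUnicyclic_G31 hm hnm).card_eq.symm) h
  rw [sum_sq_G31 hm hnm] at h1
  have hc := Finset.card_add_card_compl A
  have hn := hG.card_eq
  subst hn
  have hc' : (Aᶜ.card : ℤ) = Fintype.card V - A.card := by omega
  rw [← hc'] at h1
  obtain ⟨h2, h3⟩ := hA.meet_of_sum_sq h1
  obtain ⟨z, hz⟩ := UnicyclicData.exists_center hA h2 h3
    (Finset.card_pos.1 (by omega)) (by omega)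
  -- If `A` missed the centre, only one edge outside `A` would be there, but all `n - m ≥ 2` of them
  -- are.
  refine hA.nonempty_iso_G31 hk hz ((hA.val_eq z).resolve_left fun h0 => ?_) hnm
  have h4 := h3 z h0
  rw [UnicyclicData.val_compl_eq_card hz] at h4
  omega

theorem IsOddUnicyclic.iso_G32 (hG : IsOddUnicyclic n m G) (hm : 3 ≤ m) (hnm : 2 * m ≤ n)
    (h : phiPoly G ≤ phiPoly (G32 n m)) : Nonempty (G ≃g G32 n m) := by
  classical
  obtain ⟨k, D, A, hk, hA, rfl⟩ := hG.exists_data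
  have h1 := D.sum_sq_le (pendantData _ _)
    (hG.card_eq.trans (isOddUnicyclic_G32 hm hnm).card_eq.symm) h
  rw [sum_sq_G32 hm hnm] at h1
  have hn := hG.card_eq
  subst hn
  -- The first alternative would place $G_3^1$ below $G_3^2$; the second one provides a triangle
  -- avoided by the matching.
  rcases D.main_bound hk hA (by omega) with h2 | ⟨-, -, rfl, hc⟩
  · rw [← phiPoly_G31] at h2
    exact absurd (h2.trans h) (not_G31_le_G32 hm)
  · obtain ⟨h3, h4, h5⟩ := hA.meet_of_sum_sq_of_triangle hc
      (b := (Fintype.card V : ℤ) - A.card - 3) (by ring) (le_trans (le_of_eq (by ring)) h1)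
    exact hA.nonempty_iso_G32 hc h3 h4 h5 hnm

end Class

end SignlessLaplacian


theorem theorem4p1 (n m : ℕ) (hnm : 2 * m ≤ n) :
    (m = 2 →
      IsOddUnicyclic n m (G31 n m) ∧
      ∀ (V : Type u) [Fintype V] (G : SimpleGraph V), IsOddUnicyclic n m G →
        CoeffLE n (G31 n m) G ∧
        (CoeffLE n G (G31 n m) →
          Nonempty (G ≃g G31 n m))) ∧
    (n - m ≤ 3 ∧ 6 ≤ n ∧ n ≤ 12 ∧ 3 ≤ m →
      IsOddUnicyclic n m (G32 n m) ∧
      ∀ (V : Type u) [Fintype V] (G : SimpleGraph V), IsOddUnicyclic n m G →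
        CoeffLE n (G32 n m) G ∧
        (CoeffLE n G (G32 n m) →
          Nonempty (G ≃g G32 n m))) ∧
    ((n - m > 3 ∧ 3 ≤ m) ∨ (n > 12 ∧ 3 ≤ m) →
      IsOddUnicyclic n m (G31 n m) ∧
      IsOddUnicyclic n m (G32 n m) ∧
      (∀ (V : Type u) [Fintype V] (G : SimpleGraph V), IsOddUnicyclic n m G →
        (CoeffLE n (G31 n m) G ∨
          CoeffLE n (G32 n m) G) ∧
        (CoeffLE n G (G31 n m) →
          Nonempty (G ≃g G31 n m)) ∧
        (CoeffLE n G (G32 n m) →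
          Nonempty (G ≃g G32 n m))) ∧
      ¬ CoeffLE n (G31 n m) (G32 n m) ∧
      ¬ CoeffLE n (G32 n m) (G31 n m)) := by
  refine ⟨?_, ?_, ?_⟩
  · rintro rfl
    have h1 := isOddUnicyclic_G31 le_rfl hnm
    refine ⟨h1, fun V _ G hG => ?_⟩
    rw [coeffLE_iff _ _ h1.card_eq hG.card_eq, coeffLE_iff _ _ hG.card_eq h1.card_eq]
    exact ⟨(hG.le_or_le le_rfl).resolve_right fun h => absurd h.1 (by norm_num),
      hG.iso_G31 le_rfl hnm (Or.inr (by norm_num))⟩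
  · rintro ⟨h3, h6, -, hm⟩
    have h1 := isOddUnicyclic_G32 hm hnm
    refine ⟨h1, fun V _ G hG => ?_⟩
    rw [coeffLE_iff _ _ h1.card_eq hG.card_eq, coeffLE_iff _ _ hG.card_eq h1.card_eq]
    refine ⟨(hG.le_or_le (by omega)).elim (fun h => le_trans ?_ h) fun h => h.2,
      hG.iso_G32 hm hnm⟩
    -- From `2 * m ≤ n` and `n - m ≤ 3` one gets `m ≤ 3`, so this case consists of a single pair of
    -- parameters.
    obtain rfl : m = 3 := by omega
    obtain rfl : n = 6 := by omega
    rw [phiPoly_G31, phiPoly_G32]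
    exact threeTrees_le_oneTree X_nonneg
  · intro h
    have hm : 3 ≤ m := h.elim And.right And.right
    -- If `n > 12`, then `n - m ≥ n / 2` already exceeds 3.
    have hd : 3 < n - m := by omega
    have h1 := isOddUnicyclic_G31 (by omega) hnm
    have h2 := isOddUnicyclic_G32 hm hnm
    refine ⟨h1, h2, fun V _ G hG => ?_, ?_, ?_⟩
    · rw [coeffLE_iff _ _ h1.card_eq hG.card_eq, coeffLE_iff _ _ hG.card_eq h1.card_eq,
        coeffLE_iff _ _ h2.card_eq hG.card_eq, coeffLE_iff _ _ hG.card_eq h2.card_eq]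
      exact ⟨(hG.le_or_le (by omega)).imp_right And.right,
        hG.iso_G31 (by omega) hnm (Or.inl hd), hG.iso_G32 hm hnm⟩
    · rw [coeffLE_iff _ _ h1.card_eq h2.card_eq]
      exact not_G31_le_G32 hm
    · rw [coeffLE_iff _ _ h2.card_eq h1.card_eq]
      exact not_G32_le_G31 hm hnm hd
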